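/- **Setting.** Let $p\ge 1$ and let $\Omega=\mathrm{Int}\big(\bigcup_{k}\overline{\Omega_k}\big)\subset\mathbb R^2$ be a geometrically conforming multipatch domain with finitely many pairwise disjoint patches $\Omega_k=F_k((0,1)^2)$, where $F_k$ is a $C^1$ diffeomorphism of $[0,1]^2$ onto $\overline{\Omega_k}$; the interface $\overline{\Omega_k}\cap\overline{\Omega_l}$ of two distinct patches is empty, a common vertex, or a common edge, on which (up to a symmetry of the reference square on each side) the two parametrizations coincide. On patch $k$ let $0=\xi_0=\dots=\xi_p<\xi_{p+1}<\dots<\xi_{n_k+1}=\dots=\xi_{n_k+1+p}=1$ be knots with at least three cells ($n_k\ge p+2$), let $\mathbb V^0_k=\mathrm{span}\{\lambda^k_i:0\le i\le n_k\}$ and $\mathbb V^1_k=\mathrm{span}\{\lambda^{1,k}_i:0\le i<n_k\}$ be the associated spaces of splines of degree $p$ and $p-1$ with their B-spline bases, and let $\hat V^1_k=(\mathbb V^1_k\otimes\mathbb V^0_k)\times(\mathbb V^0_k\otimes\mathbb V^1_k)$ and $V^1_k=\{(DF_k^{-T}\hat u)\circ F_k^{-1}:\hat u\in\hat V^1_k\}$.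 Put $$V^1_{pw}=\{v\in L^2(\Omega)^2: v|_{\Omega_k}\in V^1_k\ \text{for all }k\},\qquad V^1_h=V^1_{pw}\cap H(\mathrm{curl};\Omega).$$ Each interior edge $e$ is shared by two patches $k^-,k^+$, and $\mathbb V^0_{k^-}\subset\mathbb V^0_{k^+}$ in the common parametrization of $e$. **Edge projections.** Let $0\le r\le p$. Fix an interior edge $e$ and use on the two reference squares edge-local coordinates: $t\in[0,1]$ along $e$, the same on both sides, and the distance $s\in[0,1]$ to $e$. Number the basis functions accordingly, so that in the perpendicular direction the index $0$ belongs to $e$. For $\pm$ write $\lambda^{1,\pm}_i$ for the parallel basis functions, $\lambda^\pm_{\perp,j}$ for the perpendicular basis functions (extended by $0$ to the other side), and let $(\gamma^\pm_m)_{1\le m\le r}$ be the solution of $$\sum_{m=1}^r\gamma^\pm_m\int_0^1\lambda^\pm_{\perp,m}\,q=\int_0^1\lambda^\pm_{\perp,0}\,q\qquad\text{for all polynomials } q \text{ of degree}<r .$$ Let $R^1:\mathbb V^1_{k^+}\to\mathbb V^1_{k^-}$ be the $L^2(0,1)$-projection along $e$, and $$\bar\lambda_\perp=\tfrac12(\lambda^-_{\perp,0}+\lambda^+_{\perp,0}),\qquad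 C=\tfrac12\sum_{m=1}^r\big(\gamma^-_m\lambda^-_{\perp,m}-\gamma^+_m\lambda^+_{\perp,m}\big).$$ Then $P^1_e:V^1_{pw}\to V^1_{pw}$ is the linear map which acts on the pullbacks of the basis fields, for the component tangential to $e$, by $$\lambda^{1,-}_i\otimes\lambda^-_{\perp,0}\mapsto\lambda^{1,-}_i\otimes(\bar\lambda_\perp+C),\qquad \lambda^{1,+}_i\otimes\lambda^+_{\perp,0}\mapsto R^1\lambda^{1,+}_i\otimes(\bar\lambda_\perp-C),$$ and which is the identity on all other basis fields (tangential ones with perpendicular index $j\neq0$, the other component on $\Omega_{k^\pm}$, all fields of the other patches). **Theorem.** The operators $P^1_e$ are well defined and commute with each other, so that $P^1=\prod_e P^1_e$, the product over all interior edges, does not depend on the order of the factors. $P^1$ is a projection of $V^1_{pw}$ onto $V^1_h$, i.e. $P^1v\in V^1_h$ for all $v\in V^1_{pw}$ and $P^1v=v$ for all $v\in V^1_h$; in particular the tangential component of $P^1v$ is continuous across every interior edge. Moreover $P^1$ preserves polynomial moments of order $r$: for all $v\in V^1_{pw}$, all $k$ and all vector-valued polynomials $q$ on $(0,1)^2$ of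 degree at most $r-1$ in each variable, $$\int_{(0,1)^2}DF_k^T\,\big((P^1v)\circ F_k\big)\cdot q=\int_{(0,1)^2}DF_k^T\,(v\circ F_k)\cdot q .$$ -/

import Mathlib

open MeasureTheory Set
open scoped ContDiff

noncomputable section

/-! ### The plane and the reference square -/

/-- The Euclidean plane. -/
abbrev Plane : Type := EuclideanSpace ℝ (Fin 2)

/-- The coordinate unit vectors of the plane. -/
def unitVec (d : Fin 2) : Plane := EuclideanSpace.single d 1

/-- The (open) reference domain `(0,1)²`. -/
def openSquare : Set Plane := {x | ∀ i, x i ∈ Ioo (0 : ℝ) 1}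

/-- The closed reference domain `[0,1]²`. -/
def closedSquare : Set Plane := {x | ∀ i, x i ∈ Icc (0 : ℝ) 1}

/-- The four corners of the reference domain. -/
def corners : Set Plane := {x | ∀ i, x i = 0 ∨ x i = 1}

/-! ### Univariate splines -/

/-- B-splines on `[0,1]` by the Cox–de Boor recursion (with the usual convention `0 / 0 = 0`);
`bspline ξ q i` has degree `q` and knots `ξ i, …, ξ (i + q + 1)`. The last non-empty knot interval
is closed on the right, so that the splines are also defined at the end point `1`. -/
def bspline (ξ : ℕ → ℝ) : ℕ → ℕ → ℝ → ℝ
  | 0, i, x =>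
      open Classical in
      if ξ i ≤ x ∧ (x < ξ (i + 1) ∨ (x = 1 ∧ ξ i < 1 ∧ ξ (i + 1) = 1)) then 1 else 0
  | q + 1, i, x =>
      (x - ξ i) / (ξ (i + q + 1) - ξ i) * bspline ξ q i x +
        (ξ (i + q + 2) - x) / (ξ (i + q + 2) - ξ (i + 1)) * bspline ξ q (i + 1) x

/-- An open knot vector `0 = ξ_0 = ⋯ = ξ_p < ξ_{p+1} < ⋯ < ξ_{n+1} = ⋯ = ξ_{n+1+p} = 1`
with at least three cells, i.e. `N = n + 1 - p ≥ 3`. (Values `ξ i` with `i > n + 1 + p` play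
no role.) -/
structure KnotVector (p : ℕ) where
  n : ℕ
  ξ : ℕ → ℝ
  three_cells : p + 2 ≤ n
  eq_zero : ∀ i ≤ p, ξ i = 0
  strictMono : StrictMonoOn ξ (Icc p (n + 1))
  eq_one : ∀ i ∈ Icc (n + 1) (n + 1 + p), ξ i = 1

namespace KnotVector

variable {p : ℕ} (Ξ : KnotVector p)

/-- The basis function `λ_i`, `0 ≤ i ≤ n`, of `𝕍⁰ = 𝕊^p[Ξ]`. -/
def lam0 (i : ℕ) : ℝ → ℝ := bspline Ξ.ξ p i

/-- The basis function `λ¹_i`, `0 ≤ i ≤ n - 1`, of `𝕍¹ = 𝕊^{p-1}[Ξ']`, where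
`Ξ' = (ξ_1, …, ξ_{n+p})`. -/
def lam1 (i : ℕ) : ℝ → ℝ := bspline (fun j => Ξ.ξ (j + 1)) (p - 1) i

/-- The functions `λ_i`, seen through a possibly reversed coordinate on `[0,1]` and then
numbered in the reversed order. -/
def lam0' (rev : Bool) (i : ℕ) (t : ℝ) : ℝ :=
  if rev then Ξ.lam0 (Ξ.n - i) (1 - t) else Ξ.lam0 i t

/-- The functions `λ¹_i`, seen through a possibly reversed coordinate on `[0,1]` and then
numbered in the reversed order. -/
def lam1' (rev : Bool) (i : ℕ) (t : ℝ) : ℝ :=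
  if rev then Ξ.lam1 (Ξ.n - 1 - i) (1 - t) else Ξ.lam1 i t

/-- The space `𝕍⁰`, seen through a possibly reversed coordinate. -/
def space0 (rev : Bool) : Submodule ℝ (ℝ → ℝ) :=
  Submodule.span ℝ (range fun i : Fin (Ξ.n + 1) => Ξ.lam0' rev i)

/-- The correction coefficients `γ^{1d} = (γ_1, …, γ_r)` : the solution of
`∑_m γ_m ∫ λ_m q_j = ∫ λ_0 q_j` for the monomials `q_j` of degree `< r`. The entry `m : Fin r`
stands for the basis function of index `m + 1`. -/
def gamma (rev : Bool) (r : ℕ) : Fin r → ℝ :=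
  (Matrix.of fun j m : Fin r =>
      ∫ x in (0 : ℝ)..1, Ξ.lam0' rev (m + 1) x * x ^ (j : ℕ))⁻¹.mulVec
    fun j : Fin r => ∫ x in (0 : ℝ)..1, Ξ.lam0' rev 0 x * x ^ (j : ℕ)

/-- The `L²(0,1)`-projection onto the space `𝕍¹` (seen through a possibly reversed coordinate),
through its mass matrix. -/
def l2Proj1 (rev : Bool) (f : ℝ → ℝ) (t : ℝ) : ℝ :=
  ∑ j : Fin Ξ.n,
    ((Matrix.of fun i j : Fin Ξ.n =>
        ∫ x in (0 : ℝ)..1, Ξ.lam1' rev i x * Ξ.lam1' rev j x)⁻¹.mulVec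
      fun i : Fin Ξ.n => ∫ x in (0 : ℝ)..1, Ξ.lam1' rev i x * f x) j * Ξ.lam1' rev j t

/-- The vector-valued tensor-product basis functions of the logical space `V̂¹` : the component
`d` is `λ¹_i(x_d) λ_j(x_{d'})`, where `d'` is the other direction, and the component `d'` is `0`. -/
def hatBasis1 (d : Fin 2) (i j : ℕ) (x : Plane) : Plane :=
  (Ξ.lam1 i (x d) * Ξ.lam0 j (x d.rev)) • unitVec d

/-- The logical space `V̂¹ = (𝕍¹ ⊗ 𝕍⁰) × (𝕍⁰ ⊗ 𝕍¹)`. -/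
def hatV1 : Submodule ℝ (Plane → Plane) :=
  Submodule.span ℝ
    (range fun a : Fin 2 × Fin Ξ.n × Fin (Ξ.n + 1) => Ξ.hatBasis1 a.1 a.2.1 a.2.2)

end KnotVector

/-! ### Pushforward and pullback of vector fields -/

/-- The covariant pushforward `û ↦ (DF^{-T} û) ∘ F⁻¹`, a field on `F((0,1)²)`. -/
def pushforward (F : Plane → Plane) (u : Plane → Plane) (y : Plane) : Plane :=
  (ContinuousLinearMap.adjoint
    (fderiv ℝ F (Function.invFunOn F openSquare y))).inverse
      (u (Function.invFunOn F openSquare y))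

/-- The inverse of the pushforward, `u ↦ DF^T (u ∘ F)`, a field on `(0,1)²`. -/
def pullback (F : Plane → Plane) (u : Plane → Plane) (x : Plane) : Plane :=
  ContinuousLinearMap.adjoint (fderiv ℝ F x) (u (F x))

/-! ### Edge-local coordinates on the reference square -/

/-- An edge of the reference square together with edge-local coordinates `(t, s)` on the square :
`t` is the coordinate along the edge and `s` is the distance to the edge. `par` is the direction
which is parallel to the edge. -/
structure Frame where
  par : Fin 2
  flipPar : Bool
  flipPerp : Bool

/-- The identity or the reflection of `[0,1]`. -/
def flipIf (b : Bool) (t : ℝ) : ℝ := if b then 1 - t else t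

namespace Frame

variable (A : Frame)

/-- The point of the square with edge-local coordinates `(t, s)`. -/
def point (t s : ℝ) : Plane :=
  WithLp.toLp 2 fun i => if i = A.par then flipIf A.flipPar t else flipIf A.flipPerp s

/-- The edge-local coordinate along the edge. -/
def tCoord (x : Plane) : ℝ := flipIf A.flipPar (x A.par)

/-- The edge-local coordinate perpendicular to the edge. -/
def sCoord (x : Plane) : ℝ := flipIf A.flipPerp (x A.par.rev)

/-- The unit tangent vector of the edge in the direction of increasing `t`. -/
def tangent : Plane := (if A.flipPar then (-1 : ℝ) else 1) • unitVec A.par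

/-- The logical field whose pullback to the edge-local coordinates is `(f(t) g(s), 0)`. -/
def tang (f g : ℝ → ℝ) (x : Plane) : Plane := (f (A.tCoord x) * g (A.sCoord x)) • A.tangent

end Frame

/-! ### The space `H(curl; Ω)` -/

/-- The vector curl `(∂₂ φ, -∂₁ φ)` of a scalar function. -/
def vcurl (φ : Plane → ℝ) (x : Plane) : Plane :=
  !₂[fderiv ℝ φ x (unitVec 1), -fderiv ℝ φ x (unitVec 0)]

/-- `w` is the weak scalar curl `∂₁ u₂ - ∂₂ u₁` of `u` on `Ω`. -/
def IsWeakCurl (Ω : Set Plane) (u : Plane → Plane) (w : Plane → ℝ) : Prop :=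
  ∀ φ : Plane → ℝ, ContDiff ℝ ∞ φ → HasCompactSupport φ → tsupport φ ⊆ Ω →
    ∫ x in Ω, inner ℝ (u x) (vcurl φ x) = ∫ x in Ω, w x * φ x

/-- The square integrable vector fields on `Ω`. -/
abbrev L2Field (Ω : Set Plane) : Type := Lp Plane 2 (volume.restrict Ω)

lemma vcurl_continuous {φ : Plane → ℝ} (h : ContDiff ℝ ∞ φ) : Continuous (vcurl φ) := by
  have h1 : Continuous (fderiv ℝ φ) := h.continuous_fderiv (by simp)
  unfold vcurl
  refine (PiLp.continuous_toLp 2 _).comp (continuous_pi fun i => ?_)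
  fin_cases i
  · exact h1.clm_apply continuous_const
  · exact (h1.clm_apply continuous_const).neg

lemma vcurl_hasCompactSupport {φ : Plane → ℝ} (h : HasCompactSupport φ) :
    HasCompactSupport (vcurl φ) := by
  refine (h.fderiv (𝕜 := ℝ)).mono ?_
  intro x hx
  contrapose! hx
  simp only [Function.mem_support, not_not] at hx ⊢
  ext i
  fin_cases i <;> simp [vcurl, hx]

lemma integrable_inner_vcurl {Ω : Set Plane} (u : L2Field Ω) {φ : Plane → ℝ}
    (h : ContDiff ℝ ∞ φ) (hc : HasCompactSupport φ) :
    Integrable (fun x => inner ℝ (u x) (vcurl φ x)) (volume.restrict Ω) := by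
  have h2 : MemLp (vcurl φ) 2 (volume.restrict Ω) :=
    ((vcurl_continuous h).memLp_of_hasCompactSupport (vcurl_hasCompactSupport hc)).restrict Ω
  refine (L2.integrable_inner (𝕜 := ℝ) u h2.toLp).congr ?_
  filter_upwards [h2.coeFn_toLp] with x hx
  rw [hx]

lemma integrable_mul_test {Ω : Set Plane} (w : Lp ℝ 2 (volume.restrict Ω)) {φ : Plane → ℝ}
    (h : ContDiff ℝ ∞ φ) (hc : HasCompactSupport φ) :
    Integrable (fun x => w x * φ x) (volume.restrict Ω) := by
  have h2 : MemLp φ 2 (volume.restrict Ω) :=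
    (h.continuous.memLp_of_hasCompactSupport hc).restrict Ω
  exact (Lp.memLp w).integrable_mul h2

/-- `H(curl; Ω)` : the fields in `L²(Ω)²` which have a weak curl in `L²(Ω)`. -/
def HCurl (Ω : Set Plane) : Submodule ℝ (L2Field Ω) where
  carrier := {u | ∃ w : Lp ℝ 2 (volume.restrict Ω), IsWeakCurl Ω u w}
  zero_mem' := by
    refine ⟨0, fun φ h hc hs => ?_⟩
    have h1 : ∫ x in Ω, inner ℝ ((0 : L2Field Ω) x) (vcurl φ x) = 0 := by
      refine integral_eq_zero_of_ae ?_
      filter_upwards [Lp.coeFn_zero Plane 2 (volume.restrict Ω)] with x hx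
      rw [hx]
      simp
    have h2 : ∫ x in Ω, ((0 : Lp ℝ 2 (volume.restrict Ω)) x) * φ x = 0 := by
      refine integral_eq_zero_of_ae ?_
      filter_upwards [Lp.coeFn_zero ℝ 2 (volume.restrict Ω)] with x hx
      rw [hx]
      simp
    rw [h1, h2]
  add_mem' := by
    rintro u u' ⟨w, hw⟩ ⟨w', hw'⟩
    refine ⟨w + w', fun φ h hc hs => ?_⟩
    have h1 : ∫ x in Ω, inner ℝ ((u + u' : L2Field Ω) x) (vcurl φ x) =
        ∫ x in Ω, (inner ℝ (u x) (vcurl φ x) + inner ℝ (u' x) (vcurl φ x)) := by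
      refine integral_congr_ae ?_
      filter_upwards [Lp.coeFn_add u u'] with x hx
      rw [hx, Pi.add_apply, inner_add_left]
    have h2 : ∫ x in Ω, ((w + w' : Lp ℝ 2 (volume.restrict Ω)) x) * φ x =
        ∫ x in Ω, (w x * φ x + w' x * φ x) := by
      refine integral_congr_ae ?_
      filter_upwards [Lp.coeFn_add w w'] with x hx
      rw [hx, Pi.add_apply, add_mul]
    rw [h1, h2, integral_add (integrable_inner_vcurl u h hc) (integrable_inner_vcurl u' h hc),
      integral_add (integrable_mul_test w h hc) (integrable_mul_test w' h hc),
      hw φ h hc hs, hw' φ h hc hs]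
  smul_mem' := by
    rintro c u ⟨w, hw⟩
    refine ⟨c • w, fun φ h hc hs => ?_⟩
    have h1 : ∫ x in Ω, inner ℝ ((c • u : L2Field Ω) x) (vcurl φ x) =
        ∫ x in Ω, c * inner ℝ (u x) (vcurl φ x) := by
      refine integral_congr_ae ?_
      filter_upwards [Lp.coeFn_smul c u] with x hx
      rw [hx, Pi.smul_apply, real_inner_smul_left]
    have h2 : ∫ x in Ω, ((c • w : Lp ℝ 2 (volume.restrict Ω)) x) * φ x =
        ∫ x in Ω, c * (w x * φ x) := by
      refine integral_congr_ae ?_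
      filter_upwards [Lp.coeFn_smul c w] with x hx
      rw [hx, Pi.smul_apply, smul_eq_mul, mul_assoc]
    rw [h1, h2, integral_const_mul, integral_const_mul, hw φ h hc hs]

/-! ### Multipatch domains -/

/-- A geometrically conforming multipatch domain with patches `K`, interior edges `E` and a spline
resolution on each patch, nested across the interior edges.

Each patch is parametrized by a `C¹` diffeomorphism `F k` of the closed reference square onto the
closure of the patch. An interior edge `e` is shared by a coarse patch `patchOf e false` (written
`k⁻`) and a fine patch `patchOf e true` (written `k⁺`). The frames `frame e false`, `frame e true`
are edge-local coordinates on the two reference squares; the resulting two parametrizations of the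
edge coincide, so that the two patches are parametrized together by a single continuous map. -/
structure Multipatch (K E : Type*) (p : ℕ) where
  F : K → Plane → Plane
  knots : K → KnotVector p
  patchOf : E → Bool → K
  frame : E → Bool → Frame
  contDiffOn : ∀ k, ContDiffOn ℝ 1 (F k) closedSquare
  injOn : ∀ k, InjOn (F k) closedSquare
  det_ne_zero : ∀ k, ∀ x ∈ closedSquare, (fderivWithin ℝ (F k) closedSquare x).det ≠ 0
  disjoint : ∀ k l, k ≠ l → Disjoint (F k '' openSquare) (F l '' openSquare)
  patchOf_ne : ∀ e, patchOf e false ≠ patchOf e true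
  /-- the two parametrizations of an interior edge coincide -/
  edge_param : ∀ e, ∀ t ∈ Icc (0 : ℝ) 1,
    F (patchOf e false) ((frame e false).point t 0) = F (patchOf e true) ((frame e true).point t 0)
  /-- an interior edge is the interface of its two patches -/
  edge_inter : ∀ e, closure (F (patchOf e false) '' openSquare) ∩
      closure (F (patchOf e true) '' openSquare) =
    (fun t => F (patchOf e false) ((frame e false).point t 0)) '' Icc (0 : ℝ) 1
  /-- an interior edge is determined by its two patches -/
  edge_unique : Function.Injective fun e => range (patchOf e)
  /-- the interface of two patches is empty, a common vertex, or an interior edge -/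
  conforming : ∀ k l, k ≠ l →
    closure (F k '' openSquare) ∩ closure (F l '' openSquare) = ∅ ∨
    (∃ c ∈ corners, ∃ c' ∈ corners, F k c = F l c' ∧
      closure (F k '' openSquare) ∩ closure (F l '' openSquare) = {F k c}) ∨
    ∃ e, range (patchOf e) = {k, l}
  /-- `𝕍⁰_{k⁻} ⊆ 𝕍⁰_{k⁺}` along the edge, in its common parametrization -/
  nested : ∀ e, (knots (patchOf e false)).space0 (frame e false).flipPar ≤
    (knots (patchOf e true)).space0 (frame e true).flipPar

/-- The broken logical field which is `u` on the patch `k` and `0` on the other patches. -/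
def onPatch {K : Type*} (k : K) (u : Plane → Plane) : K → Plane → Plane :=
  open Classical in Pi.single k u

namespace Multipatch

variable {K E : Type*} {p : ℕ} (M : Multipatch K E p)

/-- The patch `Ω_k = F_k((0,1)²)`. -/
def patch (k : K) : Set Plane := M.F k '' openSquare

/-- The domain `Ω`, the interior of the union of the closed patches. -/
def domain : Set Plane := interior (⋃ k, closure (M.patch k))

/-- The field `v`, given almost everywhere on `Ω`, is on each patch `Ω_k ⊆ Ω` the pushforward of
the logical field `u k`. -/
def IsPush (v : Plane → Plane) (u : K → Plane → Plane) : Prop :=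
  ∀ k, ∀ᵐ y ∂volume.restrict M.domain, y ∈ M.patch k → v y = pushforward (M.F k) (u k) y

/-- The broken space `V¹_pw = {v ∈ L²(Ω)² : v|_{Ω_k} ∈ V¹_k for all k}`, where `V¹_k` consists of
the pushforwards of the fields in `V̂¹_k`. -/
def V1pw : Submodule ℝ (L2Field M.domain) where
  carrier := {v | ∃ u : K → Plane → Plane, (∀ k, u k ∈ (M.knots k).hatV1) ∧ M.IsPush v u}
  zero_mem' := by
    refine ⟨0, fun k => Submodule.zero_mem _, fun k => ?_⟩
    filter_upwards [Lp.coeFn_zero Plane 2 (volume.restrict M.domain)] with x hx _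
    rw [hx]
    simp [pushforward]
  add_mem' := by
    rintro v v' ⟨u, hu, h⟩ ⟨u', hu', h'⟩
    refine ⟨u + u', fun k => Submodule.add_mem _ (hu k) (hu' k), fun k => ?_⟩
    filter_upwards [Lp.coeFn_add v v', h k, h' k] with x hx h1 h2 hk
    rw [hx, Pi.add_apply, h1 hk, h2 hk]
    simp [pushforward]
  smul_mem' := by
    rintro c v ⟨u, hu, h⟩
    refine ⟨c • u, fun k => Submodule.smul_mem _ c (hu k), fun k => ?_⟩
    filter_upwards [Lp.coeFn_smul c v, h k] with x hx h1 hk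
    rw [hx, Pi.smul_apply, h1 hk]
    simp [pushforward]

/-- The conforming space `V¹_h = V¹_pw ∩ H(curl; Ω)`, as a subspace of `V¹_pw`. -/
def V1h : Submodule ℝ M.V1pw := (HCurl M.domain).comap M.V1pw.subtype

/-! ### The edge projections -/

section Edge

variable (e : E)

/-- The perpendicular basis function `λ^±_{⊥,j}` of the edge `e`, as a function of the distance to
the edge. Here and below `σ = false` stands for the side `-` and `σ = true` for the side `+`. -/
def lamPerp (σ : Bool) (j : ℕ) : ℝ → ℝ :=
  (M.knots (M.patchOf e σ)).lam0' (M.frame e σ).flipPerp j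

/-- The parallel basis function `λ^{1,±}_i` of the edge `e`. -/
def lamPar (σ : Bool) (i : ℕ) : ℝ → ℝ :=
  (M.knots (M.patchOf e σ)).lam1' (M.frame e σ).flipPar i

/-- The broken field `(f ⊗ g, 0)` on the two logical patches next to `e`, in the edge-local
coordinates. A function `g` on `[-1,1]` of the perpendicular coordinate is given by its two branches
`g false` and `g true`, each as a function of the distance to the edge. -/
def edgeField (f : ℝ → ℝ) (g : Bool → ℝ → ℝ) : K → Plane → Plane :=
  ∑ σ : Bool, onPatch (M.patchOf e σ) ((M.frame e σ).tang f (g σ))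

/-- The tangential basis field `(λ^{1,±}_i ⊗ λ^±_{⊥,j}, 0)` of the side `σ`. -/
def edgeBasis (σ : Bool) (i j : ℕ) : K → Plane → Plane :=
  onPatch (M.patchOf e σ) ((M.frame e σ).tang (M.lamPar e σ i) (M.lamPerp e σ j))

/-- The average `λ̄_⊥ = (λ^-_{⊥,0} + λ^+_{⊥,0}) / 2`. -/
def lamBar (σ : Bool) : ℝ → ℝ := (1 / 2 : ℝ) • M.lamPerp e σ 0

/-- The correction term `C = ½ ∑_{m=1}^r (γ^-_m λ^-_{⊥,m} - γ^+_m λ^+_{⊥,m})`. -/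
def corr (r : ℕ) (σ : Bool) : ℝ → ℝ :=
  ((if σ then (-1 : ℝ) else 1) / 2) • ∑ m : Fin r,
    (M.knots (M.patchOf e σ)).gamma (M.frame e σ).flipPerp r m • M.lamPerp e σ (m + 1)

/-- The restriction `R¹ : 𝕍¹₊ → 𝕍¹₋`, the `L²`-projection onto the coarse space. -/
def restr1 (f : ℝ → ℝ) : ℝ → ℝ :=
  (M.knots (M.patchOf e false)).l2Proj1 (M.frame e false).flipPar f

/-- `T` is the edge projection `P¹_e` with moment corrections of order `r` : the linear map on
`V¹_pw` which is given on the basis of `V¹_pw` by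
* `λ^{1,-}_i ⊗ λ^-_{⊥,0} ↦ λ^{1,-}_i ⊗ (λ̄_⊥ + C)`,
* `λ^{1,+}_i ⊗ λ^+_{⊥,0} ↦ R¹ λ^{1,+}_i ⊗ (λ̄_⊥ - C)`,
for the tangential component on the two patches next to `e`, and by the identity on the other basis
fields, namely the tangential ones with perpendicular index `j ≠ 0`, those of the other component
on the two patches, and those of the other patches. -/
structure IsEdgeProjection (r : ℕ) (T : M.V1pw →ₗ[ℝ] M.V1pw) : Prop where
  coarse : ∀ i < (M.knots (M.patchOf e false)).n, ∀ v : M.V1pw,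
    M.IsPush v (M.edgeBasis e false i 0) →
    M.IsPush (T v) (M.edgeField e (M.lamPar e false i) (M.lamBar e + M.corr e r))
  fine : ∀ i < (M.knots (M.patchOf e true)).n, ∀ v : M.V1pw,
    M.IsPush v (M.edgeBasis e true i 0) →
    M.IsPush (T v) (M.edgeField e (M.restr1 e (M.lamPar e true i)) (M.lamBar e - M.corr e r))
  tangential : ∀ σ, ∀ i < (M.knots (M.patchOf e σ)).n,
    ∀ j ∈ Icc 1 (M.knots (M.patchOf e σ)).n, ∀ v : M.V1pw,
    M.IsPush v (M.edgeBasis e σ i j) → T v = v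
  normal : ∀ σ, ∀ i < (M.knots (M.patchOf e σ)).n,
    ∀ j ≤ (M.knots (M.patchOf e σ)).n, ∀ v : M.V1pw,
    M.IsPush v (onPatch (M.patchOf e σ)
      ((M.knots (M.patchOf e σ)).hatBasis1 (M.frame e σ).par.rev i j)) → T v = v
  other : ∀ k, (∀ σ, k ≠ M.patchOf e σ) → ∀ d, ∀ i < (M.knots k).n, ∀ j ≤ (M.knots k).n,
    ∀ v : M.V1pw, M.IsPush v (onPatch k ((M.knots k).hatBasis1 d i j)) → T v = v

/-- The tangential component of the broken field `v` is continuous across `e` : the tangential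
traces `τ · v` from the two sides, with `τ` the derivative of the common parametrization of `e`,
agree almost everywhere on the edge. On each side, `τ · v = τ̂ · û` for the logical field `û`. -/
def TangentiallyContinuous (v : M.V1pw) : Prop :=
  ∀ u : K → Plane → Plane, (∀ k, u k ∈ (M.knots k).hatV1) → M.IsPush v u →
    ∀ᵐ t ∂volume.restrict (Icc (0 : ℝ) 1),
      inner ℝ (M.frame e false).tangent (u (M.patchOf e false) ((M.frame e false).point t 0)) =
      inner ℝ (M.frame e true).tangent (u (M.patchOf e true) ((M.frame e true).point t 0))

end Edge

/-- `T` preserves polynomial moments of order `r` : on each patch, the pullbacks of `T v` and `v`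
have the same moments against the vector-valued polynomials in `ℚ_{r-1,r-1}`. -/
def MomentPreserving (r : ℕ) (T : M.V1pw →ₗ[ℝ] M.V1pw) : Prop :=
  ∀ v : M.V1pw, ∀ k, ∀ q : Fin 2 → MvPolynomial (Fin 2) ℝ, (∀ d i, (q d).degreeOf i < r) →
    ∫ x in openSquare, ∑ d, pullback (M.F k) (T v : L2Field M.domain) x d *
        MvPolynomial.eval (fun i => x i) (q d) =
      ∫ x in openSquare, ∑ d, pullback (M.F k) (v : L2Field M.domain) x d *
        MvPolynomial.eval (fun i => x i) (q d)

end Multipatch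

end

/-!
A field in the broken space is the same thing as a family of logical spline fields on the reference
squares (`Multipatch.logical`): pushforwards of bounded fields are square integrable, and the
coefficients of a spline can be recovered from its values almost everywhere by dual functions. On
this level the edge projection is `u ↦ u + edgeUpdate u`. Let `f⁻`, `f⁺` be the tangential traces of
`u` on the edge, and let `R` be the `L²`-projection onto the coarse splines along the edge. The
update replaces both traces by the mean `h = (f⁻ + R f⁺) / 2`, multiplied by the basis function which
does not vanish on the edge, and adds `±(f⁻ - R f⁺) / 2`, multiplied by a combination of the next
`r` basis functions (`Multipatch.edgeUpdate`). Since `𝕍⁰_{k⁻} ⊆ 𝕍⁰_{k⁺}` along the edge,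
differentiation shows that the coarse parallel splines are fine parallel splines as well
(`KnotVector.exists_ae_eq_mem_space1`), so that `h` is admissible on both sides. The formula takes
the prescribed values on the basis fields, which span the broken space; this gives existence and
uniqueness of the edge projections (`Multipatch.isEdgeProjection_edgeProj`,
`Multipatch.IsEdgeProjection.unique`).

*Commutation.* The update at an edge only depends on the traces on this edge, and it only writes
tangential fields with perpendicular index at most `r < n`. Such fields have no tangential trace on
the other sides of the square. So two edge projections commute as soon as different interior edges
use different sides of patches (`Multipatch.side_injective`). This is a matter of local geometry: two
patches with a common edge have opposite orientations there, as otherwise they would overlap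
(`Multipatch.orient_mul_sgn_eq_neg`), and three patches cannot be pairwise opposite.

*Moments.* The coefficients `γ` are defined in such a way that the combination of the next `r` basis
functions has the same moments as the first basis function (`KnotVector.gamma_spec`); the system is
solvable since a polynomial of degree `< r` which is orthogonal to `r` consecutive B-splines is zero.
The projections along the edge preserve moments, because by Marsden's identity the polynomials of
degree `< p` are parallel splines (`KnotVector.exists_mem_space1_eq_eval`). Then the moments of the
two parts of the update cancel (`Multipatch.integral_sideUpdate_mul`).

*Conformity.* Integration by parts on the reference squares and transport to the patches give
Green's formula (`Multipatch.exists_green`): tested with a vector curl, a broken field yields a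
square integrable curl and the tangential jumps over the interior edges. The two contributions to
each edge have opposite signs by the orientation lemma, and the sides which are no interior edges lie
outside of the open domain. Hence a broken field belongs to `H(curl)` if and only if its tangential
jumps vanish (`Multipatch.mem_V1h_iff`). After the product of all edge projections no jumps are left,
since the factor of each edge can be applied last, and fields without jumps are not changed.
-/

/-! ### Complete homogeneous symmetric polynomials of consecutive knots -/

/-- The complete homogeneous symmetric polynomial of degree `j` in the `w` consecutive
knots `ξ i, …, ξ (i + w - 1)`. -/
def windowH (ξ : ℕ → ℝ) (i : ℕ) : ℕ → ℕ → ℝ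
  | 0, _ => 1
  | _ + 1, 0 => 0
  | j + 1, w + 1 => windowH ξ i (j + 1) w + ξ (i + w) * windowH ξ i j (w + 1)
termination_by j w => j + w

section WindowH

variable (ξ : ℕ → ℝ) (i : ℕ)

@[simp] lemma windowH_zero_left (w : ℕ) : windowH ξ i 0 w = 1 := by
  rw [windowH]

@[simp] lemma windowH_succ_zero (j : ℕ) : windowH ξ i (j + 1) 0 = 0 := by
  rw [windowH]

/-- Splitting off the last knot. -/
lemma windowH_succ_succ (j w : ℕ) : windowH ξ i (j + 1) (w + 1) =
    windowH ξ i (j + 1) w + ξ (i + w) * windowH ξ i j (w + 1) := by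
  rw [windowH]

/-- Splitting off the first knot. -/
lemma windowH_succ_succ' (j w : ℕ) : windowH ξ i (j + 1) (w + 1) =
    windowH ξ (i + 1) (j + 1) w + ξ i * windowH ξ i j (w + 1) := by
  induction j generalizing w with
  | zero =>
    induction w with
    | zero => simp [windowH_succ_succ]
    | succ w ih =>
      rw [windowH_succ_succ ξ i, ih, windowH_succ_succ ξ (i + 1)]
      simp only [windowH_zero_left]
      rw [show i + 1 + w = i + (w + 1) by ring]
      ring
  | succ j ihj =>
    induction w with
    | zero => simp [windowH_succ_succ]
    | succ w ih =>
      have h1 := windowH_succ_succ ξ i (j + 1) (w + 1)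
      have h2 := windowH_succ_succ ξ (i + 1) (j + 1) w
      have h3 := windowH_succ_succ ξ i j (w + 1)
      rw [show i + 1 + w = i + (w + 1) by ring] at h2
      linear_combination h1 + ih + ξ (i + (w + 1)) * ihj (w + 1) - h2 - ξ i * h3

/-- The recursion of divided differences. -/
lemma windowH_sub (j w : ℕ) : (ξ (i + w) - ξ i) * windowH ξ i j (w + 1) =
    windowH ξ (i + 1) (j + 1) w - windowH ξ i (j + 1) w := by
  have h1 := windowH_succ_succ ξ i j w
  have h2 := windowH_succ_succ' ξ i j w
  linear_combination h2 - h1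

lemma windowH_of_eq {a : ℝ} (j w : ℕ) (h : ∀ m ≤ w, ξ (i + m) = a) :
    windowH ξ i j (w + 1) = (w + j).choose j * a ^ j := by
  induction j generalizing w with
  | zero => simp
  | succ j ihj =>
    induction w with
    | zero =>
      have h0 := h 0 le_rfl
      rw [windowH_succ_succ, ihj 0 h, h0]
      simp [pow_succ']
    | succ w ih =>
      rw [windowH_succ_succ, ih fun m hm => h m (by omega), ihj (w + 1) h, h _ le_rfl,
        show w + 1 + (j + 1) = (w + j + 1) + 1 by ring, Nat.choose_succ_succ,
        show w + 1 + j = w + j + 1 by ring, show w + (j + 1) = w + j + 1 by ring]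
      push_cast
      ring

/-- Taking differences of consecutive windows lowers the degree and widens the window: this makes
the matrices of complete homogeneous polynomials of consecutive windows invertible. -/
lemma windowH_injective (r : ℕ) {w : ℕ} (hξ : Monotone ξ) (c : ℕ → ℝ)
    (hw : ∀ m < r, ξ (i + m) < ξ (i + m + w))
    (h : ∀ m < r, ∑ j ∈ Finset.range r, c j * windowH ξ (i + m) j w = 0) :
    ∀ j < r, c j = 0 := by
  induction r generalizing w c with
  | zero => simp
  | succ r ih =>
    have key : ∀ j < r, c (j + 1) = 0 := by
      refine ih (w := w + 1) (fun j => c (j + 1))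
        (fun m hm => (hw m (by omega)).trans_le (hξ (by omega))) fun m hm => ?_
      have h1 := h m (by omega)
      have h2 := h (m + 1) (by omega)
      rw [Finset.sum_range_succ'] at h1 h2
      simp only [windowH_zero_left] at h1 h2
      have h3 : (ξ (i + m + w) - ξ (i + m)) *
          ∑ j ∈ Finset.range r, c (j + 1) * windowH ξ (i + m) j (w + 1) = 0 := by
        rw [Finset.mul_sum]
        have : ∀ j ∈ Finset.range r, (ξ (i + m + w) - ξ (i + m)) *
            (c (j + 1) * windowH ξ (i + m) j (w + 1)) =
            c (j + 1) * windowH ξ (i + (m + 1)) (j + 1) w -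
              c (j + 1) * windowH ξ (i + m) (j + 1) w := fun j _ => by
          rw [← add_assoc i m 1]
          linear_combination c (j + 1) * windowH_sub ξ (i + m) j w
        rw [Finset.sum_congr rfl this, Finset.sum_sub_distrib]
        linarith
      exact (mul_eq_zero.1 h3).resolve_left (sub_ne_zero.2 (hw m (by omega)).ne')
    intro j hj
    cases j with
    | succ j => exact key j (by omega)
    | zero =>
      have h0 := h 0 (by omega)
      rw [Finset.sum_range_succ', Finset.sum_eq_zero fun j hj => by
        rw [key j (Finset.mem_range.1 hj), zero_mul]] at h0
      simpa using h0

end WindowH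

/-! ### B-splines for a monotone knot sequence -/

lemma bspline_congr {ξ ξ' : ℕ → ℝ} (q i : ℕ) (h : ∀ m ≤ q + 1, ξ (i + m) = ξ' (i + m)) :
    bspline ξ q i = bspline ξ' q i := by
  induction q generalizing i with
  | zero =>
    funext x
    have h0 := h 0 (by omega)
    have h1 := h 1 (by omega)
    simp only [add_zero] at h0
    simp only [bspline, h0, h1]
  | succ q ih =>
    funext x
    have h0 := h 0 (by omega)
    simp only [add_zero] at h0
    have h1 : ξ (i + q + 1) = ξ' (i + q + 1) := h (q + 1) (by omega)
    have h2 : ξ (i + q + 2) = ξ' (i + q + 2) := h (q + 2) (by omega)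
    rw [bspline, bspline, ih i fun m hm => h m (by omega), ih (i + 1) fun m hm => by
      rw [show i + 1 + m = i + (m + 1) by ring]; exact h (m + 1) (by omega), h0, h1, h2,
      h 1 (by omega)]

lemma bspline_shift (ξ : ℕ → ℝ) (q i : ℕ) :
    bspline (fun j => ξ (j + 1)) q i = bspline ξ q (i + 1) := by
  induction q generalizing i with
  | zero => rfl
  | succ q ih =>
    funext x
    rw [bspline, bspline, ih, ih, show i + q + 1 + 1 = i + 1 + q + 1 by ring]

lemma bspline_zero_apply (ξ : ℕ → ℝ) (i : ℕ) (x : ℝ) : bspline ξ 0 i x =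
    ({x | ξ i ≤ x ∧ (x < ξ (i + 1) ∨ (x = 1 ∧ ξ i < 1 ∧ ξ (i + 1) = 1))} : Set ℝ).indicator
      1 x := by
  simp [bspline, indicator]

lemma bspline_succ_apply (ξ : ℕ → ℝ) (q i : ℕ) (x : ℝ) : bspline ξ (q + 1) i x =
    (x - ξ i) / (ξ (i + q + 1) - ξ i) * bspline ξ q i x +
      (ξ (i + q + 2) - x) / (ξ (i + q + 2) - ξ (i + 1)) * bspline ξ q (i + 1) x := rfl

@[fun_prop]
lemma measurable_bspline (ξ : ℕ → ℝ) (q i : ℕ) : Measurable (bspline ξ q i) := by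
  induction q generalizing i with
  | zero =>
    have : MeasurableSet
        {x : ℝ | ξ i ≤ x ∧ (x < ξ (i + 1) ∨ (x = 1 ∧ ξ i < 1 ∧ ξ (i + 1) = 1))} :=
      (measurableSet_le measurable_const measurable_id).inter
        ((measurableSet_lt measurable_id measurable_const).union
          ((measurableSet_singleton 1).inter (MeasurableSet.const _)))
    rw [show bspline ξ 0 i = _ from funext fun x => bspline_zero_apply ξ i x]
    exact measurable_one.indicator this
  | succ q ih =>
    have h1 := ih i
    have h2 := ih (i + 1)
    change Measurable fun x => (x - ξ i) / (ξ (i + q + 1) - ξ i) * bspline ξ q i x +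
      (ξ (i + q + 2) - x) / (ξ (i + q + 2) - ξ (i + 1)) * bspline ξ q (i + 1) x
    fun_prop

lemma bspline_bounded (ξ : ℕ → ℝ) (q i : ℕ) :
    ∃ C, ∀ x ∈ Icc (0 : ℝ) 1, |bspline ξ q i x| ≤ C := by
  induction q generalizing i with
  | zero =>
    refine ⟨1, fun x _ => ?_⟩
    rw [bspline_zero_apply, indicator]
    split_ifs <;> simp
  | succ q ih =>
    obtain ⟨C, hC⟩ := ih i
    obtain ⟨C', hC'⟩ := ih (i + 1)
    obtain ⟨D, hD⟩ := isCompact_Icc.exists_bound_of_continuousOn (s := Icc (0 : ℝ) 1)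
      (f := fun x => (x - ξ i) / (ξ (i + q + 1) - ξ i)) (by fun_prop)
    obtain ⟨D', hD'⟩ := isCompact_Icc.exists_bound_of_continuousOn (s := Icc (0 : ℝ) 1)
      (f := fun x => (ξ (i + q + 2) - x) / (ξ (i + q + 2) - ξ (i + 1))) (by fun_prop)
    refine ⟨D * C + D' * C', fun x hx => ?_⟩
    have h1 := hD x hx
    have h2 := hD' x hx
    rw [Real.norm_eq_abs] at h1 h2
    rw [bspline_succ_apply]
    refine (abs_add_le _ _).trans (add_le_add ?_ ?_) <;> rw [abs_mul]
    · exact mul_le_mul h1 (hC x hx) (abs_nonneg _) ((abs_nonneg _).trans h1)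
    · exact mul_le_mul h2 (hC' x hx) (abs_nonneg _) ((abs_nonneg _).trans h2)

/-- A bounded measurable function on `[0,1]`. -/
lemma intervalIntegrable_of_bounded {f : ℝ → ℝ} (hf : Measurable f) {C : ℝ}
    (hC : ∀ x ∈ Icc (0 : ℝ) 1, |f x| ≤ C) : IntervalIntegrable f volume 0 1 := by
  rw [intervalIntegrable_iff_integrableOn_Icc_of_le zero_le_one]
  refine Measure.integrableOn_of_bounded (M := C) (by simp) hf.aestronglyMeasurable ?_
  filter_upwards [ae_restrict_mem measurableSet_Icc] with x hx using hC x hx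

lemma intervalIntegrable_bspline (ξ : ℕ → ℝ) (q i : ℕ) :
    IntervalIntegrable (bspline ξ q i) volume 0 1 :=
  let ⟨_, hC⟩ := bspline_bounded ξ q i
  intervalIntegrable_of_bounded (measurable_bspline ξ q i) hC

lemma intervalIntegrable_bspline_mul (ξ : ℕ → ℝ) (q i : ℕ) {g : ℝ → ℝ} (hg : Continuous g) :
    IntervalIntegrable (fun x => bspline ξ q i x * g x) volume 0 1 :=
  (intervalIntegrable_bspline ξ q i).mul_continuousOn hg.continuousOn

section Monotone

variable {ξ : ℕ → ℝ} (hξ : Monotone ξ)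
include hξ

/-- A B-spline all of whose knots coincide is zero, at least where it is divided by the length
of its (empty) support. -/
lemma bspline_eq_zero_of_eq (q i : ℕ) (h : ξ (i + q + 1) = ξ i) : bspline ξ q i = 0 := by
  induction q generalizing i with
  | zero =>
    funext x
    rw [bspline_zero_apply, indicator, if_neg]
    · rfl
    · rintro ⟨h1, h2 | ⟨_, h3, h4⟩⟩
      · simp only [add_zero] at h; linarith
      · simp only [add_zero] at h; linarith
  | succ q ih =>
    have h1 : ξ i ≤ ξ (i + 1) := hξ (by omega)
    have h2 : ξ (i + 1) ≤ ξ (i + q + 1) := hξ (by omega)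
    have h3 : ξ (i + q + 1) ≤ ξ (i + (q + 1) + 1) := hξ (by omega)
    funext x
    rw [bspline_succ_apply, ih i (by linarith), ih (i + 1) ?_]
    · simp
    · rw [show i + 1 + q + 1 = i + (q + 1) + 1 by ring]; linarith

lemma integral_bspline_zero_mul_pow (h0 : ∀ m, ξ m ∈ Icc (0 : ℝ) 1) (i j : ℕ) :
    ∫ x in (0 : ℝ)..1, bspline ξ 0 i x * x ^ j =
      (ξ (i + 1) ^ (j + 1) - ξ i ^ (j + 1)) / (j + 1) := by
  have hle : ξ i ≤ ξ (i + 1) := hξ (by omega)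
  rw [← integral_pow, intervalIntegral.integral_of_le zero_le_one,
    intervalIntegral.integral_of_le hle, ← integral_Icc_eq_integral_Ioc,
    ← integral_indicator measurableSet_Icc, ← integral_indicator measurableSet_Ioc]
  refine integral_congr_ae ?_
  have hn : ∀ a : ℝ, ∀ᵐ x, x ≠ a := fun a => by
    simp [ae_iff]
  filter_upwards [hn (ξ i), hn (ξ (i + 1)), hn 1] with x h1 h2 h3
  have := h0 i
  have := h0 (i + 1)
  simp only [indicator, mem_Icc, mem_Ioc, bspline_zero_apply, mem_ofPred_eq, Pi.one_apply] at *
  by_cases hx : ξ i < x ∧ x ≤ ξ (i + 1)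
  · have hx2 := lt_of_le_of_ne hx.2 h2
    rw [if_pos hx, if_pos ⟨by linarith, by linarith⟩, if_pos ⟨hx.1.le, Or.inl hx2⟩, one_mul]
  · rw [if_neg hx]
    have : ¬(ξ i ≤ x ∧ (x < ξ (i + 1) ∨ x = 1 ∧ ξ i < 1 ∧ ξ (i + 1) = 1)) := by
      rintro ⟨h4, h5 | h5⟩
      · exact hx ⟨lt_of_le_of_ne h4 (Ne.symm h1), h5.le⟩
      · exact h3 h5.1
    rw [if_neg this]; simp

/-- The moments of the B-splines: up to a positive factor they are the complete homogeneous
polynomials of the knots (divided differences of monomials). -/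
lemma integral_bspline_mul_pow (h0 : ∀ m, ξ m ∈ Icc (0 : ℝ) 1) (q i j : ℕ) :
    ∫ x in (0 : ℝ)..1, bspline ξ q i x * x ^ j =
      (j.factorial * q.factorial / (j + q + 1).factorial : ℝ) *
        ((ξ (i + q + 1) - ξ i) * windowH ξ i j (q + 2)) := by
  induction q generalizing i j with
  | zero =>
    have h1 := windowH_sub ξ i j 1
    have h2 : ∀ m, windowH ξ m (j + 1) 1 = ξ m ^ (j + 1) := fun m => by
      rw [windowH_of_eq ξ m (a := ξ m) (j + 1) 0 (by simp)]; simp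
    rw [integral_bspline_zero_mul_pow hξ h0, add_zero, h1, h2, h2, Nat.factorial_succ]
    have : (j.factorial : ℝ) ≠ 0 := by positivity
    push_cast
    field_simp
    simp
  | succ q ih =>
    -- `I m l` are the moments of the normalized B-splines (zero if the support is degenerate);
    -- they satisfy the formula without the length of the support, up to a correction that
    -- is invisible in the recursion.
    set d : ℕ → ℕ → ℝ := fun q j => j.factorial * q.factorial / (j + q + 1).factorial with hd
    have hd1 : ∀ j, d (q + 1) j = d q j - d q (j + 1) := fun j => by
      simp only [hd, show j + 1 + q + 1 = j + q + 1 + 1 by ring,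
        show j + (q + 1) + 1 = j + q + 1 + 1 by ring, Nat.factorial_succ (j + q + 1),
        Nat.factorial_succ j, Nat.factorial_succ q]
      have : ((j + q + 1).factorial : ℝ) ≠ 0 := by positivity
      have : ((j + q + 1 + 1 : ℕ) : ℝ) ≠ 0 := by positivity
      push_cast at *
      field_simp
      ring
    set I : ℕ → ℕ → ℝ := fun m l =>
      (∫ x in (0 : ℝ)..1, bspline ξ q m x * x ^ l) / (ξ (m + q + 1) - ξ m) with hI
    have key : ∀ m a, a = ξ m ∨ a = ξ (m + q + 1) → I m (j + 1) - a * I m j =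
        d q (j + 1) * windowH ξ m (j + 1) (q + 2) - a * (d q j * windowH ξ m j (q + 2)) := by
      intro m a ha
      by_cases hm : ξ (m + q + 1) = ξ m
      · have ha' : ξ m = a := by rcases ha with rfl | rfl <;> simp [hm]
        have hall : ∀ l ≤ q + 1, ξ (m + l) = a := fun l hl => by
          have h1 : ξ m ≤ ξ (m + l) := hξ (by omega)
          have h2 : ξ (m + l) ≤ ξ (m + q + 1) := hξ (by omega)
          linarith
        have hI0 : ∀ l, I m l = 0 := fun l => by simp [hI, hm]
        rw [hI0, hI0, windowH_of_eq ξ m (j + 1) (q + 1) hall, windowH_of_eq ξ m j (q + 1) hall,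
          show q + 1 + (j + 1) = (j + 1) + (q + 1) by ring, Nat.add_comm (q + 1) j,
          Nat.cast_add_choose, Nat.cast_add_choose]
        simp only [hd, show j + 1 + (q + 1) = j + q + 1 + 1 by ring,
          show j + 1 + q + 1 = j + q + 1 + 1 by ring, show j + (q + 1) = j + q + 1 by ring]
        have : ((j + q + 1).factorial : ℝ) ≠ 0 := by positivity
        have : ((j + q + 1 + 1).factorial : ℝ) ≠ 0 := by positivity
        field_simp
        ring
      · have hm' : ξ (m + q + 1) - ξ m ≠ 0 := sub_ne_zero.2 hm
        have hI' : ∀ l, I m l = d q l * windowH ξ m l (q + 2) := fun l => by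
          simp only [hI, ih, hd]
          rw [mul_left_comm, mul_div_cancel_left₀ _ hm']
        rw [hI', hI']
    have e1 := key i (ξ i) (Or.inl rfl)
    have e2 := key (i + 1) (ξ (i + q + 2)) (Or.inr (by ring_nf))
    have hint : ∫ x in (0 : ℝ)..1, bspline ξ (q + 1) i x * x ^ j =
        (I i (j + 1) - ξ i * I i j) - (I (i + 1) (j + 1) - ξ (i + q + 2) * I (i + 1) j) := by
      have hii : ∀ m l, IntervalIntegrable (fun x => bspline ξ q m x * x ^ l) volume 0 1 :=
        fun m l => intervalIntegrable_bspline_mul ξ q m (by fun_prop)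
      simp only [hI, ← intervalIntegral.integral_div, ← intervalIntegral.integral_const_mul]
      rw [← intervalIntegral.integral_sub, ← intervalIntegral.integral_sub,
        ← intervalIntegral.integral_sub]
      · refine intervalIntegral.integral_congr fun x _ => ?_
        simp only [bspline_succ_apply]
        rw [show i + 1 + q + 1 = i + q + 2 by ring]
        ring
      all_goals first
        | exact (hii _ _).div_const _
        | exact ((hii _ _).div_const _).const_mul _
        | exact ((hii _ _).div_const _).sub (((hii _ _).div_const _).const_mul _)
    rw [hint, e1, e2]
    change _ = d (q + 1) j * _
    rw [hd1]
    have f1 := windowH_sub ξ i j (q + 2)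
    have f2 : ξ (i + q + 2) * windowH ξ (i + 1) j (q + 2) - ξ i * windowH ξ i j (q + 2) =
        (ξ (i + q + 2) - ξ i) * windowH ξ i j (q + 2 + 1) := by
      cases j with
      | zero => simp
      | succ l =>
        have g1 := windowH_succ_succ ξ i l (q + 2)
        have g2 := windowH_succ_succ' ξ i l (q + 2)
        rw [← add_assoc] at g1
        linear_combination ξ i * g1 - ξ (i + q + 2) * g2
    rw [← add_assoc] at f1
    rw [show i + (q + 1) + 1 = i + q + 2 by ring, show q + 1 + 2 = q + 2 + 1 by ring]
    linear_combination d q (j + 1) * f1 + d q j * f2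

/-- A polynomial of degree `< r` which is orthogonal to `r` consecutive B-splines vanishes. -/
lemma eq_zero_of_integral_bspline_mul (h0 : ∀ m, ξ m ∈ Icc (0 : ℝ) 1) {q a r : ℕ}
    (hpos : ∀ m < r, ξ (a + m) < ξ (a + m + q + 1)) (c : ℕ → ℝ)
    (h : ∀ m < r, ∑ j ∈ Finset.range r,
      c j * ∫ x in (0 : ℝ)..1, bspline ξ q (a + m) x * x ^ j = 0) :
    ∀ j < r, c j = 0 := by
  have hd : ∀ j, (j.factorial * q.factorial / (j + q + 1).factorial : ℝ) ≠ 0 :=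
    fun j => by positivity
  intro j hj
  have := windowH_injective ξ a r (w := q + 2) hξ
    (fun j => c j * (j.factorial * q.factorial / (j + q + 1).factorial : ℝ))
    (fun m hm => (hpos m hm).trans_le (hξ (by omega))) (fun m hm => ?_) j hj
  · exact (mul_eq_zero.1 this).resolve_right (hd j)
  · refine (mul_eq_zero.1 ?_).resolve_left (sub_ne_zero.2 (hpos m hm).ne')
    rw [← h m hm, Finset.mul_sum]
    refine Finset.sum_congr rfl fun j _ => ?_
    rw [integral_bspline_mul_pow hξ h0]
    ring

/-- Away from the knots, B-splines are differentiable, with the usual derivative. -/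
lemma hasDerivAt_bspline (q i : ℕ) {x : ℝ} (hx : ∀ m, x ≠ ξ m) (hx1 : x ≠ 1) :
    HasDerivAt (bspline ξ (q + 1) i)
      ((q + 1) * (bspline ξ q i x / (ξ (i + q + 1) - ξ i) -
        bspline ξ q (i + 1) x / (ξ (i + q + 2) - ξ (i + 1)))) x := by
  have hlin1 : ∀ a d : ℝ, HasDerivAt (fun y => (y - a) / d) (1 / d) x := fun a d =>
    ((hasDerivAt_id x).sub_const a).div_const d
  have hlin2 : ∀ a d : ℝ, HasDerivAt (fun y => (a - y) / d) (-1 / d) x := fun a d =>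
    ((hasDerivAt_id x).const_sub a).div_const d
  induction q generalizing i with
  | zero =>
    have hloc : ∀ m, HasDerivAt (bspline ξ 0 m) 0 x := fun m => by
      refine (hasDerivAt_const x (bspline ξ 0 m x)).congr_of_eventuallyEq ?_
      have h1 : ∀ᶠ y in nhds x, (ξ m ≤ y ↔ ξ m ≤ x) ∧ (y < ξ (m + 1) ↔ x < ξ (m + 1)) ∧ y ≠ 1 := by
        refine Filter.Eventually.and ?_ (Filter.Eventually.and ?_ (eventually_ne_nhds hx1))
        · rcases lt_or_gt_of_ne (hx m) with h | h
          · filter_upwards [eventually_lt_nhds h] with y hy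
            simp [not_le.2 hy, not_le.2 h]
          · filter_upwards [eventually_gt_nhds h] with y hy
            simp [hy.le, h.le]
        · rcases lt_or_gt_of_ne (hx (m + 1)) with h | h
          · filter_upwards [eventually_lt_nhds h] with y hy
            simp [hy, h]
          · filter_upwards [eventually_gt_nhds h] with y hy
            simp [not_lt.2 hy.le, not_lt.2 h.le]
      filter_upwards [h1] with y hy
      simp [bspline, hy.1, hy.2.1, hy.2.2, hx1]
    have : HasDerivAt (bspline ξ 1 i) _ x :=
      ((hlin1 (ξ i) (ξ (i + 0 + 1) - ξ i)).mul (hloc i)).add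
        ((hlin2 (ξ (i + 0 + 2)) (ξ (i + 0 + 2) - ξ (i + 1))).mul (hloc (i + 1)))
    refine this.congr_deriv ?_
    push_cast
    ring
  | succ q ih =>
    have : HasDerivAt (bspline ξ (q + 1 + 1) i) _ x :=
      ((hlin1 (ξ i) (ξ (i + (q + 1) + 1) - ξ i)).mul (ih i)).add
        ((hlin2 (ξ (i + (q + 1) + 2)) (ξ (i + (q + 1) + 2) - ξ (i + 1))).mul (ih (i + 1)))
    refine this.congr_deriv ?_
    -- if the support of one of the outer B-splines is degenerate, so is that of the middle one
    have key : ∀ l m : ℕ, l ≤ i + 1 → i + q + 2 ≤ m → (ξ m - ξ l) / (ξ m - ξ l) *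
        (bspline ξ q (i + 1) x / (ξ (i + q + 2) - ξ (i + 1))) =
        bspline ξ q (i + 1) x / (ξ (i + q + 2) - ξ (i + 1)) := fun l m hl hm => by
      by_cases h : ξ m - ξ l = 0
      · have h1 : ξ l ≤ ξ (i + 1) := hξ hl
        have h2 : ξ (i + 1) ≤ ξ (i + q + 2) := hξ (by omega)
        have h3 : ξ (i + q + 2) ≤ ξ m := hξ hm
        rw [show ξ (i + q + 2) - ξ (i + 1) = 0 by linarith]
        simp
      · rw [div_self h, one_mul]
    have k1 := key i (i + q + 2) (by omega) le_rfl
    have k2 := key (i + 1) (i + q + 3) le_rfl (by omega)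
    rw [bspline_succ_apply ξ q i, bspline_succ_apply ξ q (i + 1)]
    simp only [show i + (q + 1) + 1 = i + q + 2 by ring, show i + (q + 1) + 2 = i + q + 3 by ring,
      show i + 1 + q + 1 = i + q + 2 by ring, show i + 1 + q + 2 = i + q + 3 by ring]
    push_cast
    linear_combination (q + 1 : ℝ) * (k2 - k1)

omit hξ in
lemma bspline_zero_eq_sub (i : ℕ) {x : ℝ} (hx1 : x < 1) (h : ξ i ≤ ξ (i + 1)) :
    bspline ξ 0 i x = (if ξ i ≤ x then 1 else 0) - if ξ (i + 1) ≤ x then 1 else 0 := by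
  simp only [bspline, hx1.ne, false_and, or_false]
  split_ifs <;> first | (simp; done) | (exfalso; grind)

lemma bspline_eq_zero_of_lt (q i : ℕ) {x : ℝ} (hx : x < ξ i) : bspline ξ q i x = 0 := by
  induction q generalizing i with
  | zero => simp [bspline, not_le.2 hx]
  | succ q ih =>
    rw [bspline_succ_apply, ih i hx, ih (i + 1) (hx.trans_le (hξ (by omega)))]
    simp

lemma bspline_eq_zero_of_ge (q i : ℕ) {x : ℝ} (hx : ξ (i + q + 1) ≤ x) (hx1 : x < 1) :
    bspline ξ q i x = 0 := by
  induction q generalizing i with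
  | zero =>
    have : ξ i ≤ x := (hξ (by omega)).trans hx
    simp only [add_zero] at hx
    simp [bspline, not_lt.2 hx, hx1.ne]
  | succ q ih =>
    rw [bspline_succ_apply, ih i ((hξ (by omega)).trans hx), ih (i + 1) (by
      rwa [show i + 1 + q + 1 = i + (q + 1) + 1 by ring])]
    simp

open Polynomial in
/-- Marsden's identity, as an identity of polynomials. -/
lemma marsden (q a b : ℕ) {x : ℝ} (hax : ξ (a + q) ≤ x) (hxb : x < ξ b) (hx1 : x < 1) :
    ∑ i ∈ Finset.Ico a b,
      C (bspline ξ q i x) * ∏ m ∈ Finset.range q, (X - C (ξ (i + m + 1))) = (X - C x) ^ q := by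
  have hlt : a + q < b := by
    by_contra! h
    exact absurd (hξ h) (not_le.2 (hax.trans_lt hxb))
  induction q generalizing a with
  | zero =>
    have key : ∀ b, a ≤ b → ∑ i ∈ Finset.Ico a b, bspline ξ 0 i x =
        (if ξ a ≤ x then 1 else 0) - if ξ b ≤ x then 1 else 0 := fun b hb => by
      induction b, hb using Nat.le_induction with
      | base => simp
      | succ b hb ih =>
        rw [Finset.sum_Ico_succ_top hb, ih, bspline_zero_eq_sub b hx1 (hξ (by omega))]
        ring
    have := key b (by omega)
    rw [if_pos (by simpa using hax), if_neg (not_le.2 hxb)] at this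
    simp only [Finset.range_zero, Finset.prod_empty, mul_one, pow_zero]
    rw [← map_sum, this]
    simp
  | succ q ih =>
    have ih' := ih (a + 1) (by rwa [show a + 1 + q = a + (q + 1) by ring]) (by omega)
    set N : ℕ → ℝ := fun i => bspline ξ q i x / (ξ (i + q + 1) - ξ i) with hN
    have hNa : N a = 0 := by
      simp only [hN]
      rw [bspline_eq_zero_of_ge hξ q a (by rwa [add_assoc]) hx1, zero_div]
    have hNb : N b = 0 := by
      simp only [hN]
      rw [bspline_eq_zero_of_lt hξ q b hxb, zero_div]
    set ψ : ℕ → ℕ → ℝ[X] := fun q i => ∏ m ∈ Finset.range q, (X - C (ξ (i + m + 1))) with hψ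
    have hB : ∀ i, C (bspline ξ (q + 1) i x) * ψ (q + 1) i =
        C ((x - ξ i) * N i) * ψ (q + 1) i +
          C ((ξ (i + 1 + q + 1) - x) * N (i + 1)) * ψ (q + 1) i := fun i => by
      rw [← add_mul, ← map_add, bspline_succ_apply]
      simp only [hN]
      rw [show i + 1 + q + 1 = i + q + 2 by ring]
      congr 2
      ring
    have hψ1 : ∀ i, ψ (q + 1) i = ψ q i * (X - C (ξ (i + q + 1))) := fun i => by
      simp only [hψ, Finset.prod_range_succ]
    have hψ2 : ∀ i, ψ (q + 1) i = ψ q (i + 1) * (X - C (ξ (i + 1))) := fun i => by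
      simp only [hψ]
      rw [Finset.prod_range_succ']
      refine congrArg₂ _ (Finset.prod_congr rfl fun m _ => ?_) rfl
      rw [show i + (m + 1) + 1 = i + 1 + m + 1 by ring]
    obtain ⟨b, rfl⟩ : ∃ b', b = b' + 1 := ⟨b - 1, by omega⟩
    rw [Finset.sum_congr rfl fun i _ => hB i, Finset.sum_add_distrib,
      Finset.sum_eq_sum_Ico_succ_bot (by omega) (fun i => C ((x - ξ i) * N i) * ψ (q + 1) i),
      Finset.sum_Ico_succ_top (by omega)
        (fun i => C ((ξ (i + 1 + q + 1) - x) * N (i + 1)) * ψ (q + 1) i), hNa, hNb,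
      pow_succ, ← ih', Finset.sum_mul,
      ← Finset.sum_Ico_add' (fun i => C (bspline ξ q i x) * ψ q i * (X - C x)) a b 1,
      ← Finset.sum_Ico_add' (fun i => C ((x - ξ i) * N i) * ψ (q + 1) i) a b 1]
    simp only [mul_zero, map_zero, zero_mul, zero_add, add_zero]
    rw [← Finset.sum_add_distrib]
    refine Finset.sum_congr rfl fun i _ => ?_
    rw [hψ1 (i + 1), hψ2 i]
    have hNB : bspline ξ q (i + 1) x = (ξ (i + 1 + q + 1) - ξ (i + 1)) * N (i + 1) := by
      by_cases h : ξ (i + 1 + q + 1) = ξ (i + 1)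
      · rw [bspline_eq_zero_of_eq hξ q (i + 1) h, h]
        simp
      · simp only [hN]
        rw [mul_div_cancel₀ _ (sub_ne_zero.2 h)]
    rw [hNB]
    simp only [map_mul, map_sub]
    ring

omit hξ in
/-- If all knots inside `(0,1)` are simple then the B-splines of positive degree are continuous. -/
lemma continuousOn_bspline (h0 : ∀ m, ξ m ∈ Icc (0 : ℝ) 1)
    (hs : ∀ m, ξ m < ξ (m + 1) ∨ (ξ m = ξ (m + 1) ∧ (ξ m = 0 ∨ ξ m = 1))) (q i : ℕ) :
    ContinuousOn (bspline ξ (q + 1) i) (Icc 0 1) := by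
  induction q generalizing i with
  | zero =>
    have e1 := (h0 i).1
    have e2 := (h0 (i + 1)).2
    have e3 := (h0 (i + 2)).2
    have e4 := (h0 (i + 1)).1
    rcases hs i with h | ⟨h, h'⟩ <;> rcases hs (i + 1) with h2 | ⟨h2, h2'⟩
    · refine ContinuousOn.congr (f := fun x => max 0 (min ((x - ξ i) / (ξ (i + 1) - ξ i))
        ((ξ (i + 2) - x) / (ξ (i + 2) - ξ (i + 1))))) (by fun_prop) fun x hx => ?_
      simp only [bspline, add_zero]
      have p1 : 0 < ξ (i + 1) - ξ i := by linarith
      have p2 : 0 < ξ (i + 2) - ξ (i + 1) := by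
        rw [show i + 2 = i + 1 + 1 by ring]; linarith
      have p2' : ξ (i + 1) < ξ (i + 2) := by linarith
      rw [show i + 1 + 1 = i + 2 by ring]
      rcases lt_or_ge x (ξ i) with c1 | c1
      · rw [if_neg (by grind), if_neg (by grind), max_eq_left]
        · simp
        · exact (min_le_left _ _).trans (div_nonpos_of_nonpos_of_nonneg (by linarith) p1.le)
      · rcases lt_or_ge x (ξ (i + 1)) with c2 | c2
        · rw [if_pos (by grind), if_neg (by grind), min_eq_left, max_eq_right]
          · simp
          · exact div_nonneg (by linarith) p1.le
          · calc _ ≤ (1 : ℝ) := (div_le_one p1).2 (by linarith)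
              _ ≤ _ := (one_le_div p2).2 (by linarith)
        · rw [if_neg (by grind), min_eq_right]
          · rcases lt_or_ge x (ξ (i + 2)) with c3 | c3
            · rw [if_pos (by grind), max_eq_right]
              · simp
              · exact div_nonneg (by linarith) p2.le
            · rw [max_eq_left (div_nonpos_of_nonpos_of_nonneg (by linarith) p2.le)]
              split_ifs with hc
              · rw [show ξ (i + 2) - x = 0 by grind]; simp
              · simp
          · calc _ ≤ (1 : ℝ) := (div_le_one p2).2 (by linarith)
              _ ≤ _ := (one_le_div p1).2 (by linarith)
    · refine ContinuousOn.congr (f := fun x => max 0 ((x - ξ i) / (ξ (i + 1) - ξ i)))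
        (by fun_prop) fun x hx => ?_
      have p1 : 0 < ξ (i + 1) - ξ i := by linarith
      have hb : ξ (i + 1) = 1 := by rcases h2' with h3 | h3 <;> linarith
      simp only [bspline, add_zero]
      rw [show i + 1 + 1 = i + 2 by ring] at *
      rw [← h2, sub_self, div_zero, zero_mul, add_zero]
      rcases lt_or_ge x (ξ i) with c1 | c1
      · rw [if_neg (by grind), max_eq_left, mul_zero]
        exact div_nonpos_of_nonpos_of_nonneg (by linarith) p1.le
      · rw [if_pos (by grind), max_eq_right, mul_one]
        exact div_nonneg (by linarith) p1.le
    · refine ContinuousOn.congr (f := fun x => max 0 ((ξ (i + 2) - x) / (ξ (i + 2) - ξ (i + 1))))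
        (by fun_prop) fun x hx => ?_
      have hb : ξ (i + 1) = 0 := by
        rw [show i + 1 + 1 = i + 2 by ring] at *
        rcases h' with h3 | h3 <;> linarith
      simp only [bspline, add_zero]
      rw [show i + 1 + 1 = i + 2 by ring] at *
      have p1 : 0 < ξ (i + 2) - ξ (i + 1) := by linarith
      rw [← h, sub_self, div_zero, zero_mul, zero_add]
      rcases lt_or_ge x (ξ (i + 2)) with c1 | c1
      · rw [h, if_pos (by grind), max_eq_right, mul_one]
        exact div_nonneg (by linarith) p1.le
      · rw [h, max_eq_left (div_nonpos_of_nonpos_of_nonneg (by linarith) p1.le)]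
        split_ifs with hc
        · rw [show ξ (i + 2) - x = 0 by grind]; simp
        · simp
    · refine ContinuousOn.congr (f := fun _ => 0) continuousOn_const fun x hx => ?_
      simp only [bspline, add_zero]
      rw [show i + 1 + 1 = i + 2 by ring] at *
      rw [← h2, h]
      simp
  | succ q ih =>
    have h1 := ih i
    have h2 := ih (i + 1)
    change ContinuousOn (fun x => (x - ξ i) / (ξ (i + (q + 1) + 1) - ξ i) * bspline ξ (q + 1) i x +
      (ξ (i + (q + 1) + 2) - x) / (ξ (i + (q + 1) + 2) - ξ (i + 1)) *
        bspline ξ (q + 1) (i + 1) x) _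
    fun_prop

end Monotone

/-! ### Bounded measurable functions on the unit interval -/

/-- The algebra of measurable functions which are bounded on `[0,1]`. It contains all splines, so
that all integrals over `[0,1]` below exist. -/
def bddMeas : Subalgebra ℝ (ℝ → ℝ) where
  carrier := {f | Measurable f ∧ ∃ C, ∀ x ∈ Icc (0 : ℝ) 1, |f x| ≤ C}
  mul_mem' := by
    rintro f g ⟨hf, C, hC⟩ ⟨hg, D, hD⟩
    refine ⟨hf.mul hg, C * D, fun x hx => ?_⟩
    rw [Pi.mul_apply, abs_mul]
    exact mul_le_mul (hC x hx) (hD x hx) (abs_nonneg _) ((abs_nonneg _).trans (hC x hx))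
  add_mem' := by
    rintro f g ⟨hf, C, hC⟩ ⟨hg, D, hD⟩
    exact ⟨hf.add hg, C + D, fun x hx => (abs_add_le _ _).trans (add_le_add (hC x hx) (hD x hx))⟩
  algebraMap_mem' := fun c => ⟨measurable_const, |c|, fun _ _ => le_rfl⟩

namespace bddMeas

lemma intervalIntegrable {f : ℝ → ℝ} (hf : f ∈ bddMeas) : IntervalIntegrable f volume 0 1 :=
  let ⟨h, _, hC⟩ := hf
  intervalIntegrable_of_bounded h hC

lemma of_continuous {f : ℝ → ℝ} (hf : Continuous f) : f ∈ bddMeas :=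
  ⟨hf.measurable, isCompact_Icc.exists_bound_of_continuousOn (s := Icc (0 : ℝ) 1) hf.continuousOn⟩

lemma smul_mem {f : ℝ → ℝ} (c : ℝ) (hf : f ∈ bddMeas) : c • f ∈ bddMeas :=
  Subalgebra.smul_mem _ hf c

lemma sum_mem {ι : Type*} {s : Finset ι} {f : ι → ℝ → ℝ} (h : ∀ i ∈ s, f i ∈ bddMeas) :
    (fun x => ∑ i ∈ s, f i x) ∈ bddMeas := by
  have := Subalgebra.sum_mem _ h
  rwa [show (∑ i ∈ s, f i) = fun x => ∑ i ∈ s, f i x from funext fun x => by simp] at this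

lemma bspline_mem (ξ : ℕ → ℝ) (q i : ℕ) : bspline ξ q i ∈ bddMeas :=
  ⟨measurable_bspline ξ q i, bspline_bounded ξ q i⟩

end bddMeas

/-! ### Reversing the unit interval -/

@[simp] lemma flipIf_flipIf (b : Bool) (t : ℝ) : flipIf b (flipIf b t) = t := by
  cases b <;> simp [flipIf]

@[fun_prop]
lemma continuous_flipIf (b : Bool) : Continuous (flipIf b) := by
  cases b
  · exact continuous_id.congr fun t => by simp [flipIf]
  · exact (continuous_sub_left (1 : ℝ)).congr fun t => by simp [flipIf]

lemma flipIf_mem_Icc (b : Bool) {t : ℝ} : flipIf b t ∈ Icc (0 : ℝ) 1 ↔ t ∈ Icc (0 : ℝ) 1 := by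
  cases b <;> simp [flipIf, and_comm]

lemma flipIf_mem_Ioo (b : Bool) {t : ℝ} : flipIf b t ∈ Ioo (0 : ℝ) 1 ↔ t ∈ Ioo (0 : ℝ) 1 := by
  cases b <;> simp [flipIf, and_comm]

lemma hasDerivAt_flipIf (b : Bool) (t : ℝ) : HasDerivAt (flipIf b) (if b then -1 else 1) t := by
  cases b
  · exact hasDerivAt_id t
  · exact (hasDerivAt_id t).const_sub 1

lemma integral_flipIf (b : Bool) (f : ℝ → ℝ) :
    ∫ x in (0 : ℝ)..1, f (flipIf b x) = ∫ x in (0 : ℝ)..1, f x := by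
  cases b
  · simp [flipIf]
  · simp [flipIf]

lemma bddMeas.comp_flipIf (b : Bool) {f : ℝ → ℝ} (hf : f ∈ bddMeas) :
    (fun x => f (flipIf b x)) ∈ bddMeas := by
  obtain ⟨h, C, hC⟩ := hf
  exact ⟨h.comp (continuous_flipIf b).measurable, C,
    fun x hx => hC _ ((flipIf_mem_Icc b).2 hx)⟩

/-! ### Dual functions of B-splines -/

lemma bspline_moment_det_ne_zero {ξ : ℕ → ℝ} (hξ : Monotone ξ) (h0 : ∀ m, ξ m ∈ Icc (0 : ℝ) 1)
    {q a r : ℕ} (hpos : ∀ m < r, ξ (a + m) < ξ (a + m + q + 1)) :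
    (Matrix.of fun i j : Fin r => ∫ x in (0 : ℝ)..1, bspline ξ q (a + i) x * x ^ (j : ℕ)).det
      ≠ 0 := by
  intro h
  obtain ⟨c, hc, hc0⟩ := Matrix.exists_mulVec_eq_zero_iff.2 h
  refine hc (funext fun j => ?_)
  have := eq_zero_of_integral_bspline_mul hξ h0 (q := q) (a := a) hpos
    (fun j => if hj : j < r then c ⟨j, hj⟩ else 0) (fun m hm => ?_) j j.2
  · simpa using this
  · have h1 := congrFun hc0 ⟨m, hm⟩
    rw [Finset.sum_range]
    simpa [Matrix.mulVec, dotProduct, mul_comm] using h1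

lemma bspline_dual {ξ : ℕ → ℝ} (hξ : Monotone ξ) (h0 : ∀ m, ξ m ∈ Icc (0 : ℝ) 1)
    {q a r : ℕ} (hpos : ∀ m < r, ξ (a + m) < ξ (a + m + q + 1)) :
    ∃ d : Fin r → ℝ → ℝ, (∀ j, Continuous (d j)) ∧ ∀ i j : Fin r,
      ∫ x in (0 : ℝ)..1, bspline ξ q (a + i) x * d j x = if i = j then 1 else 0 := by
  set G := Matrix.of fun i j : Fin r =>
    ∫ x in (0 : ℝ)..1, bspline ξ q (a + i) x * x ^ (j : ℕ) with hG
  have hdet : IsUnit G.det := (bspline_moment_det_ne_zero hξ h0 hpos).isUnit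
  refine ⟨fun j x => ∑ l : Fin r, G⁻¹ l j * x ^ (l : ℕ), fun j => by fun_prop, fun i j => ?_⟩
  have h1 : (G * G⁻¹) i j = if i = j then 1 else 0 := by
    rw [Matrix.mul_nonsing_inv _ hdet, Matrix.one_apply]
  rw [← h1, Matrix.mul_apply]
  simp only [Finset.mul_sum]
  rw [intervalIntegral.integral_finsetSum]
  · refine Finset.sum_congr rfl fun l _ => ?_
    simp only [hG, Matrix.of_apply]
    rw [← intervalIntegral.integral_mul_const]
    exact intervalIntegral.integral_congr fun x _ => by ring
  · exact fun l _ => intervalIntegrable_bspline_mul ξ q _ (by fun_prop)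

/-! ### The splines of an open knot vector -/

namespace KnotVector

variable {p : ℕ} (Ξ : KnotVector p)

/-- The knots, continued by the constant `1` beyond the last one. -/
def knot (i : ℕ) : ℝ := Ξ.ξ (min i (Ξ.n + 1 + p))

lemma knot_of_le {i : ℕ} (h : i ≤ Ξ.n + 1 + p) : Ξ.knot i = Ξ.ξ i := by
  rw [knot, min_eq_left h]

lemma knot_eq_zero {i : ℕ} (h : i ≤ p) : Ξ.knot i = 0 := by
  rw [Ξ.knot_of_le (by omega), Ξ.eq_zero i h]

lemma knot_eq_one {i : ℕ} (h : Ξ.n + 1 ≤ i) : Ξ.knot i = 1 :=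
  Ξ.eq_one _ ⟨by omega, by omega⟩

lemma knot_lt_succ {i : ℕ} (h : p ≤ i) (h' : i ≤ Ξ.n) : Ξ.knot i < Ξ.knot (i + 1) := by
  rw [Ξ.knot_of_le (by omega), Ξ.knot_of_le (by omega)]
  exact Ξ.strictMono ⟨h, by omega⟩ ⟨by omega, by omega⟩ (by omega)

lemma knot_simple (m : ℕ) : Ξ.knot m < Ξ.knot (m + 1) ∨
    (Ξ.knot m = Ξ.knot (m + 1) ∧ (Ξ.knot m = 0 ∨ Ξ.knot m = 1)) := by
  rcases lt_or_ge m p with h | h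
  · right; rw [Ξ.knot_eq_zero h.le, Ξ.knot_eq_zero h]; simp
  · rcases le_or_gt m Ξ.n with h' | h'
    · exact Or.inl (Ξ.knot_lt_succ h h')
    · right; rw [Ξ.knot_eq_one h', Ξ.knot_eq_one (by omega)]; simp

lemma knot_mono : Monotone Ξ.knot :=
  monotone_nat_of_le_succ fun m => (Ξ.knot_simple m).elim le_of_lt fun h => h.1.le

lemma knot_mem_Icc (m : ℕ) : Ξ.knot m ∈ Icc (0 : ℝ) 1 :=
  ⟨(Ξ.knot_eq_zero (Nat.zero_le p)).symm.le.trans (Ξ.knot_mono (Nat.zero_le m)),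
    (Ξ.knot_mono (le_max_left m (Ξ.n + 1))).trans (Ξ.knot_eq_one (le_max_right _ _)).le⟩

/-- A window of at least `p + 1` knots is not degenerate, unless it consists of the first or of
the last ones. -/
lemma knot_lt_add {i q : ℕ} (hi : i ≤ Ξ.n) (hq : p < i + q) (h1 : 1 ≤ q) :
    Ξ.knot i < Ξ.knot (i + q) := by
  rcases le_or_gt p i with h | h
  · exact (Ξ.knot_lt_succ h hi).trans_le (Ξ.knot_mono (by omega))
  · rw [Ξ.knot_eq_zero h.le, ← Ξ.knot_eq_zero le_rfl]
    have := Ξ.three_cells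
    exact (Ξ.knot_lt_succ le_rfl (by omega)).trans_le (Ξ.knot_mono (by omega))

lemma lam0_eq {i : ℕ} (h : i ≤ Ξ.n) : Ξ.lam0 i = bspline Ξ.knot p i :=
  bspline_congr p i fun m hm => (Ξ.knot_of_le (by omega)).symm

lemma lam1_eq {i : ℕ} (hp : 1 ≤ p) (h : i < Ξ.n) : Ξ.lam1 i = bspline Ξ.knot (p - 1) (i + 1) := by
  rw [← bspline_shift]
  exact bspline_congr (p - 1) i fun m hm => (Ξ.knot_of_le (by omega)).symm

/-- The number of a basis function of `𝕍⁰` in the possibly reversed numbering. -/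
def idx0 (rev : Bool) (i : ℕ) : ℕ := if rev then Ξ.n - i else i

/-- The number of a basis function of `𝕍¹` in the possibly reversed numbering. -/
def idx1 (rev : Bool) (i : ℕ) : ℕ := if rev then Ξ.n - 1 - i else i

lemma idx0_le {rev : Bool} {i : ℕ} (h : i ≤ Ξ.n) : Ξ.idx0 rev i ≤ Ξ.n := by
  unfold idx0; split_ifs <;> omega

lemma idx1_lt {rev : Bool} {i : ℕ} (h : i < Ξ.n) : Ξ.idx1 rev i < Ξ.n := by
  unfold idx1; split_ifs <;> omega

lemma idx0_idx0 {rev : Bool} {i : ℕ} (h : i ≤ Ξ.n) : Ξ.idx0 rev (Ξ.idx0 rev i) = i := by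
  unfold idx0; split_ifs <;> omega

lemma idx1_idx1 {rev : Bool} {i : ℕ} (h : i < Ξ.n) : Ξ.idx1 rev (Ξ.idx1 rev i) = i := by
  unfold idx1; split_ifs <;> omega

lemma lam0'_apply (rev : Bool) (i : ℕ) (t : ℝ) :
    Ξ.lam0' rev i t = Ξ.lam0 (Ξ.idx0 rev i) (flipIf rev t) := by
  cases rev <;> simp [lam0', idx0, flipIf]

lemma lam1'_apply (rev : Bool) (i : ℕ) (t : ℝ) :
    Ξ.lam1' rev i t = Ξ.lam1 (Ξ.idx1 rev i) (flipIf rev t) := by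
  cases rev <;> simp [lam1', idx1, flipIf]

lemma lam0_mem_bddMeas (i : ℕ) : Ξ.lam0 i ∈ bddMeas := bddMeas.bspline_mem _ _ _

lemma lam1_mem_bddMeas (i : ℕ) : Ξ.lam1 i ∈ bddMeas := bddMeas.bspline_mem _ _ _

lemma lam0'_mem_bddMeas (rev : Bool) (i : ℕ) : Ξ.lam0' rev i ∈ bddMeas := by
  rw [show Ξ.lam0' rev i = _ from funext fun t => Ξ.lam0'_apply rev i t]
  exact bddMeas.comp_flipIf rev (Ξ.lam0_mem_bddMeas _)

lemma lam1'_mem_bddMeas (rev : Bool) (i : ℕ) : Ξ.lam1' rev i ∈ bddMeas := by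
  rw [show Ξ.lam1' rev i = _ from funext fun t => Ξ.lam1'_apply rev i t]
  exact bddMeas.comp_flipIf rev (Ξ.lam1_mem_bddMeas _)

lemma bspline_knot_at_zero {q : ℕ} (i : ℕ) (hq : q ≤ p) :
    bspline Ξ.knot q i 0 = if i + q = p then 1 else 0 := by
  have h3 := Ξ.three_cells
  have hpos : ∀ i, p < i → 0 < Ξ.knot i := fun i hi => by
    rw [← Ξ.knot_eq_zero le_rfl]
    exact (Ξ.knot_lt_succ le_rfl (by omega)).trans_le (Ξ.knot_mono (by omega))
  induction q generalizing i with
  | zero =>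
    simp only [bspline, zero_ne_one, false_and, or_false, add_zero]
    rcases lt_trichotomy i p with h | h | h
    · rw [Ξ.knot_eq_zero h, if_neg (by simp), if_neg h.ne]
    · rw [h, Ξ.knot_eq_zero le_rfl, if_pos ⟨le_rfl, hpos _ (by omega)⟩, if_pos rfl]
    · rw [if_neg (fun h' => absurd h'.1 (not_le.2 (hpos i h))), if_neg h.ne']
  | succ q ih =>
    rcases le_or_gt i p with h | h
    · rw [bspline_succ_apply, ih (i + 1) (by omega), Ξ.knot_eq_zero h]
      by_cases h1 : i + (q + 1) = p
      · rw [if_pos h1, if_pos (by omega), Ξ.knot_eq_zero (i := i + 1) (by omega)]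
        have := hpos (i + q + 2) (by omega)
        field_simp
        simp [this.ne']
      · rw [if_neg h1, if_neg (by omega)]
        simp
    · rw [bspline_eq_zero_of_lt Ξ.knot_mono _ _ (hpos i h), if_neg (by omega)]

lemma bspline_knot_at_one (q i : ℕ) : bspline Ξ.knot q i 1 = if i = Ξ.n then 1 else 0 := by
  have h3 := Ξ.three_cells
  induction q generalizing i with
  | zero =>
    have hle := (Ξ.knot_mem_Icc i).2
    have hle' := (Ξ.knot_mem_Icc (i + 1)).2
    simp only [bspline, true_and, not_lt.2 hle', false_or]
    rcases lt_trichotomy i Ξ.n with h | h | h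
    · have : Ξ.knot (i + 1) < 1 := by
        refine (Ξ.knot_mono (show i + 1 ≤ Ξ.n by omega)).trans_lt ?_
        exact (Ξ.knot_lt_succ (by omega) le_rfl).trans_le (Ξ.knot_mem_Icc _).2
      rw [if_neg (by grind), if_neg h.ne]
    · subst h
      have := Ξ.knot_lt_succ (i := Ξ.n) (by omega) le_rfl
      rw [if_pos ⟨hle, by linarith, Ξ.knot_eq_one le_rfl⟩, if_pos rfl]
    · rw [Ξ.knot_eq_one h, if_neg (by simp), if_neg h.ne']
  | succ q ih =>
    rw [bspline_succ_apply, ih, ih]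
    by_cases h : i = Ξ.n
    · subst h
      have := Ξ.knot_lt_succ (i := Ξ.n) (by omega) le_rfl
      rw [Ξ.knot_eq_one le_rfl] at this
      rw [if_pos rfl, if_neg (by omega), Ξ.knot_eq_one (i := Ξ.n + q + 1) (by omega),
        div_self (by linarith)]
      simp
    · rw [if_neg h]
      by_cases h1 : i + 1 = Ξ.n
      · rw [Ξ.knot_eq_one (i := i + q + 2) (by omega)]; simp
      · rw [if_neg h1]; simp

/-- The basis functions of `𝕍⁰` at an end point: only the first one does not vanish. -/
lemma lam0'_zero (rev : Bool) {i : ℕ} (hi : i ≤ Ξ.n) :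
    Ξ.lam0' rev i 0 = if i = 0 then 1 else 0 := by
  rw [lam0'_apply, Ξ.lam0_eq (Ξ.idx0_le hi)]
  cases rev
  · simp [flipIf, idx0, Ξ.bspline_knot_at_zero i le_rfl]
  · simp only [flipIf, idx0, if_true, sub_zero, bspline_knot_at_one]
    exact if_congr (by omega) rfl rfl

lemma continuousOn_lam0 (hp : 1 ≤ p) {i : ℕ} (hi : i ≤ Ξ.n) :
    ContinuousOn (Ξ.lam0 i) (Icc 0 1) := by
  rw [Ξ.lam0_eq hi]
  obtain ⟨q, rfl⟩ : ∃ q, p = q + 1 := ⟨p - 1, by omega⟩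
  exact continuousOn_bspline Ξ.knot_mem_Icc Ξ.knot_simple q i

/-- The space `𝕍¹`, seen through a possibly reversed coordinate. -/
def space1 (rev : Bool) : Submodule ℝ (ℝ → ℝ) :=
  Submodule.span ℝ (range fun i : Fin Ξ.n => Ξ.lam1' rev i)

lemma lam1'_mem_space1 (rev : Bool) {i : ℕ} (hi : i < Ξ.n) : Ξ.lam1' rev i ∈ Ξ.space1 rev :=
  Submodule.subset_span ⟨⟨i, hi⟩, rfl⟩

lemma lam0'_mem_space0 (rev : Bool) {i : ℕ} (hi : i ≤ Ξ.n) : Ξ.lam0' rev i ∈ Ξ.space0 rev :=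
  Submodule.subset_span ⟨⟨i, by omega⟩, rfl⟩

lemma space1_le_bddMeas (rev : Bool) {f : ℝ → ℝ} (hf : f ∈ Ξ.space1 rev) : f ∈ bddMeas := by
  have : Ξ.space1 rev ≤ Subalgebra.toSubmodule bddMeas := by
    refine Submodule.span_le.2 ?_
    rintro _ ⟨i, rfl⟩
    exact Ξ.lam1'_mem_bddMeas rev i
  exact this hf

lemma space0_le_bddMeas (rev : Bool) {f : ℝ → ℝ} (hf : f ∈ Ξ.space0 rev) : f ∈ bddMeas := by
  have : Ξ.space0 rev ≤ Subalgebra.toSubmodule bddMeas := by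
    refine Submodule.span_le.2 ?_
    rintro _ ⟨i, rfl⟩
    exact Ξ.lam0'_mem_bddMeas rev i
  exact this hf

/-! ### Dual functions, moments and the mass matrix -/

lemma lam0_dual : ∃ d : Fin (Ξ.n + 1) → ℝ → ℝ, (∀ j, Continuous (d j)) ∧
    ∀ i j : Fin (Ξ.n + 1), ∫ x in (0 : ℝ)..1, Ξ.lam0 i x * d j x = if i = j then 1 else 0 := by
  obtain ⟨d, hd, h⟩ := bspline_dual Ξ.knot_mono Ξ.knot_mem_Icc (q := p) (a := 0) (r := Ξ.n + 1)
    fun m hm => by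
      rw [zero_add]
      exact Ξ.knot_lt_add (q := p + 1) (by omega) (by omega) (by omega)
  refine ⟨d, hd, fun i j => ?_⟩
  rw [Ξ.lam0_eq (by omega), ← h i j, zero_add]

lemma lam1_dual (hp : 1 ≤ p) : ∃ d : Fin Ξ.n → ℝ → ℝ, (∀ j, Continuous (d j)) ∧
    ∀ i j : Fin Ξ.n, ∫ x in (0 : ℝ)..1, Ξ.lam1 i x * d j x = if i = j then 1 else 0 := by
  obtain ⟨d, hd, h⟩ := bspline_dual Ξ.knot_mono Ξ.knot_mem_Icc (q := p - 1) (a := 1) (r := Ξ.n)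
    fun m hm => by
      rw [add_assoc]
      exact Ξ.knot_lt_add (q := p - 1 + 1) (by omega) (by omega) (by omega)
  refine ⟨d, hd, fun i j => ?_⟩
  rw [Ξ.lam1_eq hp (by omega), ← h i j, add_comm]

lemma lam1'_dual (hp : 1 ≤ p) (rev : Bool) : ∃ d : Fin Ξ.n → ℝ → ℝ, (∀ j, Continuous (d j)) ∧
    ∀ i j : Fin Ξ.n, ∫ x in (0 : ℝ)..1, Ξ.lam1' rev i x * d j x = if i = j then 1 else 0 := by
  obtain ⟨d, hd, h⟩ := Ξ.lam1_dual hp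
  refine ⟨fun j x => d ⟨Ξ.idx1 rev j, Ξ.idx1_lt j.2⟩ (flipIf rev x),
    fun j => (hd _).comp (continuous_flipIf rev), fun i j => ?_⟩
  simp only [lam1'_apply]
  rw [integral_flipIf rev fun x => Ξ.lam1 (Ξ.idx1 rev i) x * d ⟨Ξ.idx1 rev j, Ξ.idx1_lt j.2⟩ x]
  rw [h ⟨Ξ.idx1 rev i, Ξ.idx1_lt i.2⟩]
  refine if_congr ⟨fun h => ?_, fun h => by rw [h]⟩ rfl rfl
  have := congrArg (Ξ.idx1 rev) (Fin.mk.inj_iff.1 h)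
  rw [Ξ.idx1_idx1 i.2, Ξ.idx1_idx1 j.2] at this
  exact Fin.ext this

end KnotVector

lemma intervalIntegral_congr_Ioo {f g : ℝ → ℝ} (h : ∀ᵐ x ∂volume.restrict (Ioo (0 : ℝ) 1), f x = g x) :
    ∫ x in (0 : ℝ)..1, f x = ∫ x in (0 : ℝ)..1, g x := by
  rw [intervalIntegral.integral_of_le zero_le_one, intervalIntegral.integral_of_le zero_le_one,
    integral_Ioc_eq_integral_Ioo, integral_Ioc_eq_integral_Ioo]
  exact integral_congr_ae h

namespace KnotVector

variable {p : ℕ} (Ξ : KnotVector p)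

/-- B-splines are linearly independent modulo null functions. -/
lemma coeff_eq_zero_of_ae (hp : 1 ≤ p) (rev : Bool) (c : Fin Ξ.n → ℝ)
    (h : ∀ᵐ x ∂volume.restrict (Ioo (0 : ℝ) 1), ∑ i, c i * Ξ.lam1' rev i x = 0) : c = 0 := by
  obtain ⟨d, hd, hdual⟩ := Ξ.lam1'_dual hp rev
  funext j
  have h1 : ∫ x in (0 : ℝ)..1, (∑ i, c i * Ξ.lam1' rev i x) * d j x = 0 := by
    rw [intervalIntegral_congr_Ioo (g := fun _ => 0)]
    · simp
    · filter_upwards [h] with x hx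
      rw [hx, zero_mul]
  simp only [Finset.sum_mul] at h1
  rw [intervalIntegral.integral_finsetSum] at h1
  · simp only [mul_assoc, intervalIntegral.integral_const_mul, hdual] at h1
    simpa using h1
  · intro i _
    simp only [mul_assoc]
    exact (bddMeas.intervalIntegrable
      (mul_mem (Ξ.lam1'_mem_bddMeas rev i) (bddMeas.of_continuous (hd j)))).const_mul _

/-- The mass matrix of `𝕍¹`. -/
noncomputable def mass (rev : Bool) : Matrix (Fin Ξ.n) (Fin Ξ.n) ℝ :=
  Matrix.of fun i j : Fin Ξ.n => ∫ x in (0 : ℝ)..1, Ξ.lam1' rev i x * Ξ.lam1' rev j x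

lemma integral_lam1'_mul_sum (rev : Bool) (c : Fin Ξ.n → ℝ) (i : Fin Ξ.n) :
    ∫ x in (0 : ℝ)..1, Ξ.lam1' rev i x * ∑ j, c j * Ξ.lam1' rev j x =
      (Ξ.mass rev).mulVec c i := by
  simp only [Finset.mul_sum]
  rw [intervalIntegral.integral_finsetSum]
  · simp only [Matrix.mulVec, dotProduct, mass, Matrix.of_apply]
    refine Finset.sum_congr rfl fun j _ => ?_
    rw [← intervalIntegral.integral_mul_const]
    exact intervalIntegral.integral_congr fun x _ => by ring
  · intro j _
    exact bddMeas.intervalIntegrable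
      (mul_mem (Ξ.lam1'_mem_bddMeas rev i) (bddMeas.smul_mem (c j) (Ξ.lam1'_mem_bddMeas rev j)))

lemma isUnit_mass_det (hp : 1 ≤ p) (rev : Bool) : IsUnit (Ξ.mass rev).det := by
  rw [isUnit_iff_ne_zero]
  intro h
  obtain ⟨c, hc, hc0⟩ := Matrix.exists_mulVec_eq_zero_iff.2 h
  refine hc (Ξ.coeff_eq_zero_of_ae hp rev c ?_)
  have hS : (fun x => ∑ j, c j * Ξ.lam1' rev j x) ∈ bddMeas :=
    bddMeas.sum_mem fun j _ => bddMeas.smul_mem (c j) (Ξ.lam1'_mem_bddMeas rev j)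
  have h1 : ∫ x in (0 : ℝ)..1,
      (∑ j, c j * Ξ.lam1' rev j x) * (∑ j, c j * Ξ.lam1' rev j x) = 0 := by
    have h2 : ∀ x, (∑ j, c j * Ξ.lam1' rev j x) * (∑ j, c j * Ξ.lam1' rev j x) =
        ∑ i, c i * (Ξ.lam1' rev i x * ∑ j, c j * Ξ.lam1' rev j x) := fun x => by
      rw [Finset.sum_mul]
      exact Finset.sum_congr rfl fun i _ => by ring
    simp only [h2]
    rw [intervalIntegral.integral_finsetSum]
    · simp [intervalIntegral.integral_const_mul, integral_lam1'_mul_sum, hc0]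
    · exact fun i _ => (bddMeas.intervalIntegrable
        (mul_mem (Ξ.lam1'_mem_bddMeas rev i) hS)).const_mul _
  rw [intervalIntegral.integral_of_le zero_le_one, integral_Ioc_eq_integral_Ioo,
    integral_eq_zero_iff_of_nonneg] at h1
  · filter_upwards [h1] with x hx using by simpa using hx
  · exact fun x => mul_self_nonneg _
  · have := bddMeas.intervalIntegrable (mul_mem hS hS)
    rw [intervalIntegrable_iff_integrableOn_Ioo_of_le zero_le_one] at this
    exact this

/-! ### The `L²`-projection onto `𝕍¹` -/

lemma mem_space1_iff (rev : Bool) {f : ℝ → ℝ} : f ∈ Ξ.space1 rev ↔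
    ∃ c : Fin Ξ.n → ℝ, f = fun x => ∑ i, c i * Ξ.lam1' rev i x := by
  rw [space1, Submodule.mem_span_range_iff_exists_fun]
  refine exists_congr fun c => ?_
  rw [show (∑ i, c i • Ξ.lam1' rev i) = fun x => ∑ i, c i * Ξ.lam1' rev i x from
    funext fun x => by simp, eq_comm]

lemma l2Proj1_eq (rev : Bool) (f : ℝ → ℝ) : Ξ.l2Proj1 rev f = fun t => ∑ j : Fin Ξ.n,
    ((Ξ.mass rev)⁻¹.mulVec fun i : Fin Ξ.n => ∫ x in (0 : ℝ)..1, Ξ.lam1' rev i x * f x) j *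
      Ξ.lam1' rev j t := rfl

lemma l2Proj1_mem (rev : Bool) (f : ℝ → ℝ) : Ξ.l2Proj1 rev f ∈ Ξ.space1 rev :=
  (Ξ.mem_space1_iff rev).2 ⟨_, Ξ.l2Proj1_eq rev f⟩

lemma l2Proj1_of_mem (hp : 1 ≤ p) (rev : Bool) {f : ℝ → ℝ} (hf : f ∈ Ξ.space1 rev) :
    Ξ.l2Proj1 rev f = f := by
  obtain ⟨c, rfl⟩ := (Ξ.mem_space1_iff rev).1 hf
  rw [l2Proj1_eq]
  simp only [integral_lam1'_mul_sum]
  rw [Matrix.mulVec_mulVec, Matrix.nonsing_inv_mul _ (Ξ.isUnit_mass_det hp rev),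
    Matrix.one_mulVec]

lemma l2Proj1_congr (rev : Bool) {f g : ℝ → ℝ}
    (h : ∀ᵐ x ∂volume.restrict (Ioo (0 : ℝ) 1), f x = g x) :
    Ξ.l2Proj1 rev f = Ξ.l2Proj1 rev g := by
  rw [l2Proj1_eq, l2Proj1_eq]
  have : ∀ i : Fin Ξ.n, ∫ x in (0 : ℝ)..1, Ξ.lam1' rev i x * f x =
      ∫ x in (0 : ℝ)..1, Ξ.lam1' rev i x * g x := fun i =>
    intervalIntegral_congr_Ioo (h.mono fun x hx => by rw [hx])
  simp only [this]

lemma l2Proj1_add (rev : Bool) {f g : ℝ → ℝ} (hf : f ∈ bddMeas) (hg : g ∈ bddMeas) :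
    Ξ.l2Proj1 rev (f + g) = Ξ.l2Proj1 rev f + Ξ.l2Proj1 rev g := by
  have : (fun i : Fin Ξ.n => ∫ x in (0 : ℝ)..1, Ξ.lam1' rev i x * (f + g) x) =
      (fun i : Fin Ξ.n => ∫ x in (0 : ℝ)..1, Ξ.lam1' rev i x * f x) +
      fun i : Fin Ξ.n => ∫ x in (0 : ℝ)..1, Ξ.lam1' rev i x * g x := funext fun i => by
    simp only [Pi.add_apply, mul_add]
    exact intervalIntegral.integral_add
      (bddMeas.intervalIntegrable (mul_mem (Ξ.lam1'_mem_bddMeas rev i) hf))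
      (bddMeas.intervalIntegrable (mul_mem (Ξ.lam1'_mem_bddMeas rev i) hg))
  funext t
  rw [l2Proj1_eq, this, Matrix.mulVec_add, Pi.add_apply, l2Proj1_eq, l2Proj1_eq,
    ← Finset.sum_add_distrib]
  exact Finset.sum_congr rfl fun j _ => by rw [Pi.add_apply, add_mul]

lemma l2Proj1_smul (rev : Bool) (c : ℝ) (f : ℝ → ℝ) :
    Ξ.l2Proj1 rev (c • f) = c • Ξ.l2Proj1 rev f := by
  have : (fun i : Fin Ξ.n => ∫ x in (0 : ℝ)..1, Ξ.lam1' rev i x * (c • f) x) =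
      c • fun i : Fin Ξ.n => ∫ x in (0 : ℝ)..1, Ξ.lam1' rev i x * f x := funext fun i => by
    rw [Pi.smul_apply, smul_eq_mul, ← intervalIntegral.integral_const_mul]
    exact intervalIntegral.integral_congr fun x _ => by simp; ring
  funext t
  rw [l2Proj1_eq, this, Matrix.mulVec_smul, Pi.smul_apply, l2Proj1_eq, smul_eq_mul,
    Finset.mul_sum]
  exact Finset.sum_congr rfl fun j _ => by rw [Pi.smul_apply, smul_eq_mul, mul_assoc]

lemma integral_mul_l2Proj1 (hp : 1 ≤ p) (rev : Bool) {f g : ℝ → ℝ} (hf : f ∈ bddMeas)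
    (hg : g ∈ Ξ.space1 rev) :
    ∫ x in (0 : ℝ)..1, g x * Ξ.l2Proj1 rev f x = ∫ x in (0 : ℝ)..1, g x * f x := by
  obtain ⟨c, rfl⟩ := (Ξ.mem_space1_iff rev).1 hg
  have key : ∀ h ∈ bddMeas, ∫ x in (0 : ℝ)..1, (∑ i, c i * Ξ.lam1' rev i x) * h x =
      ∑ i, c i * ∫ x in (0 : ℝ)..1, Ξ.lam1' rev i x * h x := fun h hh => by
    simp only [Finset.sum_mul, mul_assoc]
    rw [intervalIntegral.integral_finsetSum]
    · simp only [intervalIntegral.integral_const_mul]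
    · exact fun i _ => (bddMeas.intervalIntegrable
        (mul_mem (Ξ.lam1'_mem_bddMeas rev i) hh)).const_mul _
  rw [key f hf, key _ (Ξ.space1_le_bddMeas rev (Ξ.l2Proj1_mem rev f)), l2Proj1_eq]
  refine Finset.sum_congr rfl fun i _ => ?_
  rw [integral_lam1'_mul_sum, Matrix.mulVec_mulVec,
    Matrix.mul_nonsing_inv _ (Ξ.isUnit_mass_det hp rev), Matrix.one_mulVec]

end KnotVector

section Polynomial

open Polynomial

lemma eval_eq_sum_of_mem_degreeLT {r : ℕ} {q : ℝ[X]} (hq : q ∈ degreeLT ℝ r) (x : ℝ) :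
    q.eval x = ∑ j ∈ Finset.range r, q.coeff j * x ^ j := by
  by_cases hq0 : q = 0
  · simp [hq0]
  · exact eval_eq_sum_range' ((natDegree_lt_iff_degree_lt hq0).2 (mem_degreeLT.1 hq)) x

lemma comp_one_sub_mem_degreeLT {r : ℕ} {q : ℝ[X]} (hq : q ∈ degreeLT ℝ r) :
    q.comp (1 - X) ∈ degreeLT ℝ r := by
  by_cases hq0 : q.comp (1 - X) = 0
  · rw [hq0]; exact Submodule.zero_mem _
  · have hq1 : q ≠ 0 := fun h => hq0 (by simp [h])
    rw [mem_degreeLT, ← natDegree_lt_iff_degree_lt hq0]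
    refine lt_of_le_of_lt ?_ ((natDegree_lt_iff_degree_lt hq1).2 (mem_degreeLT.1 hq))
    refine natDegree_comp_le.trans ?_
    have : (1 - X : ℝ[X]).natDegree ≤ 1 := (natDegree_sub_le _ _).trans (by simp)
    exact (Nat.mul_le_mul_left _ this).trans (by simp)

end Polynomial

namespace KnotVector

variable {p : ℕ} (Ξ : KnotVector p)

/-! ### Polynomials and splines -/

open Polynomial in
/-- A polynomial of degree `< r` which is orthogonal to `λ_1, …, λ_r` vanishes. -/
lemma eq_zero_of_integral_lam0'_mul (rev : Bool) {r : ℕ} (hr : r ≤ p) {q : ℝ[X]}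
    (hq : q ∈ degreeLT ℝ r)
    (h : ∀ m < r, ∫ x in (0 : ℝ)..1, Ξ.lam0' rev (m + 1) x * q.eval x = 0) : q = 0 := by
  have h3 := Ξ.three_cells
  -- the case of consecutive B-splines in the original numbering
  have key : ∀ a, 1 ≤ a → a + r ≤ Ξ.n → ∀ q : ℝ[X], q ∈ degreeLT ℝ r →
      (∀ m < r, ∫ x in (0 : ℝ)..1, Ξ.lam0 (a + m) x * q.eval x = 0) → q = 0 := by
    intro a ha1 har q hq h
    have hdeg : q.degree < r := mem_degreeLT.1 hq
    have hev := eval_eq_sum_of_mem_degreeLT hq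
    ext j
    rw [coeff_zero]
    rcases lt_or_ge j r with hj | hj
    · refine eq_zero_of_integral_bspline_mul Ξ.knot_mono Ξ.knot_mem_Icc (q := p) (a := a) (r := r)
        (fun m hm => Ξ.knot_lt_add (q := p + 1) (by omega) (by omega) (by omega))
        q.coeff (fun m hm => ?_) j hj
      refine Eq.trans ?_ (h m hm)
      simp only [hev, Finset.mul_sum]
      rw [intervalIntegral.integral_finsetSum]
      · refine Finset.sum_congr rfl fun l _ => ?_
        rw [Ξ.lam0_eq (by omega), ← intervalIntegral.integral_const_mul]
        exact intervalIntegral.integral_congr fun x _ => by ring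
      · exact fun l _ => bddMeas.intervalIntegrable
          (mul_mem (Ξ.lam0_mem_bddMeas _) (bddMeas.of_continuous (by fun_prop)))
    · exact coeff_eq_zero_of_degree_lt (hdeg.trans_le (by exact_mod_cast hj))
  cases rev
  · refine key 1 le_rfl (by omega) q hq fun m hm => ?_
    refine Eq.trans ?_ (h m hm)
    simp [lam0'_apply, flipIf, idx0, add_comm]
  · have hcomp : q.comp (1 - X) = 0 := by
      refine key (Ξ.n - r) (by omega) (by omega) _ ?_ fun m hm => ?_
      · exact comp_one_sub_mem_degreeLT hq
      · refine Eq.trans ?_ (h (r - 1 - m) (by omega))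
        rw [← integral_flipIf true fun x => Ξ.lam0' true _ x * q.eval x]
        refine intervalIntegral.integral_congr fun x _ => ?_
        simp only [lam0'_apply, flipIf, idx0, if_true, eval_comp, eval_sub, eval_one, eval_X]
        rw [show Ξ.n - (r - 1 - m + 1) = Ξ.n - r + m by omega]
        simp
    have : (q.comp (1 - X)).comp (1 - X) = q := by
      rw [comp_assoc]; simp
    rw [← this, hcomp, zero_comp]

/-- The defining property of the correction coefficients. -/
lemma gamma_spec (rev : Bool) {r : ℕ} (hr : r ≤ p) {j : ℕ} (hj : j < r) :
    ∑ m : Fin r, Ξ.gamma rev r m * ∫ x in (0 : ℝ)..1, Ξ.lam0' rev (m + 1) x * x ^ j =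
      ∫ x in (0 : ℝ)..1, Ξ.lam0' rev 0 x * x ^ j := by
  set G := Matrix.of fun j m : Fin r =>
      ∫ x in (0 : ℝ)..1, Ξ.lam0' rev (m + 1) x * x ^ (j : ℕ) with hG
  have hdet : IsUnit G.det := by
    rw [isUnit_iff_ne_zero]
    intro h
    obtain ⟨c, hc, hc0⟩ := Matrix.exists_vecMul_eq_zero_iff.2 h
    refine hc ?_
    have hq := Ξ.eq_zero_of_integral_lam0'_mul rev hr
      (q := ∑ j : Fin r, Polynomial.C (c j) * Polynomial.X ^ (j : ℕ)) ?_ fun m hm => ?_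
    · funext i
      have h1 := congrArg (fun q => Polynomial.coeff q i) hq
      simpa [Polynomial.finsetSum_coeff, Polynomial.coeff_X_pow, Fin.val_inj] using h1
    · refine Submodule.sum_mem _ fun j _ => Polynomial.mem_degreeLT.2 ?_
      exact (Polynomial.degree_C_mul_X_pow_le _ _).trans_lt (by exact_mod_cast j.2)
    · have h1 := congrFun hc0 ⟨m, hm⟩
      simp only [Matrix.vecMul, dotProduct, hG, Matrix.of_apply, Pi.zero_apply] at h1
      refine Eq.trans ?_ h1
      simp only [Polynomial.eval_finsetSum, Polynomial.eval_mul, Polynomial.eval_C,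
        Polynomial.eval_pow, Polynomial.eval_X, Finset.mul_sum]
      rw [intervalIntegral.integral_finsetSum]
      · refine Finset.sum_congr rfl fun l _ => ?_
        rw [← intervalIntegral.integral_const_mul]
        exact intervalIntegral.integral_congr fun x _ => by ring
      · exact fun l _ => bddMeas.intervalIntegrable
          (mul_mem (Ξ.lam0'_mem_bddMeas _ _) (bddMeas.of_continuous (by fun_prop)))
  have h1 : G.mulVec (Ξ.gamma rev r) =
      fun j : Fin r => ∫ x in (0 : ℝ)..1, Ξ.lam0' rev 0 x * x ^ (j : ℕ) := by
    change G.mulVec (G⁻¹.mulVec _) = _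
    rw [Matrix.mulVec_mulVec, Matrix.mul_nonsing_inv _ hdet, Matrix.one_mulVec]
  have h2 := congrFun h1 ⟨j, hj⟩
  simp only [Matrix.mulVec, dotProduct, hG, Matrix.of_apply] at h2
  rw [← h2]
  exact Finset.sum_congr rfl fun m _ => mul_comm _ _

lemma comp_flipIf_mem_space1 (rev : Bool) {f : ℝ → ℝ} (hf : f ∈ Ξ.space1 false) :
    (fun x => f (flipIf rev x)) ∈ Ξ.space1 rev := by
  obtain ⟨c, rfl⟩ := (Ξ.mem_space1_iff false).1 hf
  have : (fun x => ∑ i : Fin Ξ.n, c i * Ξ.lam1' false i (flipIf rev x)) =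
      ∑ i : Fin Ξ.n, c i • Ξ.lam1' rev (Ξ.idx1 rev i) := by
    funext x
    rw [Finset.sum_apply]
    refine Finset.sum_congr rfl fun i _ => ?_
    rw [Pi.smul_apply, lam1'_apply, lam1'_apply, Ξ.idx1_idx1 i.2]
    simp [idx1, flipIf]
  rw [this]
  exact Submodule.sum_mem _ fun i _ => Submodule.smul_mem _ _
    (Ξ.lam1'_mem_space1 rev (Ξ.idx1_lt i.2))

lemma lam1'_false (i : ℕ) : Ξ.lam1' false i = Ξ.lam1 i := by
  funext x
  simp [lam1']

open Polynomial in
/-- The space `𝕍¹` contains the polynomials of degree `< p`. -/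
lemma exists_mem_space1_eq_eval (hp : 1 ≤ p) (rev : Bool) {q : ℝ[X]} (hq : q ∈ degreeLT ℝ p) :
    ∃ g ∈ Ξ.space1 rev, ∀ x ∈ Ioo (0 : ℝ) 1, g x = q.eval x := by
  have hmon : ∀ j < p, ∃ g ∈ Ξ.space1 false, ∀ x ∈ Ioo (0 : ℝ) 1, g x = x ^ j := by
    intro j hj
    -- compare the coefficients of `X ^ (p - 1 - j)` in Marsden's identity
    refine ⟨fun x => ∑ i : Fin Ξ.n, ((-1) ^ j * ((p - 1).choose (p - 1 - j) : ℝ)⁻¹ *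
      (∏ m ∈ Finset.range (p - 1), (X - C (Ξ.knot (1 + i + m + 1)))).coeff (p - 1 - j)) *
        Ξ.lam1' false i x, (Ξ.mem_space1_iff false).2 ⟨_, rfl⟩, fun x hx => ?_⟩
    have hM := marsden Ξ.knot_mono (p - 1) 1 (Ξ.n + 1) (x := x)
      (by rw [Ξ.knot_eq_zero (by omega)]; exact hx.1.le)
      (by rw [Ξ.knot_eq_one le_rfl]; exact hx.2) hx.2
    rw [Finset.sum_Ico_eq_sum_range, Finset.sum_range] at hM
    have h1 := congrArg (fun q => coeff q (p - 1 - j)) hM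
    simp only [finsetSum_coeff, coeff_C_mul, sub_eq_add_neg X (C x), ← C_neg,
      coeff_X_add_C_pow] at h1
    rw [show p - 1 - (p - 1 - j) = j by omega, neg_pow] at h1
    have h2 : ((p - 1).choose (p - 1 - j) : ℝ) ≠ 0 := by
      exact_mod_cast (Nat.choose_pos (by omega)).ne'
    have h3 : ((-1 : ℝ) ^ j) * (-1) ^ j = 1 := by rw [← mul_pow]; simp
    calc _ = (-1) ^ j * ((p - 1).choose (p - 1 - j) : ℝ)⁻¹ *
          ∑ i : Fin Ξ.n, bspline Ξ.knot (p - 1) (1 + i) x *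
            (∏ m ∈ Finset.range (p - 1), (X - C (Ξ.knot (1 + i + m + 1)))).coeff (p - 1 - j) := by
          rw [Finset.mul_sum]
          refine Finset.sum_congr rfl fun i _ => ?_
          rw [lam1'_false, Ξ.lam1_eq hp i.2, add_comm (i : ℕ) 1]
          ring
      _ = ((-1) ^ j * (-1) ^ j) * x ^ j := by
          refine (congrArg (fun z => (-1) ^ j * ((p - 1).choose (p - 1 - j) : ℝ)⁻¹ * z) h1).trans ?_
          field_simp
      _ = x ^ j := by rw [h3, one_mul]
  have hfalse : ∀ q : ℝ[X], q ∈ degreeLT ℝ p →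
      ∃ g ∈ Ξ.space1 false, ∀ x ∈ Ioo (0 : ℝ) 1, g x = q.eval x := by
    intro q hq
    choose! g hg hgx using hmon
    refine ⟨∑ j ∈ Finset.range p, q.coeff j • g j, Submodule.sum_mem _ fun j hj =>
      Submodule.smul_mem _ _ (hg j (Finset.mem_range.1 hj)), fun x hx => ?_⟩
    rw [eval_eq_sum_of_mem_degreeLT hq, Finset.sum_apply]
    refine Finset.sum_congr rfl fun j hj => ?_
    rw [Pi.smul_apply, hgx j (Finset.mem_range.1 hj) x hx, smul_eq_mul]
  cases rev
  · exact hfalse q hq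
  · obtain ⟨g, hg, hgx⟩ := hfalse _ (comp_one_sub_mem_degreeLT hq)
    refine ⟨_, Ξ.comp_flipIf_mem_space1 true hg, fun x hx => ?_⟩
    rw [hgx _ ((flipIf_mem_Ioo true).2 hx)]
    simp [flipIf]

/-! ### Derivatives of splines -/

/-- The possible points of non-differentiability of the splines. -/
def breakpoints : Set ℝ := insert 1 (range Ξ.knot)

lemma countable_breakpoints : Ξ.breakpoints.Countable := (countable_range _).insert 1

lemma ae_flipIf_notMem_breakpoints (rev : Bool) : ∀ᵐ x : ℝ, flipIf rev x ∉ Ξ.breakpoints := by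
  have : (flipIf rev ⁻¹' Ξ.breakpoints).Countable :=
    Ξ.countable_breakpoints.preimage (Function.Involutive.injective (flipIf_flipIf rev))
  exact this.ae_notMem volume

/-- The B-spline of degree `p - 1`, divided by the length of its support. -/
noncomputable def normB (i : ℕ) (x : ℝ) : ℝ :=
  bspline Ξ.knot (p - 1) i x / (Ξ.knot (i + p) - Ξ.knot i)

lemma normB_zero : Ξ.normB 0 = 0 := by
  funext x
  simp [normB, Ξ.knot_eq_zero (i := p) le_rfl, Ξ.knot_eq_zero (Nat.zero_le p)]

lemma normB_last : Ξ.normB (Ξ.n + 1) = 0 := by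
  funext x
  simp [normB, Ξ.knot_eq_one le_rfl, Ξ.knot_eq_one (i := Ξ.n + 1 + p) (by omega)]

lemma normB_succ (hp : 1 ≤ p) {i : ℕ} (hi : i < Ξ.n) :
    Ξ.normB (i + 1) = (Ξ.knot (i + 1 + p) - Ξ.knot (i + 1))⁻¹ • Ξ.lam1 i := by
  funext x
  rw [Pi.smul_apply, Ξ.lam1_eq hp hi, smul_eq_mul, normB, div_eq_inv_mul]

lemma normB_mem (hp : 1 ≤ p) {i : ℕ} (hi : i ≤ Ξ.n + 1) : Ξ.normB i ∈ Ξ.space1 false := by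
  rcases i with _ | i
  · rw [normB_zero]; exact Submodule.zero_mem _
  · rcases (show i ≤ Ξ.n by omega).eq_or_lt with rfl | h
    · rw [normB_last]; exact Submodule.zero_mem _
    · rw [Ξ.normB_succ hp h, ← lam1'_false]
      exact Submodule.smul_mem _ _ (Ξ.lam1'_mem_space1 false h)

lemma hasDerivAt_lam0 (hp : 1 ≤ p) {i : ℕ} (hi : i ≤ Ξ.n) {x : ℝ} (hx : x ∉ Ξ.breakpoints) :
    HasDerivAt (Ξ.lam0 i) (p * (Ξ.normB i x - Ξ.normB (i + 1) x)) x := by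
  have h1 : ∀ m, x ≠ Ξ.knot m := fun m h => hx (Or.inr ⟨m, h.symm⟩)
  have h2 : x ≠ 1 := fun h => hx (Or.inl h)
  obtain ⟨q, rfl⟩ : ∃ q, p = q + 1 := ⟨p - 1, by omega⟩
  rw [Ξ.lam0_eq hi]
  refine (hasDerivAt_bspline Ξ.knot_mono q i h1 h2).congr_deriv ?_
  simp only [normB, Nat.add_sub_cancel]
  rw [show i + 1 + (q + 1) = i + q + 2 by ring, show i + (q + 1) = i + q + 1 by ring]
  push_cast
  ring

/-- The basis functions of `𝕍¹` are derivatives of splines in `𝕍⁰`: the sums of consecutive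
derivatives `λ_j'` telescope. -/
lemma hasDerivAt_sum_lam0 (hp : 1 ≤ p) {i : ℕ} (hi : i < Ξ.n) {x : ℝ} (hx : x ∉ Ξ.breakpoints) :
    HasDerivAt ((-(Ξ.knot (i + 1 + p) - Ξ.knot (i + 1)) / p) •
      fun y => ∑ j ∈ Finset.range (i + 1), Ξ.lam0 j y) (Ξ.lam1 i x) x := by
  have h0 : ∀ j ∈ Finset.range (i + 1),
      HasDerivAt (Ξ.lam0 j) (p * (Ξ.normB j x - Ξ.normB (j + 1) x)) x := fun j hj =>
    Ξ.hasDerivAt_lam0 hp (by have := Finset.mem_range.1 hj; omega) hx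
  have h1 := (HasDerivAt.fun_sum h0).const_smul
      (-(Ξ.knot (i + 1 + p) - Ξ.knot (i + 1)) / (p : ℝ))
  refine h1.congr_deriv ?_
  rw [← Finset.mul_sum, Finset.sum_range_sub', normB_zero, Ξ.normB_succ hp hi]
  have h2 : Ξ.knot (i + 1 + p) - Ξ.knot (i + 1) ≠ 0 :=
    sub_ne_zero.2 (Ξ.knot_lt_add (by omega) (by omega) hp).ne'
  have h3 : (p : ℝ) ≠ 0 := by exact_mod_cast (show p ≠ 0 by omega)
  simp only [Pi.zero_apply, Pi.smul_apply, smul_eq_mul]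
  field_simp
  ring

lemma exists_deriv_mem_space1 (hp : 1 ≤ p) (rev : Bool) {h : ℝ → ℝ} (hh : h ∈ Ξ.space0 rev) :
    ∃ g ∈ Ξ.space1 rev, ∀ᵐ x : ℝ, HasDerivAt h (g x) x := by
  induction hh using Submodule.span_induction with
  | mem f hf =>
    obtain ⟨i, rfl⟩ := hf
    have hi : Ξ.idx0 rev i ≤ Ξ.n := Ξ.idx0_le (by omega)
    have hg : ((p : ℝ) • (Ξ.normB (Ξ.idx0 rev i) - Ξ.normB (Ξ.idx0 rev i + 1))) ∈
        Ξ.space1 false :=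
      Submodule.smul_mem _ _ (Submodule.sub_mem _ (Ξ.normB_mem hp (by omega))
        (Ξ.normB_mem hp (by omega)))
    refine ⟨_, Submodule.smul_mem _ (if rev then -1 else 1 : ℝ)
      (Ξ.comp_flipIf_mem_space1 rev hg), ?_⟩
    filter_upwards [Ξ.ae_flipIf_notMem_breakpoints rev] with x hx
    have := (Ξ.hasDerivAt_lam0 hp hi hx).comp x (hasDerivAt_flipIf rev x)
    rw [show Ξ.lam0' rev i = Ξ.lam0 (Ξ.idx0 rev i) ∘ flipIf rev from
      funext fun t => Ξ.lam0'_apply rev i t]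
    refine this.congr_deriv ?_
    simp only [Pi.smul_apply, Pi.sub_apply, smul_eq_mul]
    ring
  | zero => exact ⟨0, Submodule.zero_mem _, Filter.Eventually.of_forall fun x =>
      hasDerivAt_const x (0 : ℝ)⟩
  | add f f' _ _ ih ih' =>
    obtain ⟨g, hg, h1⟩ := ih
    obtain ⟨g', hg', h2⟩ := ih'
    refine ⟨g + g', Submodule.add_mem _ hg hg', ?_⟩
    filter_upwards [h1, h2] with x hx hx' using hx.add hx'
  | smul c f _ ih =>
    obtain ⟨g, hg, h1⟩ := ih
    refine ⟨c • g, Submodule.smul_mem _ c hg, ?_⟩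
    filter_upwards [h1] with x hx using hx.const_smul c

lemma exists_antideriv_mem_space0 (hp : 1 ≤ p) (rev : Bool) {f : ℝ → ℝ} (hf : f ∈ Ξ.space1 rev) :
    ∃ h ∈ Ξ.space0 rev, ∀ᵐ x : ℝ, HasDerivAt h (f x) x := by
  induction hf using Submodule.span_induction with
  | mem f hf =>
    obtain ⟨i, rfl⟩ := hf
    have hi : Ξ.idx1 rev i < Ξ.n := Ξ.idx1_lt i.2
    set c := -(Ξ.knot (Ξ.idx1 rev i + 1 + p) - Ξ.knot (Ξ.idx1 rev i + 1)) / p with hc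
    refine ⟨(if rev then -1 else 1 : ℝ) • c •
      ∑ j ∈ Finset.range (Ξ.idx1 rev i + 1), Ξ.lam0' rev (Ξ.idx0 rev j), ?_, ?_⟩
    · refine Submodule.smul_mem _ _ (Submodule.smul_mem _ _ (Submodule.sum_mem _ fun j hj => ?_))
      exact Ξ.lam0'_mem_space0 rev (Ξ.idx0_le (by have := Finset.mem_range.1 hj; omega))
    · filter_upwards [Ξ.ae_flipIf_notMem_breakpoints rev] with x hx
      have := ((Ξ.hasDerivAt_sum_lam0 hp hi hx).comp x (hasDerivAt_flipIf rev x)).const_smul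
        (if rev then -1 else 1 : ℝ)
      rw [show c • ∑ j ∈ Finset.range (Ξ.idx1 rev i + 1), Ξ.lam0' rev (Ξ.idx0 rev j) =
        (c • fun y => ∑ j ∈ Finset.range (Ξ.idx1 rev i + 1), Ξ.lam0 j y) ∘ flipIf rev from ?_]
      · refine this.congr_deriv ?_
        rw [lam1'_apply]
        cases rev <;> simp
      · funext y
        simp only [Pi.smul_apply, Function.comp_apply, Finset.sum_apply]
        congr 1
        refine Finset.sum_congr rfl fun j hj => ?_
        rw [lam0'_apply, Ξ.idx0_idx0 (by have := Finset.mem_range.1 hj; omega)]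
  | zero => exact ⟨0, Submodule.zero_mem _, Filter.Eventually.of_forall fun x =>
      hasDerivAt_const x (0 : ℝ)⟩
  | add f f' _ _ ih ih' =>
    obtain ⟨g, hg, h1⟩ := ih
    obtain ⟨g', hg', h2⟩ := ih'
    refine ⟨g + g', Submodule.add_mem _ hg hg', ?_⟩
    filter_upwards [h1, h2] with x hx hx' using hx.add hx'
  | smul c f _ ih =>
    obtain ⟨g, hg, h1⟩ := ih
    refine ⟨c • g, Submodule.smul_mem _ c hg, ?_⟩
    filter_upwards [h1] with x hx using hx.const_smul c

/-- Nestedness of the spaces `𝕍⁰` implies that of the spaces `𝕍¹` of derivatives, modulo null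
functions. -/
lemma exists_ae_eq_mem_space1 (hp : 1 ≤ p) {Ξ' : KnotVector p} {rev rev' : Bool}
    (hle : Ξ.space0 rev ≤ Ξ'.space0 rev') {f : ℝ → ℝ} (hf : f ∈ Ξ.space1 rev) :
    ∃ g ∈ Ξ'.space1 rev', ∀ᵐ x : ℝ, f x = g x := by
  obtain ⟨h, hh, h1⟩ := Ξ.exists_antideriv_mem_space0 hp rev hf
  obtain ⟨g, hg, h2⟩ := Ξ'.exists_deriv_mem_space1 hp rev' (hle hh)
  refine ⟨g, hg, ?_⟩
  filter_upwards [h1, h2] with x hx hx' using hx.unique hx'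

/-- The derivative of `λ_i`, as it is used for integration by parts. -/
lemma exists_deriv_lam0 (hp : 1 ≤ p) {i : ℕ} (hi : i ≤ Ξ.n) : ∃ g ∈ bddMeas,
    ∀ x ∉ Ξ.breakpoints, HasDerivAt (Ξ.lam0 i) (g x) x := by
  refine ⟨(p : ℝ) • (Ξ.normB i - Ξ.normB (i + 1)), Ξ.space1_le_bddMeas false ?_,
    fun x hx => Ξ.hasDerivAt_lam0 hp hi hx⟩
  exact Submodule.smul_mem _ _ (Submodule.sub_mem _ (Ξ.normB_mem hp (by omega))
        (Ξ.normB_mem hp (by omega)))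

end KnotVector

/-! ### The reference square -/

lemma unitVec_apply (d i : Fin 2) : unitVec d i = if i = d then 1 else 0 := by
  simp [unitVec]

lemma isOpen_openSquare : IsOpen openSquare := by
  rw [show openSquare = ⋂ i, (fun x : Plane => x i) ⁻¹' Ioo 0 1 by ext; simp [openSquare]]
  exact isOpen_iInter_of_finite fun i => isOpen_Ioo.preimage (by fun_prop)

lemma isClosed_closedSquare : IsClosed closedSquare := by
  rw [show closedSquare = ⋂ i, (fun x : Plane => x i) ⁻¹' Icc 0 1 by ext; simp [closedSquare]]
  exact isClosed_iInter fun i => isClosed_Icc.preimage (by fun_prop)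

lemma openSquare_subset : openSquare ⊆ closedSquare := fun _ hx i => Ioo_subset_Icc_self (hx i)

lemma convex_closedSquare : Convex ℝ closedSquare := by
  intro x hx y hy a b ha hb hab i
  exact (convex_Icc (0 : ℝ) 1) (hx i) (hy i) ha hb hab

lemma isCompact_closedSquare : IsCompact closedSquare := by
  refine Metric.isCompact_of_isClosed_isBounded isClosed_closedSquare ?_
  refine (Metric.isBounded_closedBall (x := (0 : Plane)) (r := 2)).subset fun x hx => ?_
  rw [mem_closedBall_zero_iff, EuclideanSpace.norm_eq, Real.sqrt_le_left (by norm_num)]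
  have h0 := hx 0
  have h1 := hx 1
  simp only [Real.norm_eq_abs, sq_abs, Fin.sum_univ_two]
  nlinarith [h0.1, h0.2, h1.1, h1.2]

lemma mem_openSquare_iff {x : Plane} : x ∈ openSquare ↔ x 0 ∈ Ioo (0 : ℝ) 1 ∧ x 1 ∈ Ioo (0 : ℝ) 1 :=
  Fin.forall_fin_two

lemma mem_closedSquare_iff {x : Plane} :
    x ∈ closedSquare ↔ x 0 ∈ Icc (0 : ℝ) 1 ∧ x 1 ∈ Icc (0 : ℝ) 1 :=
  Fin.forall_fin_two

lemma norm_coord_le (x : Plane) (i : Fin 2) : |x i| ≤ ‖x‖ := PiLp.norm_apply_le x i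

/-- Points of the closed square can be pushed into its interior. -/
lemma lineMap_mem_openSquare {x c : Plane} (hx : x ∈ closedSquare) (hc : c ∈ openSquare) {θ : ℝ}
    (h0 : 0 < θ) (h1 : θ ≤ 1) : x + θ • (c - x) ∈ openSquare := by
  intro i
  have h2 := hx i
  have h3 := hc i
  simp only [PiLp.add_apply, PiLp.smul_apply, PiLp.sub_apply, smul_eq_mul, mem_Ioo, mem_Icc] at *
  constructor <;> nlinarith

/-- The center of the square. -/
noncomputable def squareCenter : Plane := !₂[1 / 2, 1 / 2]

lemma squareCenter_mem : squareCenter ∈ openSquare := by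
  rw [mem_openSquare_iff]
  simp [squareCenter]
  norm_num

lemma closure_openSquare : closure openSquare = closedSquare := by
  refine (closure_minimal openSquare_subset isClosed_closedSquare).antisymm fun x hx => ?_
  rw [mem_closure_iff_seq_limit]
  refine ⟨fun n : ℕ => x + (1 / ((n : ℝ) + 1)) • (squareCenter - x), fun n =>
    lineMap_mem_openSquare hx squareCenter_mem (by positivity) ?_, ?_⟩
  · rw [div_le_one (by positivity)]; linarith [Nat.cast_nonneg (α := ℝ) n]
  · have := (tendsto_one_div_add_atTop_nhds_zero_nat (𝕜 := ℝ)).smul_const (squareCenter - x)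
    simpa using this.const_add x

lemma interior_closedSquare : interior closedSquare = openSquare := by
  refine Subset.antisymm (fun x hx => ?_)
    (interior_maximal openSquare_subset isOpen_openSquare)
  obtain ⟨ε, hε, hb⟩ := Metric.mem_nhds_iff.1 (mem_interior_iff_mem_nhds.1 hx)
  intro i
  have h : ∀ c : ℝ, |c| < ε → x i + c ∈ Icc (0 : ℝ) 1 := fun c hc => by
    have h1 : x + c • unitVec i ∈ closedSquare := hb (by
      rw [mem_ball_iff_norm, add_sub_cancel_left, norm_smul]
      simpa [unitVec] using hc)
    simpa [unitVec] using h1 i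
  have h1 := h (ε / 2) (by rw [abs_of_pos] <;> linarith)
  have h2 := h (-(ε / 2)) (by rw [abs_neg, abs_of_pos] <;> linarith)
  constructor <;> linarith [h1.1, h1.2, h2.1, h2.2]

lemma uniqueDiffOn_closedSquare : UniqueDiffOn ℝ closedSquare :=
  uniqueDiffOn_convex convex_closedSquare
    (by rw [interior_closedSquare]; exact ⟨_, squareCenter_mem⟩)

lemma closedSquare_mem_nhds {x : Plane} (hx : x ∈ openSquare) : closedSquare ∈ nhds x :=
  mem_interior_iff_mem_nhds.1 (by rwa [interior_closedSquare])

/-- The determinant of an endomorphism of the plane in coordinates. -/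
lemma det_plane (A : Plane →L[ℝ] Plane) :
    A.det = A (unitVec 0) 0 * A (unitVec 1) 1 - A (unitVec 1) 0 * A (unitVec 0) 1 := by
  rw [ContinuousLinearMap.det,
    ← LinearMap.det_toMatrix (EuclideanSpace.basisFun (Fin 2) ℝ).toBasis, Matrix.det_fin_two]
  simp [LinearMap.toMatrix_apply, unitVec]

lemma plane_eq (x : Plane) : x = x 0 • unitVec 0 + x 1 • unitVec 1 := by
  ext i
  fin_cases i <;> simp [unitVec]

/-! ### Local geometry of `C¹` parametrizations -/

/-- A `C¹` diffeomorphism of the closed reference square onto its image. -/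
structure IsChart (G : Plane → Plane) : Prop where
  contDiffOn : ContDiffOn ℝ 1 G closedSquare
  injOn : InjOn G closedSquare
  det_ne_zero : ∀ x ∈ closedSquare, (fderivWithin ℝ G closedSquare x).det ≠ 0

namespace IsChart

variable {G : Plane → Plane} (hG : IsChart G)
include hG

lemma continuousOn : ContinuousOn G closedSquare := hG.contDiffOn.continuousOn

lemma hasFDerivWithinAt {x : Plane} (hx : x ∈ closedSquare) :
    HasFDerivWithinAt G (fderivWithin ℝ G closedSquare x) closedSquare x :=
  (hG.contDiffOn.differentiableOn (by simp) x hx).hasFDerivWithinAt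

lemma hasFDerivAt {x : Plane} (hx : x ∈ openSquare) :
    HasFDerivAt G (fderivWithin ℝ G closedSquare x) x :=
  (hG.hasFDerivWithinAt (openSquare_subset hx)).hasFDerivAt (closedSquare_mem_nhds hx)

lemma fderiv_eq {x : Plane} (hx : x ∈ openSquare) :
    fderiv ℝ G x = fderivWithin ℝ G closedSquare x := (hG.hasFDerivAt hx).fderiv

lemma continuousOn_fderivWithin : ContinuousOn (fderivWithin ℝ G closedSquare) closedSquare :=
  hG.contDiffOn.continuousOn_fderivWithin uniqueDiffOn_closedSquare (by simp)

lemma approximates {x₀ : Plane} (hx₀ : x₀ ∈ closedSquare) {c : NNReal} (hc : 0 < c) :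
    ∃ δ > 0, ApproximatesLinearOn G (fderivWithin ℝ G closedSquare x₀)
      (closedSquare ∩ Metric.ball x₀ δ) c := by
  obtain ⟨δ, hδ, h⟩ := Metric.continuousOn_iff.1 hG.continuousOn_fderivWithin x₀ hx₀ c
    (by exact_mod_cast hc)
  refine ⟨δ, hδ, fun x hx y hy => ?_⟩
  refine Convex.norm_image_sub_le_of_norm_hasFDerivWithin_le'
    (f' := fderivWithin ℝ G closedSquare) (s := closedSquare ∩ Metric.ball x₀ δ)
    (fun z hz => (hG.hasFDerivWithinAt hz.1).mono inter_subset_left) (fun z hz => ?_)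
    (convex_closedSquare.inter (convex_ball x₀ δ)) hy hx
  rw [← dist_eq_norm]
  exact (h z hz.1 hz.2).le

/-- The derivative of a chart as a linear equivalence. -/
lemma exists_equiv {x : Plane} (hx : x ∈ closedSquare) :
    ∃ D : Plane ≃L[ℝ] Plane, (D : Plane →L[ℝ] Plane) = fderivWithin ℝ G closedSquare x :=
  ⟨_, ContinuousLinearMap.coe_toContinuousLinearEquivOfDetNeZero _ (hG.det_ne_zero x hx)⟩

/-- A boundary point of the square is not mapped to an interior point of the image. -/
lemma mem_openSquare_of_image_mem_nhds {x₀ : Plane} (hx₀ : x₀ ∈ closedSquare)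
    (h : G '' closedSquare ∈ nhds (G x₀)) : x₀ ∈ openSquare := by
  obtain ⟨D, hD⟩ := hG.exists_equiv hx₀
  -- near `x₀` the map extends to a homeomorphism of the plane
  set N := ‖(D.symm : Plane →L[ℝ] Plane)‖₊ with hN
  set L := lipschitzExtensionConstant Plane with hL
  have hNpos : 0 < N := D.nnnorm_symm_pos
  obtain ⟨c, hc0, hc⟩ : ∃ c : NNReal, 0 < c ∧ L * c < N⁻¹ := by
    have hN' : 0 < N⁻¹ := inv_pos.2 hNpos
    refine ⟨N⁻¹ / (2 * (L + 1)), by positivity, ?_⟩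
    rw [mul_div_assoc', div_lt_iff₀ (by positivity), mul_comm]
    refine mul_lt_mul_of_pos_left ?_ hN'
    calc L < L + 1 := lt_add_one L
      _ ≤ 2 * (L + 1) := le_mul_of_one_le_left (by positivity) one_le_two
  obtain ⟨δ, hδ, ha⟩ := hG.approximates hx₀ hc0
  rw [← hD] at ha
  obtain ⟨g, hg⟩ := ha.exists_homeomorph_extension (Or.inr hc)
  have hx₀' : x₀ ∈ closedSquare ∩ Metric.ball x₀ δ := ⟨hx₀, Metric.mem_ball_self hδ⟩
  -- by compactness, points near `G x₀` have their preimage near `x₀`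
  have hK : IsCompact (G '' (closedSquare \ Metric.ball x₀ δ)) :=
    (isCompact_closedSquare.diff Metric.isOpen_ball).image_of_continuousOn
      (hG.continuousOn.mono sdiff_subset)
  have hnot : G x₀ ∉ G '' (closedSquare \ Metric.ball x₀ δ) := by
    rintro ⟨x, hx, hxe⟩
    exact hx.2 (hG.injOn hx.1 hx₀ hxe ▸ Metric.mem_ball_self hδ)
  have h1 : g '' closedSquare ∈ nhds (g x₀) := by
    rw [← hg hx₀']
    filter_upwards [h, hK.isClosed.isOpen_compl.mem_nhds hnot] with y hy hy'
    obtain ⟨x, hx, rfl⟩ := hy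
    have hxb : x ∈ Metric.ball x₀ δ := by
      by_contra hb
      exact hy' ⟨x, ⟨hx, hb⟩, rfl⟩
    exact ⟨x, hx, (hg ⟨hx, hxb⟩).symm⟩
  rw [← interior_closedSquare, mem_interior_iff_mem_nhds]
  have := g.continuous.continuousAt.preimage_mem_nhds h1
  rwa [g.injective.preimage_image] at this

/-- If a direction `w` points into the square at `x₀` then `DG(x₀) w` points into the image. -/
lemma eventually_mem_image {x₀ w : Plane} (hx₀ : x₀ ∈ closedSquare) {κ : ℝ} (hκ : 0 < κ)
    (hw : ∀ᶠ s : ℝ in nhdsWithin 0 (Ioi 0), Metric.closedBall (x₀ + s • w) (κ * s) ⊆ openSquare) :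
    ∀ᶠ s : ℝ in nhdsWithin 0 (Ioi 0),
      G x₀ + s • fderivWithin ℝ G closedSquare x₀ w ∈ G '' openSquare := by
  obtain ⟨D, hD⟩ := hG.exists_equiv hx₀
  set N := D.toNonlinearRightInverse.nnnorm with hN
  have hNpos : 0 < N := D.nnnorm_symm_pos
  have hN' : 0 < (N : ℝ)⁻¹ := inv_pos.2 (by exact_mod_cast hNpos)
  obtain ⟨c, hc0, hc⟩ : ∃ c : NNReal, 0 < c ∧ (c : ℝ) * ‖w‖ ≤ ((N : ℝ)⁻¹ - c) * κ := by
    have hd : 0 < ‖w‖ + κ := by positivity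
    obtain ⟨c, hc⟩ : ∃ c : NNReal, (c : ℝ) = (N : ℝ)⁻¹ * κ / (‖w‖ + κ) :=
      ⟨_, Real.coe_toNNReal _ (by positivity)⟩
    refine ⟨c, ?_, ?_⟩
    · rw [← NNReal.coe_pos, hc]
      positivity
    · rw [hc]
      apply le_of_eq
      field_simp
      ring
  obtain ⟨δ, hδ, ha⟩ := hG.approximates hx₀ hc0
  rw [← hD] at ha ⊢
  have hsmall : ∀ᶠ s : ℝ in nhdsWithin 0 (Ioi 0), s * (‖w‖ + κ) < δ := by
    have : Filter.Tendsto (fun s : ℝ => s * (‖w‖ + κ)) (nhdsWithin 0 (Ioi 0)) (nhds 0) := by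
      have h : Continuous fun s : ℝ => s * (‖w‖ + κ) := by fun_prop
      simpa using (h.tendsto 0).mono_left nhdsWithin_le_nhds
    exact this.eventually_lt_const hδ
  filter_upwards [hw, hsmall, self_mem_nhdsWithin] with s hs hsδ hs0
  replace hs0 : 0 < s := hs0
  have hball : Metric.closedBall (x₀ + s • w) (κ * s) ⊆ closedSquare ∩ Metric.ball x₀ δ := by
    refine fun x hx => ⟨openSquare_subset (hs hx), ?_⟩
    rw [mem_closedBall_iff_norm] at hx
    rw [mem_ball_iff_norm]
    calc ‖x - x₀‖ = ‖(x - (x₀ + s • w)) + s • w‖ := by congr 1; abel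
      _ ≤ κ * s + s * ‖w‖ := (norm_add_le _ _).trans (add_le_add hx (by
          rw [norm_smul, Real.norm_of_nonneg hs0.le]))
      _ < δ := by linarith
  have hsurj := ha.surjOn_closedBall_of_nonlinearRightInverse D.toNonlinearRightInverse
    (by positivity) hball
  have hmem : G x₀ + s • D w ∈ Metric.closedBall (G (x₀ + s • w)) (((N : ℝ)⁻¹ - c) * (κ * s)) := by
    rw [mem_closedBall_iff_norm, ← norm_neg]
    have h1 := ha (x₀ + s • w) (hball (Metric.mem_closedBall_self (by positivity))) x₀
      ⟨hx₀, Metric.mem_ball_self hδ⟩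
    rw [add_sub_cancel_left, norm_smul, Real.norm_of_nonneg hs0.le] at h1
    calc _ = ‖G (x₀ + s • w) - G x₀ - (D : Plane →L[ℝ] Plane) (s • w)‖ := by
          congr 1
          simp only [ContinuousLinearEquiv.coe_coe, map_smul]
          abel
      _ ≤ c * (s * ‖w‖) := h1
      _ ≤ _ := by nlinarith
  obtain ⟨x, hx, hxe⟩ := hsurj hmem
  exact ⟨x, hs hx, hxe⟩

end IsChart

/-! ### Two parametrizations which agree on an edge -/

/-- The point with the coordinates `(t, s)`. -/
noncomputable def pt (t s : ℝ) : Plane := !₂[t, s]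

@[simp] lemma pt_zero (t s : ℝ) : pt t s 0 = t := rfl
@[simp] lemma pt_one (t s : ℝ) : pt t s 1 = s := rfl

lemma pt_eq (t s : ℝ) : pt t s = t • unitVec 0 + s • unitVec 1 := by
  rw [plane_eq (pt t s), pt_zero, pt_one]

lemma hasDerivAt_pt (t s : ℝ) : HasDerivAt (fun t => pt t s) (unitVec 0) t := by
  simp only [pt_eq]
  simpa using ((hasDerivAt_id t).smul_const (unitVec 0)).add_const (s • unitVec 1)

lemma pt_mem_closedSquare {t s : ℝ} : pt t s ∈ closedSquare ↔ t ∈ Icc (0 : ℝ) 1 ∧ s ∈ Icc (0 : ℝ) 1 :=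
  mem_closedSquare_iff

section TwoCharts

variable {G₁ G₂ : Plane → Plane} (h₁ : IsChart G₁) (h₂ : IsChart G₂)
  (hG : ∀ t ∈ Icc (0 : ℝ) 1, G₁ (pt t 0) = G₂ (pt t 0)) {t₀ : ℝ} (ht₀ : t₀ ∈ Ioo (0 : ℝ) 1)
include ht₀

lemma edgePoint_mem : pt t₀ 0 ∈ closedSquare := by
  rw [pt_mem_closedSquare]
  exact ⟨Ioo_subset_Icc_self ht₀, by simp⟩

/-- Near a point of the open edge, the square looks like the upper half plane. -/
lemma mem_closedSquare_of_dist_lt {x : Plane} (hx : ‖x - pt t₀ 0‖ < min t₀ (1 - t₀))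
    (hx1 : 0 ≤ x 1) : x ∈ closedSquare := by
  have h0 := (norm_coord_le (x - pt t₀ 0) 0).trans_lt hx
  have h1 := (norm_coord_le (x - pt t₀ 0) 1).trans_lt hx
  simp only [PiLp.sub_apply, pt_zero, pt_one, sub_zero] at h0 h1
  have := min_le_left t₀ (1 - t₀)
  have := min_le_right t₀ (1 - t₀)
  have := ht₀.1
  have := ht₀.2
  rw [abs_lt] at h0 h1
  rw [mem_closedSquare_iff]
  exact ⟨⟨by linarith, by linarith⟩, ⟨hx1, by linarith⟩⟩

lemma eventually_closedBall_subset_openSquare {w : Plane} (hw : 0 < w 1) :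
    ∀ᶠ s : ℝ in nhdsWithin 0 (Ioi 0),
      Metric.closedBall (pt t₀ 0 + s • w) (w 1 / 2 * s) ⊆ openSquare := by
  have hsmall : ∀ᶠ s : ℝ in nhdsWithin 0 (Ioi 0), s * (‖w‖ + w 1 / 2) < min t₀ (1 - t₀) := by
    have : Filter.Tendsto (fun s : ℝ => s * (‖w‖ + w 1 / 2)) (nhdsWithin 0 (Ioi 0)) (nhds 0) := by
      have h : Continuous fun s : ℝ => s * (‖w‖ + w 1 / 2) := by fun_prop
      simpa using (h.tendsto 0).mono_left nhdsWithin_le_nhds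
    exact this.eventually_lt_const (lt_min ht₀.1 (by linarith [ht₀.2]))
  filter_upwards [hsmall, self_mem_nhdsWithin] with s hs hs0 x hx
  replace hs0 : 0 < s := hs0
  rw [mem_closedBall_iff_norm] at hx
  have h1 := (norm_coord_le (x - (pt t₀ 0 + s • w)) 1).trans hx
  have hpos : 0 < x 1 := by
    simp only [PiLp.sub_apply, PiLp.add_apply, PiLp.smul_apply, smul_eq_mul, pt_one,
      zero_add] at h1
    have := neg_abs_le (x 1 - s * w 1)
    nlinarith
  have hd : ‖x - pt t₀ 0‖ < min t₀ (1 - t₀) := by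
    calc ‖x - pt t₀ 0‖ = ‖(x - (pt t₀ 0 + s • w)) + s • w‖ := by congr 1; abel
      _ ≤ w 1 / 2 * s + s * ‖w‖ := (norm_add_le _ _).trans (add_le_add hx (by
          rw [norm_smul, Real.norm_of_nonneg hs0.le]))
      _ < _ := by linarith
  have h0 := (norm_coord_le (x - pt t₀ 0) 0).trans_lt hd
  have h1 := (norm_coord_le (x - pt t₀ 0) 1).trans_lt hd
  simp only [PiLp.sub_apply, pt_zero, pt_one, sub_zero] at h0 h1
  have := min_le_left t₀ (1 - t₀)
  have := min_le_right t₀ (1 - t₀)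
  have := ht₀.1
  have := ht₀.2
  rw [abs_lt] at h0 h1
  rw [mem_openSquare_iff]
  exact ⟨⟨by linarith, by linarith⟩, ⟨hpos, by linarith⟩⟩

include h₁ h₂ hG

lemma fderivWithin_tangent_eq :
    fderivWithin ℝ G₁ closedSquare (pt t₀ 0) (unitVec 0) =
      fderivWithin ℝ G₂ closedSquare (pt t₀ 0) (unitVec 0) := by
  have hmaps : MapsTo (fun t => pt t 0) (Icc 0 1) closedSquare := fun t ht =>
    pt_mem_closedSquare.2 ⟨ht, by simp⟩
  have hn : Icc (0 : ℝ) 1 ∈ nhds t₀ := Icc_mem_nhds ht₀.1 ht₀.2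
  have e₁ := ((h₁.hasFDerivWithinAt (edgePoint_mem ht₀)).comp_hasDerivWithinAt t₀
    (hasDerivAt_pt t₀ 0).hasDerivWithinAt hmaps).hasDerivAt hn
  have e₂ := ((h₂.hasFDerivWithinAt (edgePoint_mem ht₀)).comp_hasDerivWithinAt t₀
    (hasDerivAt_pt t₀ 0).hasDerivWithinAt hmaps).hasDerivAt hn
  refine e₁.unique (e₂.congr_of_eventuallyEq ?_)
  filter_upwards [hn] with t ht using hG t ht

/-- The change of coordinates between the two parametrizations, to first order: it fixes the
edge, and maps the half plane to itself or to its complement according to the orientations. -/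
lemma exists_transition : ∃ S : Plane →L[ℝ] Plane,
    (∀ v, fderivWithin ℝ G₂ closedSquare (pt t₀ 0) (S v) =
      fderivWithin ℝ G₁ closedSquare (pt t₀ 0) v) ∧
    S (unitVec 0) = unitVec 0 ∧
    (fderivWithin ℝ G₁ closedSquare (pt t₀ 0)).det =
      (fderivWithin ℝ G₂ closedSquare (pt t₀ 0)).det * S (unitVec 1) 1 := by
  obtain ⟨D, hD⟩ := h₂.exists_equiv (edgePoint_mem ht₀)
  set A := fderivWithin ℝ G₁ closedSquare (pt t₀ 0) with hA
  have hS0 : (D.symm : Plane →L[ℝ] Plane).comp A (unitVec 0) = unitVec 0 := by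
    rw [ContinuousLinearMap.comp_apply, hA, fderivWithin_tangent_eq h₁ h₂ hG ht₀, ← hD]
    simp
  refine ⟨(D.symm : Plane →L[ℝ] Plane).comp A, fun v => ?_, hS0, ?_⟩
  · rw [← hD]; simp
  · have h : A = (D : Plane →L[ℝ] Plane).comp ((D.symm : Plane →L[ℝ] Plane).comp A) := by
      ext v; simp
    have h' : A.det = (D : Plane →L[ℝ] Plane).det *
        ((D.symm : Plane →L[ℝ] Plane).comp A).det := by
      conv_lhs => rw [h]
      exact LinearMap.det_comp _ _
    rw [h', det_plane ((D.symm : Plane →L[ℝ] Plane).comp A), hS0, ← hD]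
    simp [unitVec]

/-- If the two parametrizations have the same orientation, the patches lie on the same side of
the edge and overlap. -/
lemma image_inter_nonempty (hdet : 0 < (fderivWithin ℝ G₁ closedSquare (pt t₀ 0)).det *
    (fderivWithin ℝ G₂ closedSquare (pt t₀ 0)).det) :
    (G₁ '' openSquare ∩ G₂ '' openSquare).Nonempty := by
  obtain ⟨S, hS, hS0, hSd⟩ := exists_transition h₁ h₂ hG ht₀
  have hpos : 0 < S (unitVec 1) 1 := by
    rw [hSd] at hdet
    by_contra! h
    nlinarith [mul_self_nonneg (fderivWithin ℝ G₂ closedSquare (pt t₀ 0)).det]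
  have hone : (0 : ℝ) < unitVec 1 1 := by simp [unitVec]
  have e₁ := h₁.eventually_mem_image (edgePoint_mem ht₀) (half_pos hone)
    (eventually_closedBall_subset_openSquare ht₀ hone)
  have e₂ := h₂.eventually_mem_image (edgePoint_mem ht₀) (half_pos hpos)
    (eventually_closedBall_subset_openSquare ht₀ hpos)
  obtain ⟨s, hs₁, hs₂⟩ := (e₁.and e₂).exists
  refine ⟨_, hs₁, ?_⟩
  rwa [hS, ← hG t₀ (Ioo_subset_Icc_self ht₀)] at hs₂

/-- If the two parametrizations have opposite orientations, the patches together cover a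
neighbourhood of the points of the open edge: gluing the first one with the second one,
precomposed with the linear transition map, gives a strictly differentiable map. -/
lemma image_union_mem_nhds (hdet : (fderivWithin ℝ G₁ closedSquare (pt t₀ 0)).det *
    (fderivWithin ℝ G₂ closedSquare (pt t₀ 0)).det < 0) :
    G₁ '' closedSquare ∪ G₂ '' closedSquare ∈ nhds (G₁ (pt t₀ 0)) := by
  obtain ⟨S, hS, hS0, hSd⟩ := exists_transition h₁ h₂ hG ht₀
  have hneg : S (unitVec 1) 1 < 0 := by
    rw [hSd] at hdet
    by_contra! h
    nlinarith [mul_self_nonneg (fderivWithin ℝ G₂ closedSquare (pt t₀ 0)).det]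
  have hx₀ := edgePoint_mem ht₀
  set x₀ := pt t₀ 0 with hx₀_def
  obtain ⟨D, hD⟩ := h₁.exists_equiv hx₀
  set N := D.toNonlinearRightInverse.nnnorm with hN
  have hNpos : 0 < N := D.nnnorm_symm_pos
  obtain ⟨c, hc0, hcN⟩ : ∃ c : NNReal, 0 < c ∧ c < N⁻¹ := exists_between (inv_pos.2 hNpos)
  obtain ⟨δ₁, hδ₁, ha₁⟩ := h₁.approximates hx₀ hc0
  obtain ⟨δ₂, hδ₂, ha₂⟩ := h₂.approximates hx₀ (c := c / (‖S‖₊ + 1)) (by positivity)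
  have hcS : (c / (‖S‖₊ + 1) : NNReal) * ‖S‖ ≤ (c : ℝ) := by
    push_cast
    rw [div_mul_eq_mul_div, div_le_iff₀ (by positivity)]
    have : (0 : ℝ) ≤ c := c.2
    nlinarith
  set ρ := min t₀ (1 - t₀) with hρ
  have hρ0 : 0 < ρ := lt_min ht₀.1 (by linarith [ht₀.2])
  set δ := min (min δ₁ ρ) (min δ₂ ρ / (‖S‖ + 1)) with hδ_def
  have hδ : 0 < δ := by positivity
  have hS1 : ∀ v, S v 1 = v 1 * S (unitVec 1) 1 := fun v => by
    conv_lhs => rw [plane_eq v, map_add, map_smul, map_smul, hS0]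
    simp only [PiLp.add_apply, PiLp.smul_apply, smul_eq_mul, unitVec_apply]
    simp
  set T : Plane → Plane := fun x => x₀ + S (x - x₀) with hT
  have hTsub : ∀ x y, T x - T y = S (x - y) := fun x y => by
    simp only [hT, map_sub]; abel
  -- the two halves of a small ball are mapped into the domains of approximation
  have hU : ∀ x ∈ Metric.ball x₀ δ, 0 ≤ x 1 → x ∈ closedSquare ∩ Metric.ball x₀ δ₁ := by
    intro x hx hx1
    rw [mem_ball_iff_norm] at hx
    refine ⟨mem_closedSquare_of_dist_lt ht₀ (hx.trans_le ?_) hx1, mem_ball_iff_norm.2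
      (hx.trans_le ?_)⟩
    · exact (min_le_left _ _).trans (min_le_right _ _)
    · exact (min_le_left _ _).trans (min_le_left _ _)
  have hL : ∀ x ∈ Metric.ball x₀ δ, x 1 ≤ 0 → T x ∈ closedSquare ∩ Metric.ball x₀ δ₂ := by
    intro x hx hx1
    rw [mem_ball_iff_norm] at hx
    have hTx : ‖T x - x₀‖ < min δ₂ ρ := by
      have h1 : T x - x₀ = S (x - x₀) := by simp [hT]
      have h2 : ‖x - x₀‖ * (‖S‖ + 1) < min δ₂ ρ :=
        (lt_div_iff₀ (by positivity)).1 (hx.trans_le (min_le_right _ _))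
      rw [h1]
      calc ‖S (x - x₀)‖ ≤ ‖S‖ * ‖x - x₀‖ := S.le_opNorm _
        _ ≤ ‖x - x₀‖ * (‖S‖ + 1) := by nlinarith [norm_nonneg (x - x₀)]
        _ < _ := h2
    refine ⟨mem_closedSquare_of_dist_lt ht₀ (hTx.trans_le (min_le_right _ _)) ?_,
      mem_ball_iff_norm.2 (hTx.trans_le (min_le_left _ _))⟩
    simp only [hT, PiLp.add_apply]
    rw [hS1, PiLp.sub_apply, hx₀_def, pt_one, sub_zero, zero_add]
    nlinarith
  set G : Plane → Plane := fun x => if 0 ≤ x 1 then G₁ x else G₂ (T x) with hGdef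
  have hline : ∀ x ∈ Metric.ball x₀ δ, x 1 = 0 → G₁ x = G₂ (T x) := by
    intro x hx hx1
    have hx' : x = pt (x 0) 0 := by
      rw [pt_eq, zero_smul, add_zero]
      conv_lhs => rw [plane_eq x, hx1, zero_smul, add_zero]
    have hTx : T x = x := by
      have h : x - x₀ = (x 0 - t₀) • unitVec 0 := by
        rw [hx', hx₀_def, pt_eq, pt_eq, zero_smul, sub_smul, unitVec]
        simp
      simp only [hT]
      rw [h, map_smul, hS0, ← h]
      abel
    rw [hTx, hx']
    exact hG _ (mem_closedSquare_iff.1 (hU x hx hx1.ge).1).1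
  have aU : ∀ x ∈ Metric.ball x₀ δ, ∀ y ∈ Metric.ball x₀ δ, 0 ≤ x 1 → 0 ≤ y 1 →
      ‖G₁ x - G₁ y - D (x - y)‖ ≤ c * ‖x - y‖ := fun x hx y hy hx1 hy1 => by
    have := ha₁ x (hU x hx hx1) y (hU y hy hy1)
    rwa [← hD] at this
  have aL : ∀ x ∈ Metric.ball x₀ δ, ∀ y ∈ Metric.ball x₀ δ, x 1 ≤ 0 → y 1 ≤ 0 →
      ‖G₂ (T x) - G₂ (T y) - D (x - y)‖ ≤ c * ‖x - y‖ := fun x hx y hy hx1 hy1 => by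
    have := ha₂ (T x) (hL x hx hx1) (T y) (hL y hy hy1)
    rw [hTsub, hS, ← hD] at this
    refine this.trans ?_
    calc _ ≤ (c / (‖S‖₊ + 1) : NNReal) * (‖S‖ * ‖x - y‖) := by
          gcongr
          exact S.le_opNorm _
      _ = (c / (‖S‖₊ + 1) : NNReal) * ‖S‖ * ‖x - y‖ := by ring
      _ ≤ _ := by gcongr
  have aUL : ∀ x ∈ Metric.ball x₀ δ, ∀ y ∈ Metric.ball x₀ δ, 0 ≤ x 1 → y 1 < 0 →
      ‖G₁ x - G₂ (T y) - D (x - y)‖ ≤ c * ‖x - y‖ := fun x hx y hy hx1 hy1 => by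
    -- split the segment at its intersection with the edge
    have hxy : 0 < x 1 - y 1 := by linarith
    set θ := x 1 / (x 1 - y 1) with hθ
    have hθ0 : 0 ≤ θ := div_nonneg hx1 hxy.le
    have hθ1 : θ ≤ 1 := (div_le_one hxy).2 (by linarith)
    set z := x + θ • (y - x) with hz
    have hzb : z ∈ Metric.ball x₀ δ :=
      (convex_ball x₀ δ).add_smul_sub_mem hx hy ⟨hθ0, hθ1⟩
    have hz1 : z 1 = 0 := by
      simp only [hz, PiLp.add_apply, PiLp.smul_apply, PiLp.sub_apply, smul_eq_mul, hθ]
      field_simp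
      ring
    have e1 := aU x hx z hzb hx1 hz1.ge
    have e2 := aL z hzb y hy hz1.le hy1.le
    have hxz : x - z = θ • (x - y) := by rw [hz, smul_sub, smul_sub]; abel
    have hzy : z - y = (1 - θ) • (x - y) := by rw [hz, sub_smul, one_smul, smul_sub, smul_sub]; abel
    calc ‖G₁ x - G₂ (T y) - D (x - y)‖
        = ‖(G₁ x - G₁ z - D (x - z)) + (G₂ (T z) - G₂ (T y) - D (z - y))‖ := by
          rw [hline z hzb hz1]
          simp only [map_sub]
          congr 1
          abel
      _ ≤ c * ‖x - z‖ + c * ‖z - y‖ := (norm_add_le _ _).trans (add_le_add e1 e2)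
      _ = c * ‖x - y‖ := by
          rw [hxz, hzy, norm_smul, norm_smul, Real.norm_of_nonneg hθ0,
            Real.norm_of_nonneg (by linarith : 0 ≤ 1 - θ)]
          ring
  have ha : ApproximatesLinearOn G (D : Plane →L[ℝ] Plane) (Metric.ball x₀ δ) c := by
    intro x hx y hy
    simp only [hGdef, ContinuousLinearEquiv.coe_coe]
    split_ifs with hx1 hy1 hy1
    · exact aU x hx y hy hx1 hy1
    · exact aUL x hx y hy hx1 (not_le.1 hy1)
    · have := aUL y hy x hx hy1 (not_le.1 hx1)
      rw [show G₂ (T x) - G₁ y - D (x - y) = -(G₁ y - G₂ (T x) - D (y - x)) by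
        rw [map_sub, map_sub]; abel, norm_neg, norm_sub_rev x y]
      exact this
    · exact aL x hx y hy (not_le.1 hx1).le (not_le.1 hy1).le
  have hnhds := ha.image_mem_nhds D.toNonlinearRightInverse (Metric.ball_mem_nhds x₀ hδ)
    (Or.inr hcN)
  have hGx₀ : G x₀ = G₁ x₀ := by simp [hGdef, hx₀_def]
  rw [hGx₀] at hnhds
  refine Filter.mem_of_superset hnhds ?_
  rintro _ ⟨x, hx, rfl⟩
  simp only [hGdef]
  split_ifs with hx1
  · exact Or.inl ⟨x, (hU x hx hx1).1, rfl⟩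
  · exact Or.inr ⟨T x, (hL x hx (not_le.1 hx1).le).1, rfl⟩

end TwoCharts

/-! ### Edge-local frames -/

/-- The derivative of `flipIf b`. -/
def flipSign (b : Bool) : ℝ := if b then -1 else 1

lemma flipSign_mul_self (b : Bool) : flipSign b * flipSign b = 1 := by
  cases b <;> simp [flipSign]

lemma flipIf_eq (b : Bool) (t : ℝ) : flipIf b t = flipIf b 0 + flipSign b * t := by
  cases b <;> simp [flipIf, flipSign]
  ring

lemma flipIf_xor (a b : Bool) (t : ℝ) : flipIf (a ^^ b) t = flipIf a (flipIf b t) := by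
  cases a <;> cases b <;> simp [flipIf]

lemma Fin.rev_ne_self_two (d : Fin 2) : d.rev ≠ d := by
  fin_cases d <;> simp

namespace Frame

variable (A : Frame)

lemma point_par (t s : ℝ) : A.point t s A.par = flipIf A.flipPar t := by
  simp [point]

lemma point_perp (t s : ℝ) : A.point t s A.par.rev = flipIf A.flipPerp s := by
  simp [point, Fin.rev_ne_self_two]

lemma forall_coord {P : Fin 2 → Prop} : (∀ i, P i) ↔ P A.par ∧ P A.par.rev := by
  obtain ⟨d, _, _⟩ := A
  fin_cases d <;> simp [Fin.forall_fin_two, and_comm]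

lemma point_coords (x : Plane) : A.point (A.tCoord x) (A.sCoord x) = x := by
  ext i
  revert i
  rw [A.forall_coord, point_par, point_perp]
  simp [tCoord, sCoord]

lemma tCoord_point (t s : ℝ) : A.tCoord (A.point t s) = t := by
  simp [tCoord, point_par]

lemma sCoord_point (t s : ℝ) : A.sCoord (A.point t s) = s := by
  simp [sCoord, point_perp]

lemma point_mem_openSquare {t s : ℝ} :
    A.point t s ∈ openSquare ↔ t ∈ Ioo (0 : ℝ) 1 ∧ s ∈ Ioo (0 : ℝ) 1 := by
  rw [openSquare, mem_ofPred_eq, A.forall_coord, point_par, point_perp, flipIf_mem_Ioo,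
    flipIf_mem_Ioo]

lemma point_mem_closedSquare {t s : ℝ} :
    A.point t s ∈ closedSquare ↔ t ∈ Icc (0 : ℝ) 1 ∧ s ∈ Icc (0 : ℝ) 1 := by
  rw [closedSquare, mem_ofPred_eq, A.forall_coord, point_par, point_perp, flipIf_mem_Icc,
    flipIf_mem_Icc]

lemma edge_mem_closedSquare {t : ℝ} (ht : t ∈ Icc (0 : ℝ) 1) : A.point t 0 ∈ closedSquare :=
  A.point_mem_closedSquare.2 ⟨ht, by simp⟩

lemma edge_notMem_openSquare (t : ℝ) : A.point t 0 ∉ openSquare := fun h => by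
  simpa using (A.point_mem_openSquare.1 h).2

/-- The symmetry of the square which maps the standard coordinates to the edge-local ones. -/
def map (x : Plane) : Plane := A.point (x 0) (x 1)

/-- The linear part of the symmetry `Frame.map`. -/
noncomputable def lin : Plane →L[ℝ] Plane :=
  (flipSign A.flipPar • EuclideanSpace.proj (𝕜 := ℝ) (0 : Fin 2)).smulRight (unitVec A.par) +
    (flipSign A.flipPerp • EuclideanSpace.proj (𝕜 := ℝ) (1 : Fin 2)).smulRight (unitVec A.par.rev)

lemma map_eq (x : Plane) : A.map x = A.point 0 0 + A.lin x := by
  ext i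
  revert i
  rw [A.forall_coord, map]
  have h : A.par ≠ A.par.rev := (Fin.rev_ne_self_two _).symm
  simp only [PiLp.add_apply, point_par, point_perp, lin]
  rw [flipIf_eq _ (x 0), flipIf_eq _ (x 1)]
  simp [unitVec_apply, h, h.symm]

lemma hasFDerivAt_map (x : Plane) : HasFDerivAt A.map A.lin x := by
  rw [show A.map = fun x => A.point 0 0 + A.lin x from funext A.map_eq]
  exact A.lin.hasFDerivAt.const_add _

lemma contDiff_map : ContDiff ℝ 1 A.map := by
  rw [show A.map = fun x => A.point 0 0 + A.lin x from funext A.map_eq]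
  exact contDiff_const.add A.lin.contDiff

lemma mapsTo_map : MapsTo A.map closedSquare closedSquare := fun _ hx =>
  A.point_mem_closedSquare.2 (mem_closedSquare_iff.1 hx)

lemma injective_map : Function.Injective A.map := by
  intro x y h
  have h1 := congrArg A.tCoord h
  have h2 := congrArg A.sCoord h
  simp only [map, tCoord_point, sCoord_point] at h1 h2
  rw [plane_eq x, plane_eq y, h1, h2]

lemma image_map_openSquare : A.map '' openSquare = openSquare := by
  refine Subset.antisymm ?_ fun x hx => ⟨pt (A.tCoord x) (A.sCoord x), ?_, A.point_coords x⟩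
  · rintro _ ⟨x, hx, rfl⟩
    exact A.point_mem_openSquare.2 (mem_openSquare_iff.1 hx)
  · rw [← A.point_coords x] at hx
    exact mem_openSquare_iff.2 (A.point_mem_openSquare.1 hx)

/-- The orientation `±1` of the edge-local coordinates. -/
noncomputable def sgn : ℝ := A.lin.det

lemma sgn_eq : A.sgn = (if A.par = 0 then 1 else -1) * flipSign A.flipPar * flipSign A.flipPerp := by
  rw [sgn, det_plane]
  obtain ⟨d, a, b⟩ := A
  fin_cases d <;> simp [lin, unitVec_apply, mul_comm]

lemma sgn_mul_self : A.sgn * A.sgn = 1 := by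
  have h1 := flipSign_mul_self A.flipPar
  have h2 := flipSign_mul_self A.flipPerp
  rw [sgn_eq]
  split_ifs
  · linear_combination h1 * (flipSign A.flipPerp * flipSign A.flipPerp) + h2
  · linear_combination h1 * (flipSign A.flipPerp * flipSign A.flipPerp) + h2

end Frame

namespace IsChart

variable {G : Plane → Plane} (hG : IsChart G)
include hG

lemma fderivWithin_comp_map (A : Frame) {x : Plane} (hx : x ∈ closedSquare) :
    fderivWithin ℝ (G ∘ A.map) closedSquare x =
      (fderivWithin ℝ G closedSquare (A.map x)).comp A.lin :=
  ((hG.hasFDerivWithinAt (A.mapsTo_map hx)).comp x (A.hasFDerivAt_map x).hasFDerivWithinAt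
    A.mapsTo_map).fderivWithin (uniqueDiffOn_closedSquare x hx)

lemma det_comp_map (A : Frame) {x : Plane} (hx : x ∈ closedSquare) :
    (fderivWithin ℝ (G ∘ A.map) closedSquare x).det =
      (fderivWithin ℝ G closedSquare (A.map x)).det * A.sgn := by
  rw [hG.fderivWithin_comp_map A hx]
  exact LinearMap.det_comp _ _

lemma comp_map (A : Frame) : IsChart (G ∘ A.map) where
  contDiffOn := hG.contDiffOn.comp A.contDiff_map.contDiffOn A.mapsTo_map
  injOn := hG.injOn.comp A.injective_map.injOn A.mapsTo_map
  det_ne_zero x hx := by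
    rw [hG.det_comp_map A hx]
    refine mul_ne_zero (hG.det_ne_zero _ (A.mapsTo_map hx)) fun h => ?_
    have := A.sgn_mul_self
    simp [h] at this

lemma isOpen_image_of_subset {U : Set Plane} (hU : IsOpen U) (hUs : U ⊆ openSquare) :
    IsOpen (G '' U) := by
  rw [isOpen_iff_mem_nhds]
  rintro _ ⟨x, hxU, rfl⟩
  have hx := hUs hxU
  have h1 : ContDiffAt ℝ 1 G x :=
    (hG.contDiffOn x (openSquare_subset hx)).contDiffAt (closedSquare_mem_nhds hx)
  have h2 : HasStrictFDerivAt G (fderivWithin ℝ G closedSquare x) x :=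
    h1.hasStrictFDerivAt' (hG.hasFDerivAt hx) (by simp)
  obtain ⟨D, hD⟩ := hG.exists_equiv (openSquare_subset hx)
  rw [← hD] at h2
  rw [← h2.map_nhds_eq_of_equiv]
  exact Filter.image_mem_map (hU.mem_nhds hxU)

lemma isOpen_image : IsOpen (G '' openSquare) :=
  hG.isOpen_image_of_subset isOpen_openSquare Subset.rfl

lemma closure_image : closure (G '' openSquare) = G '' closedSquare := by
  refine (closure_minimal (image_mono openSquare_subset)
    (isCompact_closedSquare.image_of_continuousOn hG.continuousOn).isClosed).antisymm ?_
  rw [← closure_openSquare]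
  exact ContinuousOn.image_closure (by rw [closure_openSquare]; exact hG.continuousOn)

end IsChart

/-! ### The topology of a multipatch domain -/

namespace Multipatch

variable {K E : Type*} {p : ℕ} (M : Multipatch K E p)

lemma chart (k : K) : IsChart (M.F k) where
  contDiffOn := M.contDiffOn k
  injOn := M.injOn k
  det_ne_zero := M.det_ne_zero k

lemma isOpen_patch (k : K) : IsOpen (M.patch k) := (M.chart k).isOpen_image

lemma closure_patch (k : K) : closure (M.patch k) = M.F k '' closedSquare :=
  (M.chart k).closure_image

lemma patch_subset_domain (k : K) : M.patch k ⊆ M.domain :=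
  interior_maximal (subset_closure.trans (subset_iUnion (fun k => closure (M.patch k)) k))
    (M.isOpen_patch k)

lemma isOpen_domain : IsOpen M.domain := isOpen_interior

lemma disjoint_closure_patch {k l : K} (h : k ≠ l) : Disjoint (closure (M.patch k)) (M.patch l) :=
  (M.disjoint k l h).closure_left (M.isOpen_patch l)

/-- The point of patch `k` with edge-local coordinates `(t, 0)`. -/
def edgePoint (k : K) (A : Frame) (t : ℝ) : Plane := M.F k (A.point t 0)

lemma edgePoint_mem_closure (k : K) (A : Frame) {t : ℝ} (ht : t ∈ Icc (0 : ℝ) 1) :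
    M.edgePoint k A t ∈ closure (M.patch k) := by
  rw [closure_patch]
  exact ⟨_, A.edge_mem_closedSquare ht, rfl⟩

lemma edgePoint_notMem_patch (k : K) (A : Frame) {t : ℝ} (ht : t ∈ Icc (0 : ℝ) 1) (m : K) :
    M.edgePoint k A t ∉ M.patch m := by
  intro h
  by_cases hkm : k = m
  · subst hkm
    obtain ⟨x, hx, hxe⟩ := h
    have := M.injOn k (openSquare_subset hx) (A.edge_mem_closedSquare ht) hxe
    exact A.edge_notMem_openSquare t (this ▸ hx)
  · exact disjoint_left.1 (M.disjoint_closure_patch hkm) (M.edgePoint_mem_closure k A ht) h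

/-- The orientation `±1` of the parametrization of a patch. -/
noncomputable def orient (k : K) : ℝ :=
  if 0 < (fderivWithin ℝ (M.F k) closedSquare squareCenter).det then 1 else -1

lemma orient_mul_self (k : K) : M.orient k * M.orient k = 1 := by
  unfold orient; split_ifs <;> simp

lemma orient_mul_det_pos (k : K) {x : Plane} (hx : x ∈ closedSquare) :
    0 < M.orient k * (fderivWithin ℝ (M.F k) closedSquare x).det := by
  have hc : ContinuousOn (fun x => (fderivWithin ℝ (M.F k) closedSquare x).det) closedSquare :=
    ContinuousLinearMap.continuous_det.comp_continuousOn (M.chart k).continuousOn_fderivWithin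
  have hpre : IsPreconnected ((fun x => (fderivWithin ℝ (M.F k) closedSquare x).det) ''
      closedSquare) := convex_closedSquare.isPreconnected.image _ hc
  have h0 : (0 : ℝ) ∉ (fun x => (fderivWithin ℝ (M.F k) closedSquare x).det) '' closedSquare := by
    rintro ⟨y, hy, hy0⟩
    exact M.det_ne_zero k y hy hy0
  have hcs := openSquare_subset squareCenter_mem
  have hord := hpre.ordConnected
  have hx0 := M.det_ne_zero k x hx
  have hc0 := M.det_ne_zero k _ hcs
  unfold orient
  split_ifs with hpos
  · rw [one_mul]
    by_contra! hneg
    exact h0 (hord.out ⟨x, hx, rfl⟩ ⟨_, hcs, rfl⟩ ⟨hneg, hpos.le⟩)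
  · rw [neg_one_mul, Left.neg_pos_iff]
    by_contra! hneg
    exact h0 (hord.out ⟨_, hcs, rfl⟩ ⟨x, hx, rfl⟩ ⟨not_lt.1 hpos, hneg⟩)

lemma abs_det (k : K) {x : Plane} (hx : x ∈ closedSquare) :
    |(fderivWithin ℝ (M.F k) closedSquare x).det| =
      M.orient k * (fderivWithin ℝ (M.F k) closedSquare x).det := by
  have h := M.orient_mul_det_pos k hx
  unfold orient at *
  split_ifs at * with h1
  · rw [abs_of_pos (by linarith)]; ring
  · rw [abs_of_neg (by linarith)]; ring

section Opposite

variable {k l : K} {A B : Frame} (hkl : k ≠ l)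
  (h : ∀ t ∈ Icc (0 : ℝ) 1, M.edgePoint k A t = M.edgePoint l B t)
include hkl h

lemma det_mul_det_neg {t : ℝ} (ht : t ∈ Ioo (0 : ℝ) 1) :
    (fderivWithin ℝ (M.F k ∘ A.map) closedSquare (pt t 0)).det *
      (fderivWithin ℝ (M.F l ∘ B.map) closedSquare (pt t 0)).det < 0 := by
  have c₁ := (M.chart k).comp_map A
  have c₂ := (M.chart l).comp_map B
  have hm := edgePoint_mem ht
  refine lt_of_le_of_ne (not_lt.1 fun hpos => ?_)
    (mul_ne_zero (c₁.det_ne_zero _ hm) (c₂.det_ne_zero _ hm))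
  obtain ⟨y, hy₁, hy₂⟩ := image_inter_nonempty c₁ c₂ h ht hpos
  rw [image_comp, A.image_map_openSquare] at hy₁
  rw [image_comp, B.image_map_openSquare] at hy₂
  exact disjoint_left.1 (M.disjoint k l hkl) hy₁ hy₂

/-- Two patches with a common edge lie on opposite sides of it. -/
lemma orient_mul_sgn_eq_neg : M.orient k * A.sgn = -(M.orient l * B.sgn) := by
  have ht : (1 / 2 : ℝ) ∈ Ioo (0 : ℝ) 1 := by constructor <;> norm_num
  have h1 := M.det_mul_det_neg hkl h ht
  have hm := edgePoint_mem ht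
  rw [(M.chart k).det_comp_map A hm, (M.chart l).det_comp_map B hm] at h1
  have h2 := M.orient_mul_det_pos k (A.mapsTo_map hm)
  have h3 := M.orient_mul_det_pos l (B.mapsTo_map hm)
  set d := (fderivWithin ℝ (M.F k) closedSquare (A.map (pt (1 / 2) 0))).det
  set d' := (fderivWithin ℝ (M.F l) closedSquare (B.map (pt (1 / 2) 0))).det
  have a1 := mul_self_eq_one_iff.1 (M.orient_mul_self k)
  have a2 := mul_self_eq_one_iff.1 (M.orient_mul_self l)
  have a3 := mul_self_eq_one_iff.1 A.sgn_mul_self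
  have a4 := mul_self_eq_one_iff.1 B.sgn_mul_self
  have h4 := mul_pos h2 h3
  rcases a1 with a1 | a1 <;> rcases a2 with a2 | a2 <;> rcases a3 with a3 | a3 <;>
    rcases a4 with a4 | a4 <;> rw [a1, a2, a3, a4] <;> rw [a3, a4] at h1 <;>
    rw [a1, a2] at h4 <;> first | (norm_num; done) | (exfalso; nlinarith)

lemma edgePoint_mem_domain {t : ℝ} (ht : t ∈ Ioo (0 : ℝ) 1) : M.edgePoint k A t ∈ M.domain := by
  have := image_union_mem_nhds ((M.chart k).comp_map A) ((M.chart l).comp_map B) h ht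
    (M.det_mul_det_neg hkl h ht)
  refine mem_interior_iff_mem_nhds.2 (Filter.mem_of_superset this ?_)
  rintro y (hy | hy)
  · obtain ⟨x, hx, rfl⟩ := hy
    exact mem_iUnion.2 ⟨k, by rw [closure_patch]; exact ⟨_, A.mapsTo_map hx, rfl⟩⟩
  · obtain ⟨x, hx, rfl⟩ := hy
    exact mem_iUnion.2 ⟨l, by rw [closure_patch]; exact ⟨_, B.mapsTo_map hx, rfl⟩⟩

end Opposite

/-- The parametrization of an interior edge. -/
def edgeCurve (e : E) (t : ℝ) : Plane := M.edgePoint (M.patchOf e false) (M.frame e false) t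

lemma edgePoint_eq (e : E) (σ : Bool) {t : ℝ} (ht : t ∈ Icc (0 : ℝ) 1) :
    M.edgePoint (M.patchOf e σ) (M.frame e σ) t = M.edgeCurve e t := by
  cases σ
  · rfl
  · exact (M.edge_param e t ht).symm

lemma patchOf_ne' (e : E) (σ : Bool) : M.patchOf e σ ≠ M.patchOf e (!σ) := by
  cases σ
  · exact M.patchOf_ne e
  · exact (M.patchOf_ne e).symm

lemma edgeCurve_mem_domain (e : E) {t : ℝ} (ht : t ∈ Ioo (0 : ℝ) 1) :
    M.edgeCurve e t ∈ M.domain :=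
  M.edgePoint_mem_domain (M.patchOf_ne e) (M.edge_param e) ht

lemma orient_mul_sgn_edge (e : E) : M.orient (M.patchOf e false) * (M.frame e false).sgn =
    -(M.orient (M.patchOf e true) * (M.frame e true).sgn) :=
  M.orient_mul_sgn_eq_neg (M.patchOf_ne e) (M.edge_param e)

lemma range_patchOf (e : E) (σ : Bool) :
    range (M.patchOf e) = {M.patchOf e σ, M.patchOf e (!σ)} := by
  ext k
  cases σ <;> simp [or_comm]

/-- A side of a patch belongs to at most one interior edge: otherwise three patches would meet
along a curve, pairwise on opposite sides of it. -/
lemma side_injective {e e' : E} {σ σ' : Bool} (hk : M.patchOf e σ = M.patchOf e' σ')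
    (hpar : (M.frame e σ).par = (M.frame e' σ').par)
    (hperp : (M.frame e σ).flipPerp = (M.frame e' σ').flipPerp) : e = e' ∧ σ = σ' := by
  have hee : e = e' := by
    by_contra hne
    set A := M.frame e σ with hA
    set c := xor A.flipPar (M.frame e' σ').flipPar with hc
    set k := M.patchOf e σ with hk_def
    set B' : Frame := { M.frame e' (!σ') with
      flipPar := xor (M.frame e' (!σ')).flipPar c } with hB'
    have hll : M.patchOf e (!σ) ≠ M.patchOf e' (!σ') := by
      intro hll
      refine hne (M.edge_unique ?_)
      change range (M.patchOf e) = range (M.patchOf e')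
      rw [M.range_patchOf e σ, M.range_patchOf e' σ', ← hk_def, ← hk, hll]
    have h1 : ∀ t ∈ Icc (0 : ℝ) 1, M.edgePoint k A t =
        M.edgePoint (M.patchOf e (!σ)) (M.frame e (!σ)) t := fun t ht => by
      rw [M.edgePoint_eq e σ ht, M.edgePoint_eq e (!σ) ht]
    have h2 : ∀ t ∈ Icc (0 : ℝ) 1, M.edgePoint k A t =
        M.edgePoint (M.patchOf e' (!σ')) B' t := fun t ht => by
      have hB : B'.point t 0 = (M.frame e' (!σ')).point (flipIf c t) 0 := by
        ext i
        simp only [Frame.point, hB', flipIf_xor]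
      have hA' : A.point t 0 = (M.frame e' σ').point (flipIf c t) 0 := by
        ext i
        simp only [Frame.point, hpar, hperp]
        rw [← flipIf_xor, hc, Bool.xor_comm A.flipPar, ← Bool.xor_assoc]
        simp
      rw [edgePoint, edgePoint, hB, hA', hk]
      have hct := (flipIf_mem_Icc c).2 ht
      exact (M.edgePoint_eq e' σ' hct).trans (M.edgePoint_eq e' (!σ') hct).symm
    have s1 := M.orient_mul_sgn_eq_neg (M.patchOf_ne' e σ) h1
    have s2 := M.orient_mul_sgn_eq_neg (hk ▸ M.patchOf_ne' e' σ') h2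
    have s3 := M.orient_mul_sgn_eq_neg hll fun t ht => (h1 t ht).symm.trans (h2 t ht)
    have h0 : M.orient k * A.sgn = 0 := by linarith
    have := congrArg₂ (· * ·) (M.orient_mul_self k) A.sgn_mul_self
    have h0' : M.orient k * A.sgn * (M.orient k * A.sgn) = 1 := by linear_combination this
    rw [h0] at h0'
    norm_num at h0'
  subst hee
  refine ⟨rfl, ?_⟩
  by_contra hne
  have : σ' = !σ := by cases σ <;> cases σ' <;> simp_all
  exact M.patchOf_ne' e σ (this ▸ hk)

/-- If a point in the relative interior of a side of the patch `k` belongs to another closed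
patch, then this side is an interior edge. -/
lemma exists_edge_of_mem_closure {k m : K} (hkm : k ≠ m) {A : Frame} {t : ℝ}
    (ht : t ∈ Ioo (0 : ℝ) 1) (h : M.edgePoint k A t ∈ closure (M.patch m)) :
    ∃ e σ, M.patchOf e σ = k ∧ M.patchOf e (!σ) = m ∧ (M.frame e σ).par = A.par ∧
      (M.frame e σ).flipPerp = A.flipPerp := by
  have htc := Ioo_subset_Icc_self ht
  have hmem : M.edgePoint k A t ∈ closure (M.patch k) ∩ closure (M.patch m) :=
    ⟨M.edgePoint_mem_closure k A htc, h⟩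
  have hparIoo : A.point t 0 A.par ∈ Ioo (0 : ℝ) 1 := by
    rw [A.point_par]; exact (flipIf_mem_Ioo _).2 ht
  rcases M.conforming k m hkm with h0 | ⟨c, hc, c', hc', -, h1⟩ | ⟨e, he⟩
  · exact absurd (h0 ▸ hmem) (notMem_empty _)
  · exfalso
    have hcc : c ∈ closedSquare := fun i => by rcases hc i with h | h <;> simp [h]
    have h2 : M.edgePoint k A t = M.F k c := by
      have := h1 ▸ hmem
      exact this
    have h3 := M.injOn k (A.edge_mem_closedSquare htc) hcc h2
    rw [h3] at hparIoo
    rcases hc A.par with h | h <;> simp [h] at hparIoo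
  · obtain ⟨σ, hσ⟩ : k ∈ range (M.patchOf e) := he ▸ mem_insert _ _
    have hσ' : M.patchOf e (!σ) = m := by
      have : M.patchOf e (!σ) ∈ ({k, m} : Set K) := he ▸ mem_range_self _
      rcases this with h' | h'
      · exact absurd (hσ.trans h'.symm) (M.patchOf_ne' e σ)
      · exact h'
    have hmem' : M.edgePoint k A t ∈ closure (M.patch (M.patchOf e false)) ∩
        closure (M.patch (M.patchOf e true)) := by
      cases σ
      · rwa [hσ, show true = !false from rfl, hσ']
      · rw [inter_comm]
        rwa [hσ, show false = !true from rfl, hσ']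
    obtain ⟨t', ht', hte⟩ := (M.edge_inter e).subset hmem'
    have hte' : M.edgePoint k (M.frame e σ) t' = M.edgePoint k A t := by
      rw [← hσ, M.edgePoint_eq e σ ht', hσ]
      exact hte
    have hpt : (M.frame e σ).point t' 0 = A.point t 0 :=
      M.injOn k ((M.frame e σ).edge_mem_closedSquare ht') (A.edge_mem_closedSquare htc) hte'
    set B := M.frame e σ
    have hpp : B.par = A.par := by
      by_contra hne
      have : A.par = B.par.rev := by
        have : ∀ a b : Fin 2, b ≠ a → a = b.rev := by decide
        exact this _ _ hne
      rw [← hpt, this, B.point_perp] at hparIoo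
      have := ((flipIf_mem_Ioo _).1 hparIoo).1
      simp at this
    refine ⟨e, σ, hσ, hσ', hpp, ?_⟩
    have h4 := B.point_perp t' 0
    rw [hpt, hpp, A.point_perp] at h4
    revert h4
    cases A.flipPerp <;> cases B.flipPerp <;> simp [flipIf]

/-- The relative interior of a side which is no interior edge belongs to the boundary of the
domain. -/
lemma edgePoint_notMem_domain [Finite K] {k : K} {A : Frame} {t : ℝ} (ht : t ∈ Ioo (0 : ℝ) 1)
    (h : ∀ e σ, M.patchOf e σ = k → (M.frame e σ).par = A.par →
      (M.frame e σ).flipPerp ≠ A.flipPerp) : M.edgePoint k A t ∉ M.domain := by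
  intro hd
  have hnot : ∀ m, k ≠ m → M.edgePoint k A t ∉ closure (M.patch m) := fun m hm hmem => by
    obtain ⟨e, σ, h1, -, h3, h4⟩ := M.exists_edge_of_mem_closure hm ht hmem
    exact h e σ h1 h3 h4
  have hn : (⋂ m : {m // k ≠ m}, (closure (M.patch m))ᶜ) ∈ nhds (M.edgePoint k A t) :=
    Filter.iInter_mem.2 fun m => isClosed_closure.isOpen_compl.mem_nhds (hnot m m.2)
  have hk : M.F k '' closedSquare ∈ nhds (M.edgePoint k A t) := by
    filter_upwards [mem_interior_iff_mem_nhds.1 hd, hn] with y hy hy'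
    obtain ⟨m, hm⟩ := mem_iUnion.1 hy
    by_cases hkm : k = m
    · subst hkm
      rwa [← closure_patch]
    · exact absurd hm (mem_iInter.1 hy' ⟨m, hkm⟩)
  exact A.edge_notMem_openSquare t ((M.chart k).mem_openSquare_of_image_mem_nhds
    (A.edge_mem_closedSquare (Ioo_subset_Icc_self ht)) hk)

/-- Two interior edges meet at most at their end points. -/
lemma edgeCurve_notMem {e e' : E} (hne : e ≠ e') {t : ℝ} (ht : t ∈ Ioo (0 : ℝ) 1) :
    M.edgeCurve e t ∉ M.edgeCurve e' '' Icc 0 1 := by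
  rintro ⟨t', ht', hte⟩
  have hcl : ∀ σ', M.edgePoint (M.patchOf e false) (M.frame e false) t ∈
      closure (M.patch (M.patchOf e' σ')) := fun σ' => by
    rw [M.edgePoint_eq e false (Ioo_subset_Icc_self ht), ← hte, ← M.edgePoint_eq e' σ' ht']
    exact M.edgePoint_mem_closure _ _ ht'
  have hmem : ∀ σ', M.patchOf e' σ' ∈ range (M.patchOf e) := fun σ' => by
    by_cases hk : M.patchOf e false = M.patchOf e' σ'
    · exact ⟨false, hk⟩
    · obtain ⟨e'', σ'', h1, h2, h3, h4⟩ := M.exists_edge_of_mem_closure hk ht (hcl σ')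
      obtain ⟨rfl, -⟩ := M.side_injective h1 h3 h4
      exact ⟨!σ'', h2⟩
  refine hne (M.edge_unique (Subset.antisymm ?_ ?_))
  · rintro _ ⟨σ, rfl⟩
    obtain ⟨τ, hτ⟩ := hmem false
    obtain ⟨τ', hτ'⟩ := hmem true
    have := M.patchOf_ne e'
    by_cases h : σ = τ
    · exact ⟨false, by rw [h, hτ]⟩
    · refine ⟨true, ?_⟩
      have : σ = τ' := by
        have : τ ≠ τ' := by rintro rfl; exact this (hτ.symm.trans hτ')
        cases σ <;> cases τ <;> cases τ' <;> simp_all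
      rw [this, hτ']
  · rintro _ ⟨σ', rfl⟩
    exact hmem σ'

lemma volume_image_boundary (k : K) : volume (M.F k '' (closedSquare \ openSquare)) = 0 := by
  refine addHaar_image_eq_zero_of_differentiableOn_of_addHaar_eq_zero volume
    (((M.contDiffOn k).differentiableOn (by simp)).mono sdiff_subset) ?_
  rw [← interior_closedSquare]
  exact measure_mono_null (sdiff_le_sdiff_right subset_closure)
    (convex_closedSquare.addHaar_frontier volume)

lemma volume_domain_diff [Countable K] : volume (M.domain \ ⋃ k, M.patch k) = 0 := by
  refine measure_mono_null (t := ⋃ k, M.F k '' (closedSquare \ openSquare)) ?_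
    (measure_iUnion_null M.volume_image_boundary)
  rintro y ⟨hy, hy'⟩
  obtain ⟨k, hk⟩ := mem_iUnion.1 (interior_subset hy)
  rw [closure_patch] at hk
  obtain ⟨x, hx, rfl⟩ := hk
  exact mem_iUnion.2 ⟨k, x, ⟨hx, fun hxo => hy' (mem_iUnion.2 ⟨k, x, hxo, rfl⟩)⟩, rfl⟩

end Multipatch

/-! ### Integration over the reference square -/

lemma measurePreserving_pt : MeasurePreserving (fun z : ℝ × ℝ => pt z.1 z.2) := by
  exact (PiLp.volume_preserving_toLp (Fin 2)).comp (volume_preserving_finTwoArrow ℝ).symm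

namespace Frame

variable (A : Frame)

lemma measurePreserving_map : MeasurePreserving A.map := by
  have h1 : MeasurePreserving A.lin := by
    refine ⟨A.lin.continuous.measurable, ?_⟩
    have hd : LinearMap.det (A.lin : Plane →ₗ[ℝ] Plane) ≠ 0 := fun h => by
      have := A.sgn_mul_self
      rw [show A.sgn = 0 from h] at this
      simp at this
    have := Measure.map_linearMap_addHaar_eq_smul_addHaar (volume : Measure Plane) hd
    have h1 : |(LinearMap.det (A.lin : Plane →ₗ[ℝ] Plane))⁻¹| = 1 := by
      change |A.sgn⁻¹| = 1
      rcases mul_self_eq_one_iff.1 A.sgn_mul_self with h | h <;> simp [h]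
    rw [h1] at this
    simpa using this
  have h2 := (measurePreserving_add_left (volume : Measure Plane) (A.point 0 0)).comp h1
  rwa [show A.map = _ from funext A.map_eq]

/-- The edge-local coordinates as a map on `ℝ²`. -/
def prodMap (z : ℝ × ℝ) : Plane := A.point z.1 z.2

lemma measurePreserving_prodMap : MeasurePreserving A.prodMap :=
  A.measurePreserving_map.comp measurePreserving_pt

lemma continuous_prodMap : Continuous A.prodMap := by
  have : Continuous fun z : ℝ × ℝ => pt z.1 z.2 := by
    simp only [pt_eq]
    fun_prop
  exact A.contDiff_map.continuous.comp this

lemma injective_prodMap : Function.Injective A.prodMap := fun z w h => by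
  have h1 := congrArg A.tCoord h
  have h2 := congrArg A.sCoord h
  simp only [prodMap, tCoord_point, sCoord_point] at h1 h2
  exact Prod.ext h1 h2

lemma measurableEmbedding_prodMap : MeasurableEmbedding A.prodMap :=
  A.continuous_prodMap.measurableEmbedding A.injective_prodMap

lemma preimage_prodMap : A.prodMap ⁻¹' openSquare = Ioo 0 1 ×ˢ Ioo 0 1 := by
  ext z
  exact A.point_mem_openSquare

lemma setIntegral_openSquare {H : Type*} [NormedAddCommGroup H] [NormedSpace ℝ H]
    (f : Plane → H) : ∫ x in openSquare, f x =
      ∫ z in Ioo (0 : ℝ) 1 ×ˢ Ioo (0 : ℝ) 1, f (A.point z.1 z.2) := by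
  rw [← A.measurePreserving_prodMap.setIntegral_preimage_emb A.measurableEmbedding_prodMap,
    preimage_prodMap]
  rfl

lemma integrableOn_openSquare {H : Type*} [NormedAddCommGroup H] {f : Plane → H}
    (h : IntegrableOn f openSquare) :
    IntegrableOn (fun z => f (A.point z.1 z.2)) (Ioo (0 : ℝ) 1 ×ˢ Ioo (0 : ℝ) 1) := by
  rw [← A.preimage_prodMap]
  exact (A.measurePreserving_prodMap.integrableOn_comp_preimage
    A.measurableEmbedding_prodMap).2 h

/-- Integrals of products over the square, in edge-local coordinates. -/
lemma setIntegral_openSquare_mul (f g : ℝ → ℝ) :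
    ∫ x in openSquare, f (A.tCoord x) * g (A.sCoord x) =
      (∫ t in (0 : ℝ)..1, f t) * ∫ s in (0 : ℝ)..1, g s := by
  rw [A.setIntegral_openSquare]
  simp only [tCoord_point, sCoord_point]
  rw [Measure.volume_eq_prod, setIntegral_prod_mul]
  simp only [intervalIntegral.integral_of_le zero_le_one, integral_Ioc_eq_integral_Ioo]

end Frame

lemma volume_openSquare_lt_top : volume openSquare < ⊤ :=
  (measure_mono openSquare_subset).trans_lt isCompact_closedSquare.measure_lt_top

lemma measurableSet_openSquare : MeasurableSet openSquare := isOpen_openSquare.measurableSet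

/-- Measurable functions which are bounded on the open square. -/
structure BddOnSquare {H : Type*} [NormedAddCommGroup H] [MeasurableSpace H]
    (f : Plane → H) : Prop where
  measurable : Measurable f
  bounded : ∃ C, ∀ x ∈ openSquare, ‖f x‖ ≤ C

lemma BddOnSquare.integrableOn {H : Type*} [NormedAddCommGroup H] [MeasurableSpace H]
    [BorelSpace H] [SecondCountableTopology H] {f : Plane → H} (h : BddOnSquare f) :
    IntegrableOn f openSquare := by
  obtain ⟨C, hC⟩ := h.bounded
  refine Measure.integrableOn_of_bounded (M := C) volume_openSquare_lt_top.ne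
    h.measurable.aestronglyMeasurable ?_
  filter_upwards [ae_restrict_mem measurableSet_openSquare] with x hx using hC x hx

/-! ### Transport to the patches -/

/-- The adjoint of an invertible map is invertible. -/
lemma exists_adjoint_equiv (D : Plane ≃L[ℝ] Plane) : ∃ D' : Plane ≃L[ℝ] Plane,
    (D' : Plane →L[ℝ] Plane) = ContinuousLinearMap.adjoint (D : Plane →L[ℝ] Plane) := by
  refine ⟨ContinuousLinearEquiv.equivOfInverse
    (ContinuousLinearMap.adjoint (D : Plane →L[ℝ] Plane))
    (ContinuousLinearMap.adjoint (D.symm : Plane →L[ℝ] Plane)) (fun x => ?_) (fun x => ?_), rfl⟩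
  · rw [← ContinuousLinearMap.comp_apply, ← ContinuousLinearMap.adjoint_comp]
    simp [ContinuousLinearMap.adjoint_id]
  · rw [← ContinuousLinearMap.comp_apply, ← ContinuousLinearMap.adjoint_comp]
    simp [ContinuousLinearMap.adjoint_id]

namespace IsChart

variable {G : Plane → Plane} (hG : IsChart G)
include hG

lemma invFunOn_apply {x : Plane} (hx : x ∈ openSquare) :
    Function.invFunOn G openSquare (G x) = x :=
  (hG.injOn.mono openSquare_subset).leftInvOn_invFunOn hx

lemma continuousOn_invFunOn : ContinuousOn (Function.invFunOn G openSquare) (G '' openSquare) := by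
  rw [continuousOn_open_iff hG.isOpen_image]
  intro U hU
  have : G '' openSquare ∩ Function.invFunOn G openSquare ⁻¹' U = G '' (openSquare ∩ U) := by
    ext y
    constructor
    · rintro ⟨⟨x, hx, rfl⟩, hy⟩
      rw [mem_preimage, hG.invFunOn_apply hx] at hy
      exact ⟨x, ⟨hx, hy⟩, rfl⟩
    · rintro ⟨x, ⟨hx, hxU⟩, rfl⟩
      exact ⟨⟨x, hx, rfl⟩, by rwa [mem_preimage, hG.invFunOn_apply hx]⟩
  rw [this]
  exact hG.isOpen_image_of_subset (isOpen_openSquare.inter hU) inter_subset_left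

/-- The matrix `DG^{-T}` depends continuously on the point. -/
lemma continuousOn_inverse_adjoint : ContinuousOn (fun x =>
    (ContinuousLinearMap.adjoint (fderivWithin ℝ G closedSquare x)).inverse) closedSquare := by
  intro x hx
  obtain ⟨D, hD⟩ := hG.exists_equiv hx
  obtain ⟨D', hD'⟩ := exists_adjoint_equiv D
  have h1 : ContinuousAt ContinuousLinearMap.inverse
      (ContinuousLinearMap.adjoint (fderivWithin ℝ G closedSquare x)) := by
    rw [← hD, ← hD']
    exact (contDiffAt_map_inverse (n := 0) D').continuousAt
  have h2 : ContinuousWithinAt (fun x =>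
      ContinuousLinearMap.adjoint (fderivWithin ℝ G closedSquare x)) closedSquare x :=
    (ContinuousLinearMap.adjoint (𝕜 := ℝ) (E := Plane) (F := Plane)).continuous.continuousAt
      |>.comp_continuousWithinAt (hG.continuousOn_fderivWithin x hx)
  exact ContinuousAt.comp_continuousWithinAt (f := fun x =>
    ContinuousLinearMap.adjoint (fderivWithin ℝ G closedSquare x)) h1 h2

lemma pushforward_apply (u : Plane → Plane) {x : Plane} (hx : x ∈ openSquare) :
    pushforward G u (G x) =
      (ContinuousLinearMap.adjoint (fderivWithin ℝ G closedSquare x)).inverse (u x) := by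
  rw [pushforward, hG.invFunOn_apply hx, hG.fderiv_eq hx]

lemma adjoint_pushforward (u : Plane → Plane) {x : Plane} (hx : x ∈ openSquare) :
    ContinuousLinearMap.adjoint (fderivWithin ℝ G closedSquare x) (pushforward G u (G x)) =
      u x := by
  obtain ⟨D, hD⟩ := hG.exists_equiv (openSquare_subset hx)
  obtain ⟨D', hD'⟩ := exists_adjoint_equiv D
  rw [hG.pushforward_apply u hx, ← hD, ← hD']
  simp

lemma setIntegral_image {H : Type*} [NormedAddCommGroup H] [NormedSpace ℝ H] (g : Plane → H) :
    ∫ y in G '' openSquare, g y =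
      ∫ x in openSquare, |(fderivWithin ℝ G closedSquare x).det| • g (G x) :=
  integral_image_eq_integral_abs_det_fderiv_smul volume measurableSet_openSquare
    (fun _ hx => (hG.hasFDerivAt hx).hasFDerivWithinAt) (hG.injOn.mono openSquare_subset) g

/-- A chart maps null sets to null sets, and so does its inverse. -/
lemma ae_image_iff {P : Plane → Prop} :
    (∀ᵐ y, y ∈ G '' openSquare → P y) ↔ ∀ᵐ x ∂volume.restrict openSquare, P (G x) := by
  constructor
  · intro h
    obtain ⟨N, hN, hNm, hN0⟩ := exists_measurable_superset_of_null (ae_iff.1 h)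
    have h1 : ∫⁻ y in G '' openSquare, N.indicator 1 y = 0 := by
      rw [lintegral_indicator_one hNm]
      exact measure_mono_null (fun y hy => hy) (Measure.restrict_apply_eq_zero hNm |>.2
        (measure_mono_null inter_subset_left hN0))
    rw [lintegral_image_eq_lintegral_abs_det_fderiv_mul volume measurableSet_openSquare
      (fun x hx => (hG.hasFDerivAt hx).hasFDerivWithinAt) (hG.injOn.mono openSquare_subset),
      lintegral_eq_zero_iff'] at h1
    · filter_upwards [h1, ae_restrict_mem measurableSet_openSquare] with x hx hxo
      by_contra hP
      have hxN : G x ∈ N := hN fun h => hP (h ⟨x, hxo, rfl⟩)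
      have := hG.det_ne_zero x (openSquare_subset hxo)
      simp [indicator_of_mem hxN, this] at hx
    · have hc : ContinuousOn (fun x => (fderivWithin ℝ G closedSquare x).det) openSquare :=
        ContinuousLinearMap.continuous_det.comp_continuousOn
          (hG.continuousOn_fderivWithin.mono openSquare_subset)
      have hm := hc.aemeasurable measurableSet_openSquare (μ := volume)
      have hGm := (hG.continuousOn.mono openSquare_subset).aemeasurable measurableSet_openSquare
        (μ := volume)
      refine AEMeasurable.mul ?_ ((measurable_one.indicator hNm).comp_aemeasurable hGm)
      exact (measurable_norm.comp_aemeasurable hm).ennreal_ofReal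
  · intro h
    rw [ae_restrict_iff' measurableSet_openSquare, ae_iff] at h
    rw [ae_iff]
    refine measure_mono_null ?_ (addHaar_image_eq_zero_of_differentiableOn_of_addHaar_eq_zero
      volume (f := G) (fun x hx => ?_) h)
    · intro y hy
      simp only [mem_ofPred_eq, Classical.not_imp] at hy
      obtain ⟨⟨x, hx, rfl⟩, hy⟩ := hy
      exact ⟨x, by simpa using ⟨hx, hy⟩, rfl⟩
    · have hx' : x ∈ openSquare := by
        by_contra hn
        simp [hn] at hx
      exact (hG.hasFDerivAt hx').differentiableAt.differentiableWithinAt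

end IsChart

/-! ### Broken fields and their logical fields -/

namespace BddOnSquare

variable {H : Type*} [NormedAddCommGroup H] [MeasurableSpace H]

lemma add [BorelSpace H] [SecondCountableTopology H] {f g : Plane → H} (hf : BddOnSquare f)
    (hg : BddOnSquare g) : BddOnSquare (f + g) := by
  obtain ⟨hf, C, hC⟩ := hf
  obtain ⟨hg, D, hD⟩ := hg
  exact ⟨hf.add hg, C + D, fun x hx => (norm_add_le _ _).trans (add_le_add (hC x hx) (hD x hx))⟩

lemma smul [NormedSpace ℝ H] [BorelSpace H] [SecondCountableTopology H] {f : Plane → ℝ}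
    {g : Plane → H} (hf : BddOnSquare f) (hg : BddOnSquare g) :
    BddOnSquare fun x => f x • g x := by
  obtain ⟨hf, C, hC⟩ := hf
  obtain ⟨hg, D, hD⟩ := hg
  refine ⟨hf.smul hg, C * D, fun x hx => (norm_smul_le _ _).trans ?_⟩
  exact mul_le_mul (hC x hx) (hD x hx) (norm_nonneg _) ((norm_nonneg _).trans (hC x hx))

lemma const (c : H) : BddOnSquare fun _ => c :=
  ⟨measurable_const, ‖c‖, fun _ _ => le_rfl⟩

lemma comp_coord {f : ℝ → ℝ} (hf : f ∈ bddMeas) (d : Fin 2) : BddOnSquare fun x => f (x d) := by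
  obtain ⟨hf, C, hC⟩ := hf
  exact ⟨hf.comp (by fun_prop), C, fun x hx => hC _ (openSquare_subset hx d)⟩

end BddOnSquare

namespace KnotVector

variable {p : ℕ} (Ξ : KnotVector p)

lemma bddOnSquare_of_mem_hatV1 {u : Plane → Plane} (hu : u ∈ Ξ.hatV1) : BddOnSquare u := by
  induction hu using Submodule.span_induction with
  | mem u hu =>
    obtain ⟨⟨d, i, j⟩, rfl⟩ := hu
    have h1 := BddOnSquare.comp_coord (Ξ.lam1_mem_bddMeas i) d
    have h2 := BddOnSquare.comp_coord (Ξ.lam0_mem_bddMeas j) d.rev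
    exact (h1.smul h2).smul (BddOnSquare.const (unitVec d))
  | zero => exact BddOnSquare.const 0
  | add u v _ _ hu hv => exact hu.add hv
  | smul c u _ hu => exact (BddOnSquare.const c).smul hu

lemma hatBasis1_mem_hatV1 (d : Fin 2) {i j : ℕ} (hi : i < Ξ.n) (hj : j ≤ Ξ.n) :
    Ξ.hatBasis1 d i j ∈ Ξ.hatV1 :=
  Submodule.subset_span ⟨(d, ⟨i, hi⟩, ⟨j, by omega⟩), rfl⟩

lemma hatBasis1_apply (d d' : Fin 2) (i j : ℕ) (x : Plane) :
    Ξ.hatBasis1 d i j x d' = if d' = d then Ξ.lam1 i (x d) * Ξ.lam0 j (x d.rev) else 0 := by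
  simp [hatBasis1, unitVec_apply]

lemma exists_coeff_of_mem_hatV1 {u : Plane → Plane} (hu : u ∈ Ξ.hatV1) :
    ∃ c : Fin 2 → Fin Ξ.n → Fin (Ξ.n + 1) → ℝ,
      u = (∑ d, ∑ i, ∑ j, c d i j • Ξ.hatBasis1 d i j) ∧
      ∀ x d, u x d = ∑ i, ∑ j, c d i j * (Ξ.lam1 i (x d) * Ξ.lam0 j (x d.rev)) := by
  rw [hatV1, Submodule.mem_span_range_iff_exists_fun] at hu
  obtain ⟨c, rfl⟩ := hu
  have h0 : ∑ a, c a • Ξ.hatBasis1 a.1 a.2.1 a.2.2 =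
      ∑ d, ∑ i, ∑ j, c (d, i, j) • Ξ.hatBasis1 d i j := by
    simp only [Fintype.sum_prod_type]
  refine ⟨fun d i j => c (d, i, j), h0, fun x d => ?_⟩
  rw [h0]
  simp only [Finset.sum_apply, WithLp.ofLp_sum, Pi.smul_apply, PiLp.smul_apply, smul_eq_mul,
    hatBasis1_apply]
  rw [Finset.sum_eq_single d (fun b _ hb => by simp [hb.symm]) (by simp)]
  simp

/-- The functions of `V̂¹` are determined by their values almost everywhere. -/
lemma eq_zero_of_ae_hatV1 (hp : 1 ≤ p) {u : Plane → Plane} (hu : u ∈ Ξ.hatV1)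
    (h : ∀ᵐ x ∂volume.restrict openSquare, u x = 0) : u = 0 := by
  obtain ⟨c, hc, hcx⟩ := Ξ.exists_coeff_of_mem_hatV1 hu
  obtain ⟨D, hD, hDd⟩ := Ξ.lam1_dual hp
  obtain ⟨D', hD', hDd'⟩ := Ξ.lam0_dual
  -- the coefficients are the moments against the tensor products of the dual functions
  have key : ∀ d i j, c d i j = 0 := by
    intro d i j
    have h1 : ∫ x in openSquare, u x d * (D i (x d) * D' j (x d.rev)) = 0 := by
      refine integral_eq_zero_of_ae ?_
      filter_upwards [h] with x hx
      simp [hx]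
    have h2 : ∀ i' j', ∫ x in openSquare, c d i' j' * (Ξ.lam1 i' (x d) * Ξ.lam0 j' (x d.rev)) *
        (D i (x d) * D' j (x d.rev)) = c d i' j' * ((if i' = i then 1 else 0) *
          if j' = j then 1 else 0) := by
      intro i' j'
      have := (Frame.mk d false false).setIntegral_openSquare_mul
        (fun t => Ξ.lam1 i' t * D i t) (fun s => Ξ.lam0 j' s * D' j s)
      rw [hDd, hDd'] at this
      rw [← this, ← integral_const_mul]
      refine integral_congr_ae (Filter.Eventually.of_forall fun x => ?_)
      simp only [Frame.tCoord, Frame.sCoord, flipIf]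
      simp only [Bool.false_eq_true, if_false]
      ring
    have hint : ∀ i' j', IntegrableOn (fun x : Plane =>
        c d i' j' * (Ξ.lam1 i' (x d) * Ξ.lam0 j' (x d.rev)) *
        (D i (x d) * D' j (x d.rev))) openSquare := fun i' j' =>
      (((BddOnSquare.const (c d i' j')).smul
        ((BddOnSquare.comp_coord (Ξ.lam1_mem_bddMeas i') d).smul
          (BddOnSquare.comp_coord (Ξ.lam0_mem_bddMeas j') d.rev))).smul
        ((BddOnSquare.comp_coord (bddMeas.of_continuous (hD i)) d).smul
          (BddOnSquare.comp_coord (bddMeas.of_continuous (hD' j)) d.rev))).integrableOn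
    simp only [hcx, Finset.sum_mul] at h1
    rw [integral_finsetSum _ fun i' _ => integrable_finsetSum _ fun j' _ => hint i' j'] at h1
    simp only [integral_finsetSum _ fun j' _ => hint _ j', h2] at h1
    simpa [mul_ite] using h1
  rw [hc]
  simp [key]

end KnotVector

lemma IsChart.pullback_apply {G : Plane → Plane} (hG : IsChart G) (v : Plane → Plane) {x : Plane}
    (hx : x ∈ openSquare) : pullback G v x =
      ContinuousLinearMap.adjoint (fderivWithin ℝ G closedSquare x) (v (G x)) := by
  rw [pullback, hG.fderiv_eq hx]

lemma IsChart.eq_pushforward_iff {G : Plane → Plane} (hG : IsChart G) (v u : Plane → Plane)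
    {x : Plane} (hx : x ∈ openSquare) :
    v (G x) = pushforward G u (G x) ↔ pullback G v x = u x := by
  rw [hG.pullback_apply v hx]
  constructor
  · intro h
    rw [h, hG.adjoint_pushforward u hx]
  · intro h
    obtain ⟨D, hD⟩ := hG.exists_equiv (openSquare_subset hx)
    obtain ⟨D', hD'⟩ := exists_adjoint_equiv D
    rw [hG.pushforward_apply u hx, ← h, ← hD, ← hD']
    simp

lemma IsChart.isFiniteMeasure_image {G : Plane → Plane} (hG : IsChart G) :
    IsFiniteMeasure (volume.restrict (G '' openSquare)) := by
  refine ⟨?_⟩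
  rw [Measure.restrict_apply_univ]
  exact (measure_mono (image_mono openSquare_subset)).trans_lt
    (isCompact_closedSquare.image_of_continuousOn hG.continuousOn).measure_lt_top

/-- The pushforward of a bounded logical field belongs to `L²`. -/
lemma IsChart.memLp_pushforward {G : Plane → Plane} (hG : IsChart G) {u : Plane → Plane}
    (hu : BddOnSquare u) : MemLp (pushforward G u) 2 (volume.restrict (G '' openSquare)) := by
  have hm : MeasurableSet (G '' openSquare) := hG.isOpen_image.measurableSet
  have hfin : IsFiniteMeasure (volume.restrict (G '' openSquare)) := hG.isFiniteMeasure_image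
  have hmaps : MapsTo (Function.invFunOn G openSquare) (G '' openSquare) closedSquare := by
    rintro _ ⟨x, hx, rfl⟩
    rw [hG.invFunOn_apply hx]
    exact openSquare_subset hx
  obtain ⟨C, hC⟩ := hu.bounded
  obtain ⟨B, hB⟩ := isCompact_closedSquare.exists_bound_of_continuousOn
    hG.continuousOn_inverse_adjoint
  have h1 := (hG.continuousOn_inverse_adjoint.comp hG.continuousOn_invFunOn
    hmaps).aestronglyMeasurable hm (μ := volume)
  have h2 : AEStronglyMeasurable (fun y => u (Function.invFunOn G openSquare y))
      (volume.restrict (G '' openSquare)) :=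
    (hu.measurable.comp_aemeasurable
      (hG.continuousOn_invFunOn.aemeasurable hm (μ := volume))).aestronglyMeasurable
  have h3 := (ContinuousLinearMap.apply ℝ Plane (E := Plane)).flip.aestronglyMeasurable_comp₂ h1 h2
  refine MemLp.of_bound (h3.congr ?_) (B * C) ?_
  · filter_upwards [ae_restrict_mem hm] with y hy
    obtain ⟨x, hx, rfl⟩ := hy
    simp only [Function.comp, ContinuousLinearMap.flip_apply, ContinuousLinearMap.apply_apply,
      hG.invFunOn_apply hx, hG.pushforward_apply u hx]
  · filter_upwards [ae_restrict_mem hm] with y hy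
    obtain ⟨x, hx, rfl⟩ := hy
    rw [hG.pushforward_apply u hx]
    refine (ContinuousLinearMap.le_opNorm _ _).trans ?_
    exact mul_le_mul (hB x (openSquare_subset hx)) (hC x hx) (norm_nonneg _)
      ((norm_nonneg _).trans (hB x (openSquare_subset hx)))

namespace Multipatch

variable {K E : Type*} {p : ℕ} (M : Multipatch K E p)

lemma ae_patch_iff {k : K} {P : Plane → Prop} :
    (∀ᵐ y ∂volume.restrict M.domain, y ∈ M.patch k → P y) ↔
      ∀ᵐ x ∂volume.restrict openSquare, P (M.F k x) := by
  rw [← (M.chart k).ae_image_iff, ae_restrict_iff' M.isOpen_domain.measurableSet]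
  refine Filter.eventually_congr (Filter.Eventually.of_forall fun y => ?_)
  exact ⟨fun h hy => h (M.patch_subset_domain k hy) hy, fun h _ hy => h hy⟩

/-- On the reference squares, `IsPush` says that the pullbacks are the given logical fields. -/
lemma isPush_iff {v : Plane → Plane} {u : K → Plane → Plane} : M.IsPush v u ↔
    ∀ k, ∀ᵐ x ∂volume.restrict openSquare, pullback (M.F k) v x = u k x := by
  refine forall_congr' fun k => ?_
  rw [M.ae_patch_iff]
  refine Filter.eventually_congr ?_
  filter_upwards [ae_restrict_mem measurableSet_openSquare] with x hx
  exact (M.chart k).eq_pushforward_iff v (u k) hx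

/-- The patches cover the domain up to a null set. -/
lemma ae_domain_of_forall_patch [Countable K] {P : Plane → Prop}
    (h : ∀ k, ∀ᵐ x ∂volume.restrict openSquare, P (M.F k x)) :
    ∀ᵐ y ∂volume.restrict M.domain, P y := by
  have h1 := ae_all_iff.2 fun k => M.ae_patch_iff.2 (h k)
  have h2 : ∀ᵐ y ∂volume.restrict M.domain, y ∈ ⋃ k, M.patch k := by
    rw [ae_restrict_iff' M.isOpen_domain.measurableSet, ae_iff]
    refine measure_mono_null (fun y hy => ?_) M.volume_domain_diff
    simpa using hy
  filter_upwards [h1, h2] with y hy hy2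
  obtain ⟨k, hk⟩ := mem_iUnion.1 hy2
  exact hy k hk

lemma eq_of_isPush [Countable K] {v v' : L2Field M.domain} {u : K → Plane → Plane}
    (h : M.IsPush v u) (h' : M.IsPush v' u) : v = v' := by
  refine Lp.ext (M.ae_domain_of_forall_patch fun k => ?_)
  filter_upwards [M.ae_patch_iff.1 (h k), M.ae_patch_iff.1 (h' k)] with x hx hx'
  rw [hx, hx']

/-- Square integrable functions on the patches are glued to one on the domain. -/
lemma exists_glue [Fintype K] {H : Type*} [NormedAddCommGroup H] {f : K → Plane → H}
    (hf : ∀ k, MemLp (f k) 2 (volume.restrict (M.patch k))) :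
    ∃ v : Lp H 2 (volume.restrict M.domain), ∀ k, ∀ᵐ y ∂volume.restrict M.domain,
      y ∈ M.patch k → v y = f k y := by
  have h1 : MemLp (fun y => ∑ k, (M.patch k).indicator (f k) y) 2
      (volume.restrict M.domain) :=
    memLp_finsetSum _ fun k _ => ((memLp_indicator_iff_restrict
      (M.isOpen_patch k).measurableSet).2 (hf k)).restrict _
  refine ⟨h1.toLp, fun k => ?_⟩
  filter_upwards [h1.coeFn_toLp] with y hy hk
  rw [hy, Finset.sum_eq_single k (fun l _ hl => ?_) (by simp), indicator_of_mem hk]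
  exact indicator_of_notMem (disjoint_left.1 (M.disjoint k l hl.symm) hk) _

lemma exists_isPush [Fintype K] {u : K → Plane → Plane} (hu : ∀ k, BddOnSquare (u k)) :
    ∃ v : L2Field M.domain, M.IsPush v u :=
  M.exists_glue fun k => (M.chart k).memLp_pushforward (hu k)

/-- The broken logical fields, which belong to `V̂¹_k` on the patch `k`. -/
def broken : Submodule ℝ (K → Plane → Plane) := Submodule.pi univ fun k => (M.knots k).hatV1

lemma mem_broken {u : K → Plane → Plane} : u ∈ M.broken ↔ ∀ k, u k ∈ (M.knots k).hatV1 := by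
  simp [broken, Submodule.mem_pi]

lemma onPatch_mem_broken {k : K} {u : Plane → Plane} (hu : u ∈ (M.knots k).hatV1) :
    onPatch k u ∈ M.broken := by
  classical
  rw [mem_broken]
  intro l
  unfold onPatch
  rcases eq_or_ne l k with rfl | h
  · simpa using hu
  · rw [Pi.single_eq_of_ne h]
    exact Submodule.zero_mem _

lemma isPush_unique (hp : 1 ≤ p) {v : Plane → Plane} {u u' : K → Plane → Plane}
    (hu : u ∈ M.broken) (hu' : u' ∈ M.broken) (h : M.IsPush v u) (h' : M.IsPush v u') :
    u = u' := by
  funext k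
  refine sub_eq_zero.1 ((M.knots k).eq_zero_of_ae_hatV1 hp
    (Submodule.sub_mem _ (M.mem_broken.1 hu k) (M.mem_broken.1 hu' k)) ?_)
  filter_upwards [M.isPush_iff.1 h k, M.isPush_iff.1 h' k] with x hx hx'
  rw [Pi.sub_apply, ← hx, ← hx', sub_self]

lemma exists_logical (v : M.V1pw) : ∃ u : M.broken, M.IsPush v u := by
  obtain ⟨u, hu, h⟩ := v.2
  exact ⟨⟨u, M.mem_broken.2 hu⟩, h⟩

/-- A field in `V¹_pw` corresponds to a unique broken logical field. -/
noncomputable def logical [Fintype K] (hp : 1 ≤ p) : M.V1pw ≃ₗ[ℝ] M.broken :=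
  LinearEquiv.ofBijective
    { toFun := fun v => (M.exists_logical v).choose
      map_add' := fun v w => by
        have h1 := (M.exists_logical v).choose_spec
        have h2 := (M.exists_logical w).choose_spec
        refine Subtype.ext (M.isPush_unique hp (Subtype.coe_prop _) (Subtype.coe_prop _)
          (M.exists_logical (v + w)).choose_spec fun k => ?_)
        filter_upwards [h1 k, h2 k, Lp.coeFn_add (v : L2Field M.domain) w] with y hy hy' hyy hk
        rw [Submodule.coe_add, hyy, Pi.add_apply, hy hk, hy' hk]
        simp [pushforward]
      map_smul' := fun c v => by
        have h1 := (M.exists_logical v).choose_spec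
        refine Subtype.ext (M.isPush_unique hp (Subtype.coe_prop _) (Subtype.coe_prop _)
          (M.exists_logical (c • v)).choose_spec fun k => ?_)
        filter_upwards [h1 k, Lp.coeFn_smul c (v : L2Field M.domain)] with y hy hyy hk
        rw [Submodule.coe_smul, hyy, Pi.smul_apply, hy hk]
        simp [pushforward] } <| by
    constructor
    · intro v w h
      have h1 := (M.exists_logical v).choose_spec
      have h2 := (M.exists_logical w).choose_spec
      have h' : (M.exists_logical v).choose = (M.exists_logical w).choose := h
      rw [h'] at h1
      exact Subtype.ext (M.eq_of_isPush h1 h2)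
    · intro u
      obtain ⟨v, hv⟩ := M.exists_isPush fun k =>
        (M.knots k).bddOnSquare_of_mem_hatV1 (M.mem_broken.1 u.2 k)
      let w : M.V1pw := ⟨v, u, M.mem_broken.1 u.2, hv⟩
      exact ⟨w, Subtype.ext (M.isPush_unique hp (Subtype.coe_prop _) u.2
        (M.exists_logical w).choose_spec hv)⟩

section Logical

variable [Fintype K] (hp : 1 ≤ p)

lemma isPush_logical (v : M.V1pw) : M.IsPush v (M.logical hp v : K → Plane → Plane) :=
  (M.exists_logical v).choose_spec

lemma isPush_iff_logical {v : M.V1pw} {u : K → Plane → Plane} (hu : u ∈ M.broken) :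
    M.IsPush v u ↔ (M.logical hp v : K → Plane → Plane) = u :=
  ⟨M.isPush_unique hp (Subtype.coe_prop _) hu (M.isPush_logical hp v),
    fun h => h ▸ M.isPush_logical hp v⟩

end Logical

end Multipatch

/-! ### Traces and tangential fields on one patch -/

namespace Frame

variable (A : Frame)

/-- The tangential trace of a logical field on an edge of the square. -/
noncomputable def trace : (Plane → Plane) →ₗ[ℝ] ℝ → ℝ where
  toFun u t := inner ℝ A.tangent (u (A.point t 0))
  map_add' u v := by
    funext t
    simp [inner_add_right]
  map_smul' c u := by
    funext t
    simp [real_inner_smul_right]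

lemma trace_apply (u : Plane → Plane) (t : ℝ) :
    A.trace u t = inner ℝ A.tangent (u (A.point t 0)) := rfl

lemma tangent_eq : A.tangent = flipSign A.flipPar • unitVec A.par := rfl

lemma inner_tangent (y : Plane) : inner ℝ A.tangent y = flipSign A.flipPar * y A.par := by
  rw [tangent_eq, real_inner_smul_left]
  congr 1
  simp [unitVec, EuclideanSpace.inner_single_left]

lemma tang_apply (f g : ℝ → ℝ) (x : Plane) :
    A.tang f g x = (f (A.tCoord x) * g (A.sCoord x)) • A.tangent := rfl

lemma tang_apply_coord (f g : ℝ → ℝ) (x : Plane) (d : Fin 2) : A.tang f g x d =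
    if d = A.par then flipSign A.flipPar * (f (A.tCoord x) * g (A.sCoord x)) else 0 := by
  rw [tang_apply, tangent_eq]
  simp only [PiLp.smul_apply, unitVec_apply, smul_eq_mul]
  split_ifs <;> ring

lemma trace_tang (f g : ℝ → ℝ) : A.trace (A.tang f g) = g 0 • f := by
  funext t
  rw [trace_apply, inner_tangent, tang_apply_coord, if_pos rfl, tCoord_point, sCoord_point]
  have := flipSign_mul_self A.flipPar
  rw [Pi.smul_apply, smul_eq_mul]
  linear_combination (f t * g 0) * this

lemma trace_tang_of_par_ne {B : Frame} (h : A.par ≠ B.par) (f g : ℝ → ℝ) :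
    A.trace (B.tang f g) = 0 := by
  funext t
  rw [trace_apply, inner_tangent, tang_apply_coord, if_neg h, mul_zero, Pi.zero_apply]

/-- A tangential field of the opposite side has no trace if it vanishes at distance `1`. -/
lemma trace_tang_opposite {B : Frame} (h : A.par = B.par) (h' : A.flipPerp ≠ B.flipPerp)
    (f : ℝ → ℝ) {g : ℝ → ℝ} (hg : g 1 = 0) : A.trace (B.tang f g) = 0 := by
  funext t
  have h1 : B.sCoord (A.point t 0) = 1 := by
    rw [sCoord, ← h, point_perp]
    revert h'
    cases A.flipPerp <;> cases B.flipPerp <;> simp [flipIf]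
  rw [trace_apply, inner_tangent, tang_apply_coord, h1, hg]
  simp

lemma tang_add_left (f f' g : ℝ → ℝ) : A.tang (f + f') g = A.tang f g + A.tang f' g := by
  funext x
  simp [tang_apply, add_mul, add_smul]

lemma tang_smul_left (c : ℝ) (f g : ℝ → ℝ) : A.tang (c • f) g = c • A.tang f g := by
  funext x
  simp [tang_apply, smul_smul, mul_assoc]

lemma tang_add_right (f g g' : ℝ → ℝ) : A.tang f (g + g') = A.tang f g + A.tang f g' := by
  funext x
  simp [tang_apply, mul_add, add_smul]

lemma tang_smul_right (c : ℝ) (f g : ℝ → ℝ) : A.tang f (c • g) = c • A.tang f g := by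
  funext x
  simp [tang_apply, smul_smul, mul_left_comm]

lemma tang_zero_left (g : ℝ → ℝ) : A.tang 0 g = 0 := by
  funext x
  simp [tang_apply]

lemma tang_zero_right (f : ℝ → ℝ) : A.tang f 0 = 0 := by
  funext x
  simp [tang_apply]

variable {p : ℕ} (Ξ : KnotVector p)

/-- In edge-local coordinates, the tangential basis fields are the basis fields of the square up to
their numbering and sign. -/
lemma hatBasis1_par (i j : ℕ) :
    Ξ.hatBasis1 A.par (Ξ.idx1 A.flipPar i) (Ξ.idx0 A.flipPerp j) =
      flipSign A.flipPar • A.tang (Ξ.lam1' A.flipPar i) (Ξ.lam0' A.flipPerp j) := by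
  funext x
  rw [Pi.smul_apply, tang_apply, Ξ.lam1'_apply, Ξ.lam0'_apply, tCoord, sCoord, flipIf_flipIf,
    flipIf_flipIf, tangent_eq, smul_smul, smul_smul, KnotVector.hatBasis1]
  congr 1
  linear_combination (-(Ξ.lam1 (Ξ.idx1 A.flipPar i) (x A.par) *
    Ξ.lam0 (Ξ.idx0 A.flipPerp j) (x A.par.rev))) * flipSign_mul_self A.flipPar

lemma tang_basis_eq (i j : ℕ) : A.tang (Ξ.lam1' A.flipPar i) (Ξ.lam0' A.flipPerp j) =
    flipSign A.flipPar • Ξ.hatBasis1 A.par (Ξ.idx1 A.flipPar i) (Ξ.idx0 A.flipPerp j) := by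
  rw [hatBasis1_par, smul_smul, flipSign_mul_self, one_smul]

lemma tang_mem_hatV1 {f g : ℝ → ℝ} (hf : f ∈ Ξ.space1 A.flipPar) (hg : g ∈ Ξ.space0 A.flipPerp) :
    A.tang f g ∈ Ξ.hatV1 := by
  induction hf using Submodule.span_induction with
  | mem f hf =>
    obtain ⟨i, rfl⟩ := hf
    induction hg using Submodule.span_induction with
    | mem g hg =>
      obtain ⟨j, rfl⟩ := hg
      simp only [tang_basis_eq]
      exact Submodule.smul_mem _ _ (Ξ.hatBasis1_mem_hatV1 _ (Ξ.idx1_lt i.2)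
        (Ξ.idx0_le (by omega)))
    | zero => rw [tang_zero_right]; exact Submodule.zero_mem _
    | add g g' _ _ h h' => rw [tang_add_right]; exact Submodule.add_mem _ h h'
    | smul c g _ h => rw [tang_smul_right]; exact Submodule.smul_mem _ c h
  | zero => rw [tang_zero_left]; exact Submodule.zero_mem _
  | add f f' _ _ h h' => rw [tang_add_left]; exact Submodule.add_mem _ h h'
  | smul c f _ h => rw [tang_smul_left]; exact Submodule.smul_mem _ c h

lemma trace_hatBasis1_of_ne {d : Fin 2} (h : d ≠ A.par) (i j : ℕ) :
    A.trace (Ξ.hatBasis1 d i j) = 0 := by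
  funext t
  rw [trace_apply, inner_tangent, Ξ.hatBasis1_apply, if_neg h.symm, mul_zero, Pi.zero_apply]

lemma trace_mem_space1 {u : Plane → Plane} (hu : u ∈ Ξ.hatV1) : A.trace u ∈ Ξ.space1 A.flipPar := by
  induction hu using Submodule.span_induction with
  | mem u hu =>
    obtain ⟨⟨d, i, j⟩, rfl⟩ := hu
    rcases eq_or_ne d A.par with rfl | h
    · have h1 := A.hatBasis1_par Ξ (Ξ.idx1 A.flipPar i) (Ξ.idx0 A.flipPerp j)
      rw [Ξ.idx1_idx1 i.2, Ξ.idx0_idx0 (by omega)] at h1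
      simp only
      rw [h1, map_smul, trace_tang]
      exact Submodule.smul_mem _ _ (Submodule.smul_mem _ _
        (Ξ.lam1'_mem_space1 _ (Ξ.idx1_lt i.2)))
    · simp only [A.trace_hatBasis1_of_ne Ξ h]
      exact Submodule.zero_mem _
  | zero => rw [map_zero]; exact Submodule.zero_mem _
  | add u v _ _ hu hv => rw [map_add]; exact Submodule.add_mem _ hu hv
  | smul c u _ hu => rw [map_smul]; exact Submodule.smul_mem _ c hu

lemma ae_tCoord {P : ℝ → Prop} (h : ∀ᵐ t : ℝ, P t) :
    ∀ᵐ x ∂volume.restrict openSquare, P (A.tCoord x) := by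
  rw [← A.measurePreserving_prodMap.map_eq]
  refine ae_restrict_of_ae (A.measurableEmbedding_prodMap.ae_map_iff.2 ?_)
  simp only [prodMap, tCoord_point]
  exact Measure.quasiMeasurePreserving_fst.ae h

end Frame

namespace KnotVector

variable {p : ℕ} (Ξ : KnotVector p)

/-- Only the last basis function does not vanish at the end point `1`. -/
lemma lam0'_one (rev : Bool) {i : ℕ} (hi : i < Ξ.n) : Ξ.lam0' rev i 1 = 0 := by
  have h := Ξ.lam0'_zero (!rev) (i := Ξ.n - i) (by omega)
  rw [if_neg (by omega)] at h
  rw [← h]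
  cases rev
  · simp [lam0', show Ξ.n - (Ξ.n - i) = i by omega]
  · simp [lam0']

lemma l2Proj1_zero (rev : Bool) : Ξ.l2Proj1 rev 0 = 0 := by
  simpa using Ξ.l2Proj1_smul rev 0 0

end KnotVector

/-! ### The edge projections on the logical fields -/

lemma onPatch_self {K : Type*} (k : K) (u : Plane → Plane) : onPatch k u k = u := by
  classical
  simp [onPatch]

lemma onPatch_of_ne {K : Type*} {k l : K} (h : l ≠ k) (u : Plane → Plane) : onPatch k u l = 0 := by
  classical
  simp [onPatch, Pi.single_eq_of_ne h]

lemma onPatch_add {K : Type*} (k : K) (u v : Plane → Plane) :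
    onPatch k (u + v) = onPatch k u + onPatch k v := by
  classical exact Pi.single_add _ _ _

lemma onPatch_smul {K : Type*} (k : K) (c : ℝ) (u : Plane → Plane) :
    onPatch k (c • u) = c • onPatch k u := by
  classical exact Pi.single_smul _ _ _

lemma onPatch_zero {K : Type*} (k : K) : onPatch k 0 = 0 := by
  classical exact Pi.single_zero _

lemma sum_onPatch {K : Type*} [Fintype K] (u : K → Plane → Plane) :
    ∑ k, onPatch k (u k) = u := by
  classical
  unfold onPatch
  convert Finset.univ_sum_single u

namespace Multipatch

variable {K E : Type*} {p : ℕ} (M : Multipatch K E p) (e : E)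

/-- The tangential trace on the edge `e` from the side `σ`. -/
noncomputable def trace (σ : Bool) (u : K → Plane → Plane) : ℝ → ℝ :=
  (M.frame e σ).trace (u (M.patchOf e σ))

lemma trace_add (σ : Bool) (u v : K → Plane → Plane) :
    M.trace e σ (u + v) = M.trace e σ u + M.trace e σ v :=
  map_add (M.frame e σ).trace _ _

lemma trace_smul (σ : Bool) (c : ℝ) (u : K → Plane → Plane) :
    M.trace e σ (c • u) = c • M.trace e σ u :=
  map_smul (M.frame e σ).trace _ _

lemma trace_onPatch_self (σ : Bool) (u : Plane → Plane) :
    M.trace e σ (onPatch (M.patchOf e σ) u) = (M.frame e σ).trace u := by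
  rw [trace, onPatch_self]

lemma trace_onPatch_of_ne (σ : Bool) {k : K} (h : M.patchOf e σ ≠ k) (u : Plane → Plane) :
    M.trace e σ (onPatch k u) = 0 := by
  rw [trace, onPatch_of_ne h, map_zero]

lemma trace_mem_space1 (σ : Bool) {u : K → Plane → Plane} (hu : u ∈ M.broken) :
    M.trace e σ u ∈ (M.knots (M.patchOf e σ)).space1 (M.frame e σ).flipPar :=
  (M.frame e σ).trace_mem_space1 _ (M.mem_broken.1 hu _)

lemma trace_mem_bddMeas (σ : Bool) {u : K → Plane → Plane} (hu : u ∈ M.broken) :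
    M.trace e σ u ∈ bddMeas :=
  KnotVector.space1_le_bddMeas _ _ (M.trace_mem_space1 e σ hu)

/-- The `L²`-projection onto the parallel splines of the side `σ`. -/
noncomputable def proj (σ : Bool) (f : ℝ → ℝ) : ℝ → ℝ :=
  (M.knots (M.patchOf e σ)).l2Proj1 (M.frame e σ).flipPar f

lemma proj_mem (σ : Bool) (f : ℝ → ℝ) :
    M.proj e σ f ∈ (M.knots (M.patchOf e σ)).space1 (M.frame e σ).flipPar :=
  KnotVector.l2Proj1_mem _ _ _

lemma proj_mem_bddMeas (σ : Bool) (f : ℝ → ℝ) : M.proj e σ f ∈ bddMeas :=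
  KnotVector.space1_le_bddMeas _ _ (M.proj_mem e σ f)

lemma proj_add (σ : Bool) {f g : ℝ → ℝ} (hf : f ∈ bddMeas) (hg : g ∈ bddMeas) :
    M.proj e σ (f + g) = M.proj e σ f + M.proj e σ g := KnotVector.l2Proj1_add _ _ hf hg

lemma proj_smul (σ : Bool) (c : ℝ) (f : ℝ → ℝ) : M.proj e σ (c • f) = c • M.proj e σ f :=
  KnotVector.l2Proj1_smul _ _ _ _

lemma proj_zero (σ : Bool) : M.proj e σ 0 = 0 := KnotVector.l2Proj1_zero _ _

lemma proj_of_mem (hp : 1 ≤ p) (σ : Bool) {f : ℝ → ℝ}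
    (hf : f ∈ (M.knots (M.patchOf e σ)).space1 (M.frame e σ).flipPar) : M.proj e σ f = f :=
  KnotVector.l2Proj1_of_mem _ hp _ hf

/-- By nestedness, the splines of the coarse side are reproduced by the projections of both
sides. -/
lemma proj_ae_eq (hp : 1 ≤ p) (σ : Bool) {f : ℝ → ℝ}
    (hf : f ∈ (M.knots (M.patchOf e false)).space1 (M.frame e false).flipPar) :
    ∀ᵐ t : ℝ, M.proj e σ f t = f t := by
  cases σ
  · exact Filter.Eventually.of_forall fun t => by rw [M.proj_of_mem e hp false hf]
  · obtain ⟨g, hg, h⟩ := KnotVector.exists_ae_eq_mem_space1 _ hp (M.nested e) hf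
    have h1 : M.proj e true f = g := by
      rw [← M.proj_of_mem e hp true hg]
      exact KnotVector.l2Proj1_congr _ _ (ae_restrict_of_ae h)
    rw [h1]
    filter_upwards [h] with t ht using ht.symm

/-- The mean of the traces of the two sides in the coarse space. -/
noncomputable def meanTrace (u : K → Plane → Plane) : ℝ → ℝ :=
  (1 / 2 : ℝ) • (M.trace e false u + M.proj e false (M.trace e true u))

/-- Half of the jump of the traces in the coarse space. -/
noncomputable def halfJump (u : K → Plane → Plane) : ℝ → ℝ :=
  (1 / 2 : ℝ) • (M.trace e false u - M.proj e false (M.trace e true u))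

/-- The difference between the common trace and the trace of the side `σ`. -/
noncomputable def traceUpdate (σ : Bool) (u : K → Plane → Plane) : ℝ → ℝ :=
  M.proj e σ (M.meanTrace e u) - M.trace e σ u

/-- The sign of a side of an edge. -/
def sideSign (σ : Bool) : ℝ := if σ then -1 else 1

/-- The coefficient along the edge of the correction term on the side `σ`. -/
noncomputable def corrUpdate (σ : Bool) (u : K → Plane → Plane) : ℝ → ℝ :=
  sideSign σ • M.proj e σ (M.halfJump e u)

/-- The spline in the perpendicular direction which vanishes on the edge and has the same moments
of order `r` as the basis function which does not. -/
noncomputable def corrSum (r : ℕ) (σ : Bool) : ℝ → ℝ := ∑ m : Fin r,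
  (M.knots (M.patchOf e σ)).gamma (M.frame e σ).flipPerp r m • M.lamPerp e σ (m + 1)

lemma corr_eq (r : ℕ) (σ : Bool) : M.corr e r σ = (sideSign σ / 2) • M.corrSum e r σ := rfl

/-- The change of a broken logical field on the side `σ` of the edge `e`. -/
noncomputable def sideUpdate (r : ℕ) (σ : Bool) (u : K → Plane → Plane) : Plane → Plane :=
  (M.frame e σ).tang (M.traceUpdate e σ u) (M.lamPerp e σ 0) +
    (M.frame e σ).tang (M.corrUpdate e σ u) (M.corrSum e r σ)

/-- The change of a broken logical field under the edge projection. -/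
noncomputable def edgeUpdate (r : ℕ) (u : K → Plane → Plane) : K → Plane → Plane :=
  ∑ σ : Bool, onPatch (M.patchOf e σ) (M.sideUpdate e r σ u)

lemma sum_onPatch_apply (w : Bool → Plane → Plane) (σ : Bool) :
    (∑ σ : Bool, onPatch (M.patchOf e σ) (w σ)) (M.patchOf e σ) = w σ := by
  cases σ
  · simp [onPatch_self, onPatch_of_ne (M.patchOf_ne e)]
  · simp [onPatch_self, onPatch_of_ne (M.patchOf_ne e).symm]

lemma sum_onPatch_apply_of_ne (w : Bool → Plane → Plane) {k : K} (h : ∀ σ, k ≠ M.patchOf e σ) :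
    (∑ σ : Bool, onPatch (M.patchOf e σ) (w σ)) k = 0 := by
  simp [onPatch_of_ne (h false), onPatch_of_ne (h true)]

lemma lamPerp_mem_space0 (σ : Bool) {j : ℕ} (hj : j ≤ (M.knots (M.patchOf e σ)).n) :
    M.lamPerp e σ j ∈ (M.knots (M.patchOf e σ)).space0 (M.frame e σ).flipPerp :=
  KnotVector.lam0'_mem_space0 _ _ hj

variable {r : ℕ} (hp : 1 ≤ p) (hr : r ≤ p)

include hr in
lemma corrSum_mem_space0 (σ : Bool) : M.corrSum e r σ ∈
    (M.knots (M.patchOf e σ)).space0 (M.frame e σ).flipPerp := by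
  have := (M.knots (M.patchOf e σ)).three_cells
  exact Submodule.sum_mem _ fun m _ => Submodule.smul_mem _ _
    (M.lamPerp_mem_space0 e σ (by omega))

include hr in
lemma corrSum_zero (σ : Bool) : M.corrSum e r σ 0 = 0 := by
  have := (M.knots (M.patchOf e σ)).three_cells
  rw [corrSum, Finset.sum_apply]
  refine Finset.sum_eq_zero fun m _ => ?_
  rw [Pi.smul_apply, lamPerp, KnotVector.lam0'_zero _ _ (by omega), if_neg (by omega), smul_zero]

include hr in
lemma corrSum_one (σ : Bool) : M.corrSum e r σ 1 = 0 := by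
  have := (M.knots (M.patchOf e σ)).three_cells
  rw [corrSum, Finset.sum_apply]
  refine Finset.sum_eq_zero fun m _ => ?_
  rw [Pi.smul_apply, lamPerp, KnotVector.lam0'_one _ _ (by omega), smul_zero]

lemma lamPerp_zero_zero (σ : Bool) : M.lamPerp e σ 0 0 = 1 := by
  rw [lamPerp, KnotVector.lam0'_zero _ _ (Nat.zero_le _), if_pos rfl]

lemma lamPerp_zero_one (σ : Bool) : M.lamPerp e σ 0 1 = 0 := by
  have := (M.knots (M.patchOf e σ)).three_cells
  exact KnotVector.lam0'_one _ _ (by omega)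

lemma traceUpdate_mem (σ : Bool) {u : K → Plane → Plane} (hu : u ∈ M.broken) :
    M.traceUpdate e σ u ∈ (M.knots (M.patchOf e σ)).space1 (M.frame e σ).flipPar :=
  Submodule.sub_mem _ (M.proj_mem e σ _) (M.trace_mem_space1 e σ hu)

lemma corrUpdate_mem (σ : Bool) (u : K → Plane → Plane) :
    M.corrUpdate e σ u ∈ (M.knots (M.patchOf e σ)).space1 (M.frame e σ).flipPar :=
  Submodule.smul_mem _ _ (M.proj_mem e σ _)

include hr in
lemma edgeUpdate_mem_broken {u : K → Plane → Plane} (hu : u ∈ M.broken) :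
    M.edgeUpdate e r u ∈ M.broken := by
  refine Submodule.sum_mem _ fun σ _ => M.onPatch_mem_broken (Submodule.add_mem _ ?_ ?_)
  · exact Frame.tang_mem_hatV1 _ _ (M.traceUpdate_mem e σ hu)
      (M.lamPerp_mem_space0 e σ (Nat.zero_le _))
  · exact Frame.tang_mem_hatV1 _ _ (M.corrUpdate_mem e σ u) (M.corrSum_mem_space0 e hr σ)

lemma meanTrace_mem {u : K → Plane → Plane} (hu : u ∈ M.broken) :
    M.meanTrace e u ∈ (M.knots (M.patchOf e false)).space1 (M.frame e false).flipPar :=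
  Submodule.smul_mem _ _ (Submodule.add_mem _ (M.trace_mem_space1 e false hu) (M.proj_mem e _ _))

lemma halfJump_mem {u : K → Plane → Plane} (hu : u ∈ M.broken) :
    M.halfJump e u ∈ (M.knots (M.patchOf e false)).space1 (M.frame e false).flipPar :=
  Submodule.smul_mem _ _ (Submodule.sub_mem _ (M.trace_mem_space1 e false hu) (M.proj_mem e _ _))

lemma meanTrace_add {u v : K → Plane → Plane} (hu : u ∈ M.broken) (hv : v ∈ M.broken) :
    M.meanTrace e (u + v) = M.meanTrace e u + M.meanTrace e v := by
  rw [meanTrace, trace_add, trace_add, M.proj_add e false (M.trace_mem_bddMeas e true hu)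
    (M.trace_mem_bddMeas e true hv), meanTrace, meanTrace]
  module

lemma halfJump_add {u v : K → Plane → Plane} (hu : u ∈ M.broken) (hv : v ∈ M.broken) :
    M.halfJump e (u + v) = M.halfJump e u + M.halfJump e v := by
  rw [halfJump, trace_add, trace_add, M.proj_add e false (M.trace_mem_bddMeas e true hu)
    (M.trace_mem_bddMeas e true hv), halfJump, halfJump]
  module

lemma meanTrace_smul (c : ℝ) (u : K → Plane → Plane) :
    M.meanTrace e (c • u) = c • M.meanTrace e u := by
  rw [meanTrace, trace_smul, trace_smul, proj_smul, meanTrace]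
  module

lemma halfJump_smul (c : ℝ) (u : K → Plane → Plane) :
    M.halfJump e (c • u) = c • M.halfJump e u := by
  rw [halfJump, trace_smul, trace_smul, proj_smul, halfJump]
  module

lemma edgeUpdate_add {u v : K → Plane → Plane} (hu : u ∈ M.broken) (hv : v ∈ M.broken) :
    M.edgeUpdate e r (u + v) = M.edgeUpdate e r u + M.edgeUpdate e r v := by
  have key : ∀ σ, M.sideUpdate e r σ (u + v) = M.sideUpdate e r σ u + M.sideUpdate e r σ v := by
    intro σ
    have h1 : M.traceUpdate e σ (u + v) = M.traceUpdate e σ u + M.traceUpdate e σ v := by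
      rw [traceUpdate, M.meanTrace_add e hu hv, M.trace_add, M.proj_add e σ
        (KnotVector.space1_le_bddMeas _ _ (M.meanTrace_mem e hu))
        (KnotVector.space1_le_bddMeas _ _ (M.meanTrace_mem e hv)), traceUpdate, traceUpdate]
      module
    have h2 : M.corrUpdate e σ (u + v) = M.corrUpdate e σ u + M.corrUpdate e σ v := by
      rw [corrUpdate, M.halfJump_add e hu hv, M.proj_add e σ
        (KnotVector.space1_le_bddMeas _ _ (M.halfJump_mem e hu))
        (KnotVector.space1_le_bddMeas _ _ (M.halfJump_mem e hv)), smul_add]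
      rfl
    rw [sideUpdate, h1, h2, Frame.tang_add_left, Frame.tang_add_left, sideUpdate, sideUpdate]
    abel
  simp only [edgeUpdate, key, onPatch_add, Finset.sum_add_distrib]

lemma edgeUpdate_smul (c : ℝ) (u : K → Plane → Plane) :
    M.edgeUpdate e r (c • u) = c • M.edgeUpdate e r u := by
  have key : ∀ σ, M.sideUpdate e r σ (c • u) = c • M.sideUpdate e r σ u := by
    intro σ
    have h1 : M.traceUpdate e σ (c • u) = c • M.traceUpdate e σ u := by
      rw [traceUpdate, M.meanTrace_smul, M.trace_smul, M.proj_smul, traceUpdate]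
      module
    have h2 : M.corrUpdate e σ (c • u) = c • M.corrUpdate e σ u := by
      rw [corrUpdate, M.halfJump_smul, M.proj_smul, corrUpdate]
      module
    rw [sideUpdate, h1, h2, Frame.tang_smul_left, Frame.tang_smul_left, sideUpdate, smul_add]
  simp only [edgeUpdate, key, onPatch_smul, Finset.smul_sum]

lemma edgeUpdate_of_trace_eq_zero {u : K → Plane → Plane} (h : ∀ σ, M.trace e σ u = 0) :
    M.edgeUpdate e r u = 0 := by
  have h1 : M.meanTrace e u = 0 := by simp [meanTrace, h, proj_zero]
  have h2 : M.halfJump e u = 0 := by simp [halfJump, h, proj_zero]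
  have key : ∀ σ, M.sideUpdate e r σ u = 0 := by
    intro σ
    have h3 : M.traceUpdate e σ u = 0 := by simp [traceUpdate, h1, h, proj_zero]
    have h4 : M.corrUpdate e σ u = 0 := by simp [corrUpdate, h2, proj_zero]
    rw [sideUpdate, h3, h4, Frame.tang_zero_left, Frame.tang_zero_left, add_zero]
  simp [edgeUpdate, key, onPatch_zero]

/-- Fields which are written by the update at `e'` have no trace on another edge `e`. -/
lemma trace_onPatch_tang {e e' : E} (hne : e ≠ e') (σ σ' : Bool) (f : ℝ → ℝ) {g : ℝ → ℝ}
    (hg : g 1 = 0) :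
    M.trace e σ (onPatch (M.patchOf e' σ') ((M.frame e' σ').tang f g)) = 0 := by
  by_cases hk : M.patchOf e σ = M.patchOf e' σ'
  · rw [← hk, trace_onPatch_self]
    by_cases hpar : (M.frame e σ).par = (M.frame e' σ').par
    · by_cases hperp : (M.frame e σ).flipPerp = (M.frame e' σ').flipPerp
      · exact absurd (M.side_injective hk hpar hperp).1 hne
      · exact Frame.trace_tang_opposite _ hpar hperp f hg
    · exact Frame.trace_tang_of_par_ne _ hpar f g
  · exact M.trace_onPatch_of_ne e σ hk _

include hr in
lemma trace_edgeUpdate_of_ne {e e' : E} (hne : e ≠ e') (σ : Bool) (u : K → Plane → Plane) :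
    M.trace e σ (M.edgeUpdate e' r u) = 0 := by
  have key : ∀ σ', M.trace e σ (onPatch (M.patchOf e' σ') (M.sideUpdate e' r σ' u)) = 0 := by
    intro σ'
    rw [sideUpdate, onPatch_add, trace_add, M.trace_onPatch_tang hne _ _ _ (M.lamPerp_zero_one e' σ'),
      M.trace_onPatch_tang hne _ _ _ (M.corrSum_one e' hr σ'), add_zero]
  rw [edgeUpdate, Fintype.sum_bool, trace_add, key, key, add_zero]

include hr in
/-- After the update, the trace on the edge is the mean of the traces. -/
lemma trace_add_edgeUpdate (σ : Bool) (u : K → Plane → Plane) :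
    M.trace e σ (u + M.edgeUpdate e r u) = M.proj e σ (M.meanTrace e u) := by
  rw [trace_add]
  have : M.trace e σ (M.edgeUpdate e r u) = M.traceUpdate e σ u := by
    rw [trace, edgeUpdate, sum_onPatch_apply, sideUpdate, map_add, Frame.trace_tang,
      Frame.trace_tang, lamPerp_zero_zero, M.corrSum_zero e hr]
    simp
  rw [this, traceUpdate]
  abel

include hp in
/-- Fields with a continuous trace are not changed. -/
lemma edgeUpdate_eq_zero {u : K → Plane → Plane} (hu : u ∈ M.broken)
    (h : ∀ᵐ t ∂volume.restrict (Ioo (0 : ℝ) 1), M.trace e false u t = M.trace e true u t) :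
    M.edgeUpdate e r u = 0 := by
  have h0 : M.proj e false (M.trace e true u) = M.trace e false u := by
    rw [← M.proj_of_mem e hp false (M.trace_mem_space1 e false hu)]
    exact (KnotVector.l2Proj1_congr _ _ h).symm
  have h1 : M.meanTrace e u = M.trace e false u := by
    rw [meanTrace, h0]
    module
  have h2 : M.halfJump e u = 0 := by simp [halfJump, h0]
  have h3 : ∀ σ, M.proj e σ (M.trace e false u) = M.trace e σ u := by
    intro σ
    rw [← M.proj_of_mem e hp σ (M.trace_mem_space1 e σ hu)]
    cases σ
    · rw [M.proj_of_mem e hp false (M.trace_mem_space1 e false hu)]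
    · rw [M.proj_of_mem e hp true (M.trace_mem_space1 e true hu)]
      rw [← M.proj_of_mem e hp true (M.trace_mem_space1 e true hu)]
      exact KnotVector.l2Proj1_congr _ _ h
  have key : ∀ σ, M.sideUpdate e r σ u = 0 := by
    intro σ
    have h5 : M.traceUpdate e σ u = 0 := by rw [traceUpdate, h1, h3, sub_self]
    have h4 : M.corrUpdate e σ u = 0 := by simp [corrUpdate, h2, proj_zero]
    rw [sideUpdate, h5, h4, Frame.tang_zero_left, Frame.tang_zero_left, add_zero]
  simp [edgeUpdate, key, onPatch_zero]

/-- The edge projection on the broken logical fields. -/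
noncomputable def edgeOp : M.broken →ₗ[ℝ] M.broken where
  toFun u := ⟨u + M.edgeUpdate e r u, Submodule.add_mem _ u.2 (M.edgeUpdate_mem_broken e hr u.2)⟩
  map_add' u v := by
    refine Subtype.ext ?_
    simp only [Submodule.coe_add, M.edgeUpdate_add e u.2 v.2]
    abel
  map_smul' c u := by
    refine Subtype.ext ?_
    simp only [Submodule.coe_smul, M.edgeUpdate_smul, RingHom.id_apply, smul_add]

lemma coe_edgeOp (u : M.broken) :
    (M.edgeOp e hr u : K → Plane → Plane) = u + M.edgeUpdate e r u := rfl

/-- The update at `e` does not see the update at another edge, since that one does not change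
the traces on `e`. -/
lemma edgeUpdate_edgeOp {e e' : E} (hne : e ≠ e') (u : M.broken) :
    M.edgeUpdate e r (M.edgeOp e' hr u : K → Plane → Plane) = M.edgeUpdate e r u := by
  rw [coe_edgeOp, M.edgeUpdate_add e u.2 (M.edgeUpdate_mem_broken e' hr u.2),
    M.edgeUpdate_of_trace_eq_zero e fun σ => M.trace_edgeUpdate_of_ne hr hne σ _, add_zero]

lemma edgeOp_comm (e e' : E) (u : M.broken) :
    M.edgeOp e hr (M.edgeOp e' hr u) = M.edgeOp e' hr (M.edgeOp e hr u) := by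
  rcases eq_or_ne e e' with rfl | hne
  · rfl
  · refine Subtype.ext ?_
    rw [coe_edgeOp, M.edgeUpdate_edgeOp hr hne, coe_edgeOp, coe_edgeOp,
      M.edgeUpdate_edgeOp hr hne.symm, coe_edgeOp]
    abel

end Multipatch

/-! ### The edge projections on the broken space -/

namespace Multipatch

variable {K E : Type*} {p : ℕ} (M : Multipatch K E p) (e : E)

lemma IsPush.congr {M : Multipatch K E p} {v : Plane → Plane} {u u' : K → Plane → Plane}
    (h : M.IsPush v u) (huu : ∀ k, ∀ᵐ x ∂volume.restrict openSquare, u k x = u' k x) :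
    M.IsPush v u' := by
  rw [isPush_iff] at h ⊢
  intro k
  filter_upwards [h k, huu k] with x hx hx'
  rw [hx, hx']

lemma lamPar_mem_space1 (σ : Bool) {i : ℕ} (hi : i < (M.knots (M.patchOf e σ)).n) :
    M.lamPar e σ i ∈ (M.knots (M.patchOf e σ)).space1 (M.frame e σ).flipPar :=
  KnotVector.lam1'_mem_space1 _ _ hi

lemma edgeBasis_mem_broken (σ : Bool) {i j : ℕ} (hi : i < (M.knots (M.patchOf e σ)).n)
    (hj : j ≤ (M.knots (M.patchOf e σ)).n) : M.edgeBasis e σ i j ∈ M.broken :=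
  M.onPatch_mem_broken (Frame.tang_mem_hatV1 _ _ (M.lamPar_mem_space1 e σ hi)
    (M.lamPerp_mem_space0 e σ hj))

variable {r : ℕ} (hp : 1 ≤ p) (hr : r ≤ p)

include hp in
/-- The image of a tangential field which does not vanish on the edge. The two sides agree only
almost everywhere, since the coarse splines along the edge are reproduced on the fine side only up
to their values at the knots. -/
lemma ae_edgeUpdate_onPatch (τ : Bool) {l : ℝ → ℝ}
    (hl : l ∈ (M.knots (M.patchOf e τ)).space1 (M.frame e τ).flipPar) (k : K) :
    ∀ᵐ x ∂volume.restrict openSquare,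
      (onPatch (M.patchOf e τ) ((M.frame e τ).tang l (M.lamPerp e τ 0)) +
        M.edgeUpdate e r (onPatch (M.patchOf e τ) ((M.frame e τ).tang l (M.lamPerp e τ 0)))) k x =
      M.edgeField e (M.proj e false l) (M.lamBar e + sideSign τ • M.corr e r) k x := by
  set u := onPatch (M.patchOf e τ) ((M.frame e τ).tang l (M.lamPerp e τ 0)) with hu
  -- the field lives on the side `τ`, so that only the trace of this side does not vanish
  have htr : M.trace e τ u = l := by
    rw [hu, trace_onPatch_self, Frame.trace_tang, lamPerp_zero_zero, one_smul]
  have htr' : M.trace e (!τ) u = 0 := by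
    have := M.patchOf_ne' e (!τ)
    rw [Bool.not_not] at this
    exact M.trace_onPatch_of_ne e _ this _
  have hval : ∀ σ, u (M.patchOf e σ) = (M.frame e σ).tang (M.trace e σ u) (M.lamPerp e σ 0) := by
    intro σ
    rcases Bool.eq_or_eq_not σ τ with rfl | rfl
    · rw [htr, hu, onPatch_self]
    · rw [htr', Frame.tang_zero_left, hu]
      have := M.patchOf_ne' e (!τ)
      rw [Bool.not_not] at this
      exact onPatch_of_ne this _
  by_cases hk : ∃ σ, k = M.patchOf e σ
  · obtain ⟨σ, rfl⟩ := hk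
    have h1 : M.edgeField e (M.proj e false l) (M.lamBar e + sideSign τ • M.corr e r)
        (M.patchOf e σ) = (M.frame e σ).tang (M.proj e false l)
        ((M.lamBar e + sideSign τ • M.corr e r) σ) := by
      rw [edgeField, sum_onPatch_apply]
    have h2 : M.meanTrace e u = (1 / 2 : ℝ) • M.proj e false l ∧
        M.halfJump e u = (sideSign τ / 2) • M.proj e false l := by
      cases τ
      · rw [Bool.not_false] at htr'
        rw [meanTrace, halfJump, htr, htr', proj_zero, M.proj_of_mem e hp false hl]
        simp [sideSign]
      · rw [Bool.not_true] at htr'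
        rw [meanTrace, halfJump, htr, htr']
        simp [sideSign, neg_div]
    have h3 := (M.frame e σ).ae_tCoord (M.proj_ae_eq e hp σ (M.proj_mem e false l))
    filter_upwards [h3] with x hx
    rw [h1, Pi.add_apply, Pi.add_apply, hval, edgeUpdate, sum_onPatch_apply, sideUpdate,
      traceUpdate, corrUpdate, h2.1, h2.2, M.proj_smul, M.proj_smul]
    simp only [Pi.add_apply, Pi.sub_apply, Pi.smul_apply, Frame.tang_apply, smul_eq_mul, hx,
      ← add_smul, corr_eq, lamBar]
    congr 1
    ring
  · push Not at hk
    refine Filter.Eventually.of_forall fun x => ?_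
    rw [edgeField, M.sum_onPatch_apply_of_ne e _ hk, edgeUpdate, Pi.add_apply,
      M.sum_onPatch_apply_of_ne e _ hk, hu, onPatch_of_ne (hk τ), add_zero]

section Projection

variable [Fintype K]

/-- The edge projection on the broken space. -/
noncomputable def edgeProj : M.V1pw →ₗ[ℝ] M.V1pw :=
  (M.logical hp).symm.toLinearMap ∘ₗ M.edgeOp e hr ∘ₗ (M.logical hp).toLinearMap

lemma logical_edgeProj (v : M.V1pw) :
    M.logical hp (M.edgeProj e hp hr v) = M.edgeOp e hr (M.logical hp v) := by
  simp [edgeProj]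

lemma edgeProj_comm (e e' : E) :
    M.edgeProj e hp hr ∘ₗ M.edgeProj e' hp hr = M.edgeProj e' hp hr ∘ₗ M.edgeProj e hp hr := by
  refine LinearMap.ext fun v => (M.logical hp).injective ?_
  simp only [LinearMap.comp_apply, logical_edgeProj, M.edgeOp_comm hr e e']

lemma edgeProj_eq_self {v : M.V1pw} {u : K → Plane → Plane} (hu : u ∈ M.broken)
    (h : M.IsPush v u) (h0 : M.edgeUpdate e r u = 0) : M.edgeProj e hp hr v = v := by
  refine (M.logical hp).injective (Subtype.ext ?_)
  rw [logical_edgeProj, coe_edgeOp, (M.isPush_iff_logical hp hu).1 h, h0, add_zero]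

lemma isPush_edgeProj {v : M.V1pw} {u : K → Plane → Plane} (hu : u ∈ M.broken)
    (h : M.IsPush v u) : M.IsPush (M.edgeProj e hp hr v) (u + M.edgeUpdate e r u) := by
  have := M.isPush_logical hp (M.edgeProj e hp hr v)
  rwa [logical_edgeProj, coe_edgeOp, (M.isPush_iff_logical hp hu).1 h] at this

lemma isEdgeProjection_edgeProj : M.IsEdgeProjection e r (M.edgeProj e hp hr) where
  coarse i hi v hv := by
    have h1 := M.isPush_edgeProj e hp hr (M.edgeBasis_mem_broken e false hi (Nat.zero_le _)) hv
    have h2 := h1.congr (M.ae_edgeUpdate_onPatch e hp false (M.lamPar_mem_space1 e false hi))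
    rw [M.proj_of_mem e hp false (M.lamPar_mem_space1 e false hi)] at h2
    simpa [sideSign] using h2
  fine i hi v hv := by
    have h1 := M.isPush_edgeProj e hp hr (M.edgeBasis_mem_broken e true hi (Nat.zero_le _)) hv
    have h2 := h1.congr (M.ae_edgeUpdate_onPatch e hp true (M.lamPar_mem_space1 e true hi))
    change M.IsPush _ (M.edgeField e (M.proj e false (M.lamPar e true i)) _)
    simpa [sideSign, ← sub_eq_add_neg] using h2
  tangential σ i hi j hj v hv := by
    refine M.edgeProj_eq_self e hp hr (M.edgeBasis_mem_broken e σ hi hj.2) hv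
      (M.edgeUpdate_of_trace_eq_zero e fun σ' => ?_)
    rcases Bool.eq_or_eq_not σ' σ with rfl | rfl
    · rw [edgeBasis, trace_onPatch_self, Frame.trace_tang, lamPerp, KnotVector.lam0'_zero _ _ hj.2,
        if_neg (by have := hj.1; omega), zero_smul]
    · exact M.trace_onPatch_of_ne e _ (by simpa using M.patchOf_ne' e (!σ)) _
  normal σ i hi j hj v hv := by
    refine M.edgeProj_eq_self e hp hr
      (M.onPatch_mem_broken (KnotVector.hatBasis1_mem_hatV1 _ _ hi hj)) hv
      (M.edgeUpdate_of_trace_eq_zero e fun σ' => ?_)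
    rcases Bool.eq_or_eq_not σ' σ with rfl | rfl
    · rw [trace_onPatch_self, Frame.trace_hatBasis1_of_ne _ _ (Fin.rev_ne_self_two _)]
    · exact M.trace_onPatch_of_ne e _ (by simpa using M.patchOf_ne' e (!σ)) _
  other k hk d i hi j hj v hv :=
    M.edgeProj_eq_self e hp hr
      (M.onPatch_mem_broken (KnotVector.hatBasis1_mem_hatV1 _ _ hi hj)) hv
      (M.edgeUpdate_of_trace_eq_zero e fun σ => M.trace_onPatch_of_ne e σ (hk σ).symm _)

/-- The fields which are pushed forward from a basis field of one patch. -/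
def basisFields : Set M.V1pw := {v | ∃ k d, ∃ i < (M.knots k).n, ∃ j ≤ (M.knots k).n,
  M.IsPush v (onPatch k ((M.knots k).hatBasis1 d i j))}

include hp in
/-- The fields which come from the basis fields span the broken space. -/
lemma span_basisFields : Submodule.span ℝ M.basisFields = ⊤ := by
  refine eq_top_iff.2 fun v _ => ?_
  have key : ∀ k, ∀ w (hw : w ∈ (M.knots k).hatV1),
      (M.logical hp).symm ⟨onPatch k w, M.onPatch_mem_broken hw⟩ ∈
        Submodule.span ℝ M.basisFields := by
    intro k w hw
    unfold KnotVector.hatV1 at hw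
    induction hw using Submodule.span_induction with
    | mem w hw' =>
      obtain ⟨⟨d, i, j⟩, rfl⟩ := hw'
      refine Submodule.subset_span ⟨k, d, i, i.2, j, by omega, ?_⟩
      rw [M.isPush_iff_logical hp (M.onPatch_mem_broken
        (KnotVector.hatBasis1_mem_hatV1 _ _ i.2 (by omega)))]
      simp
    | zero =>
      convert Submodule.zero_mem _
      rw [LinearEquiv.map_eq_zero_iff]
      exact Subtype.ext (onPatch_zero k)
    | add w w' hw hw' h h' =>
      convert Submodule.add_mem _ h h'
      rw [← map_add]
      congr 1
      exact Subtype.ext (onPatch_add k w w')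
    | smul c w hw h =>
      convert Submodule.smul_mem _ c h
      rw [← map_smul]
      congr 1
      exact Subtype.ext (onPatch_smul k c w)
  have hv : v = ∑ k, (M.logical hp).symm ⟨onPatch k ((M.logical hp v : K → Plane → Plane) k),
      M.onPatch_mem_broken (M.mem_broken.1 (M.logical hp v).2 k)⟩ := by
    rw [← map_sum, LinearEquiv.eq_symm_apply]
    refine Subtype.ext ?_
    rw [AddSubmonoidClass.coe_finsetSum]
    exact (sum_onPatch _).symm
  rw [hv]
  exact Submodule.sum_mem _ fun k _ => key k _ (M.mem_broken.1 (M.logical hp v).2 k)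

include hp in
/-- The values on the basis fields determine the edge projection. -/
lemma IsEdgeProjection.unique {M : Multipatch K E p} {e : E} {T T' : M.V1pw →ₗ[ℝ] M.V1pw}
    (h : M.IsEdgeProjection e r T) (h' : M.IsEdgeProjection e r T') : T = T' := by
  refine LinearMap.ext_on (M.span_basisFields hp) ?_
  rintro v ⟨k, d, i, hi, j, hj, hv⟩
  by_cases hk : ∃ σ, k = M.patchOf e σ
  · obtain ⟨σ, rfl⟩ := hk
    set A := M.frame e σ with hA
    set Ξ := M.knots (M.patchOf e σ) with hΞ
    -- up to sign and numbering, the basis fields of the square are those of the edge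
    by_cases hd : d = A.par
    · subst hd
      have h1 : A.tang (Ξ.lam1' A.flipPar (Ξ.idx1 A.flipPar i))
          (Ξ.lam0' A.flipPerp (Ξ.idx0 A.flipPerp j)) =
          flipSign A.flipPar • Ξ.hatBasis1 A.par i j := by
        rw [A.tang_basis_eq, Ξ.idx1_idx1 hi, Ξ.idx0_idx0 hj]
      have hv' : M.IsPush (flipSign A.flipPar • v : M.V1pw)
          (M.edgeBasis e σ (Ξ.idx1 A.flipPar i) (Ξ.idx0 A.flipPerp j)) := by
        rw [edgeBasis, lamPar, lamPerp, ← hA, ← hΞ, h1, onPatch_smul]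
        rw [M.isPush_iff_logical hp (Submodule.smul_mem _ _
          (M.onPatch_mem_broken (Ξ.hatBasis1_mem_hatV1 _ hi hj))), map_smul, Submodule.coe_smul,
          (M.isPush_iff_logical hp (M.onPatch_mem_broken (Ξ.hatBasis1_mem_hatV1 _ hi hj))).1 hv]
      have hi' : Ξ.idx1 A.flipPar i < Ξ.n := Ξ.idx1_lt hi
      have hj' : Ξ.idx0 A.flipPerp j ≤ Ξ.n := Ξ.idx0_le hj
      have hT : T (flipSign A.flipPar • v) = T' (flipSign A.flipPar • v) := by
        rcases Nat.eq_zero_or_pos (Ξ.idx0 A.flipPerp j) with h0 | h0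
        · rw [h0] at hv'
          cases σ
          · exact Subtype.ext (M.eq_of_isPush (h.coarse _ hi' _ hv') (h'.coarse _ hi' _ hv'))
          · exact Subtype.ext (M.eq_of_isPush (h.fine _ hi' _ hv') (h'.fine _ hi' _ hv'))
        · rw [h.tangential σ _ hi' _ ⟨h0, hj'⟩ _ hv', h'.tangential σ _ hi' _ ⟨h0, hj'⟩ _ hv']
      rw [map_smul, map_smul] at hT
      have := congrArg (flipSign A.flipPar • ·) hT
      simpa only [smul_smul, flipSign_mul_self, one_smul] using this
    · have hd' : d = A.par.rev := by
        revert hd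
        generalize A.par = a
        fin_cases a <;> fin_cases d <;> simp
      subst hd'
      rw [h.normal σ i hi j hj v hv, h'.normal σ i hi j hj v hv]
  · push Not at hk
    rw [h.other k hk d i hi j hj v hv, h'.other k hk d i hi j hj v hv]

lemma tangentiallyContinuous_iff {v : M.V1pw} : M.TangentiallyContinuous e v ↔
    ∀ᵐ t ∂volume.restrict (Icc (0 : ℝ) 1), M.trace e false (M.logical hp v : K → Plane → Plane) t =
      M.trace e true (M.logical hp v : K → Plane → Plane) t := by
  constructor
  · intro h
    exact h _ (M.mem_broken.1 (M.logical hp v).2) (M.isPush_logical hp v)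
  · intro h u hu huv
    rw [(M.isPush_iff_logical hp (M.mem_broken.2 hu)).1 huv] at h
    exact h

/-- The edge projection makes the tangential component continuous. -/
lemma tangentiallyContinuous_edgeProj (v : M.V1pw) :
    M.TangentiallyContinuous e (M.edgeProj e hp hr v) := by
  rw [M.tangentiallyContinuous_iff e hp, logical_edgeProj, coe_edgeOp]
  have h := M.meanTrace_mem e (M.logical hp v).2
  refine ae_restrict_of_ae ?_
  filter_upwards [M.proj_ae_eq e hp false h, M.proj_ae_eq e hp true h] with t h1 h2
  rw [M.trace_add_edgeUpdate e hr, M.trace_add_edgeUpdate e hr, h1, h2]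

lemma edgeProj_of_tangentiallyContinuous {v : M.V1pw} (h : M.TangentiallyContinuous e v) :
    M.edgeProj e hp hr v = v := by
  rw [M.tangentiallyContinuous_iff e hp] at h
  exact M.edgeProj_eq_self e hp hr (M.logical hp v).2 (M.isPush_logical hp v)
    (M.edgeUpdate_eq_zero e hp (M.logical hp v).2 (ae_restrict_of_ae_restrict_of_subset
      Ioo_subset_Icc_self h))

end Projection

end Multipatch

/-! ### Moments -/

lemma BddOnSquare.of_continuous {H : Type*} [NormedAddCommGroup H] [MeasurableSpace H]
    [BorelSpace H] {f : Plane → H} (hf : Continuous f) : BddOnSquare f := by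
  obtain ⟨C, hC⟩ := isCompact_closedSquare.exists_bound_of_continuousOn hf.continuousOn
  exact ⟨hf.measurable, C, fun x hx => hC x (openSquare_subset hx)⟩

lemma BddOnSquare.coord {u : Plane → Plane} (hu : BddOnSquare u) (d : Fin 2) :
    BddOnSquare fun x => u x d := by
  obtain ⟨h, C, hC⟩ := hu
  exact ⟨(by fun_prop : Measurable fun y : Plane => y d).comp h, C,
    fun x hx => (PiLp.norm_apply_le (u x) d).trans (hC x hx)⟩

lemma continuous_mvPolynomial_eval (q : MvPolynomial (Fin 2) ℝ) :
    Continuous fun x : Plane => MvPolynomial.eval (fun i => x i) q :=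
  (MvPolynomial.continuous_eval q).comp (by fun_prop : Continuous fun x : Plane => fun i => x i)

open Polynomial in
lemma exists_degreeLT_eval_eq_flipIf_pow (b : Bool) {i r : ℕ} (hi : i < r) :
    ∃ q ∈ degreeLT ℝ r, ∀ t, q.eval t = flipIf b t ^ i := by
  have h : (X ^ i : ℝ[X]) ∈ degreeLT ℝ r :=
    mem_degreeLT.2 ((degree_X_pow_le i).trans_lt (by exact_mod_cast hi))
  cases b
  · exact ⟨X ^ i, h, fun t => by simp [flipIf]⟩
  · exact ⟨_, comp_one_sub_mem_degreeLT h, fun t => by simp [flipIf]⟩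

lemma bddMeas.eval_mem (q : Polynomial ℝ) : (fun t => q.eval t) ∈ bddMeas :=
  bddMeas.of_continuous q.continuous

lemma bddMeas.intervalIntegrable_mul {f g : ℝ → ℝ} (hf : f ∈ bddMeas) (hg : g ∈ bddMeas) :
    IntervalIntegrable (fun t => f t * g t) volume 0 1 :=
  bddMeas.intervalIntegrable (bddMeas.mul_mem hf hg)

namespace Multipatch

variable {K E : Type*} {p : ℕ} (M : Multipatch K E p) (e : E)
variable {r : ℕ} (hp : 1 ≤ p) (hr : r ≤ p)

include hp hr in
/-- The projection along the edge preserves moments, since the polynomials of degree `< p` are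
splines. -/
lemma integral_proj_mul_eval (σ : Bool) {f : ℝ → ℝ} (hf : f ∈ bddMeas) {q : Polynomial ℝ}
    (hq : q ∈ Polynomial.degreeLT ℝ r) :
    ∫ t in (0 : ℝ)..1, M.proj e σ f t * q.eval t = ∫ t in (0 : ℝ)..1, f t * q.eval t := by
  obtain ⟨g, hg, hgq⟩ := KnotVector.exists_mem_space1_eq_eval (M.knots (M.patchOf e σ)) hp
    (M.frame e σ).flipPar (Polynomial.degreeLT_mono hr hq)
  have key : ∀ h : ℝ → ℝ, ∫ t in (0 : ℝ)..1, h t * q.eval t = ∫ t in (0 : ℝ)..1, g t * h t :=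
    fun h => by
      refine intervalIntegral_congr_Ioo ?_
      filter_upwards [ae_restrict_mem measurableSet_Ioo] with t ht
      rw [hgq t ht, mul_comm]
  rw [key, key]
  exact KnotVector.integral_mul_l2Proj1 _ hp _ hf hg

/-- The moments of the two coefficients along the edge cancel. -/
lemma integral_update_mul_eval (hp : 1 ≤ p) (hr : r ≤ p) (σ : Bool) {u : K → Plane → Plane}
    (hu : u ∈ M.broken) {q : Polynomial ℝ} (hq : q ∈ Polynomial.degreeLT ℝ r) :
    (∫ t in (0 : ℝ)..1, M.traceUpdate e σ u t * q.eval t) +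
      ∫ t in (0 : ℝ)..1, M.corrUpdate e σ u t * q.eval t = 0 := by
  have hq' := bddMeas.eval_mem q
  have hm := KnotVector.space1_le_bddMeas _ _ (M.meanTrace_mem e hu)
  have hj := KnotVector.space1_le_bddMeas _ _ (M.halfJump_mem e hu)
  have hf := M.trace_mem_bddMeas e false hu
  have hf' := M.trace_mem_bddMeas e true hu
  have h1 : ∫ t in (0 : ℝ)..1, M.traceUpdate e σ u t * q.eval t =
      (∫ t in (0 : ℝ)..1, M.meanTrace e u t * q.eval t) -
        ∫ t in (0 : ℝ)..1, M.trace e σ u t * q.eval t := by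
    rw [← M.integral_proj_mul_eval e hp hr σ hm hq, ← intervalIntegral.integral_sub
      (bddMeas.intervalIntegrable_mul (M.proj_mem_bddMeas e σ _) hq')
      (bddMeas.intervalIntegrable_mul (M.trace_mem_bddMeas e σ hu) hq')]
    simp only [traceUpdate, Pi.sub_apply, sub_mul]
  have h2 : ∫ t in (0 : ℝ)..1, M.corrUpdate e σ u t * q.eval t =
      sideSign σ * ∫ t in (0 : ℝ)..1, M.halfJump e u t * q.eval t := by
    rw [← M.integral_proj_mul_eval e hp hr σ hj hq, ← intervalIntegral.integral_const_mul]
    simp only [corrUpdate, Pi.smul_apply, smul_eq_mul, mul_assoc]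
  have h3 : ∫ t in (0 : ℝ)..1, M.meanTrace e u t * q.eval t =
      1 / 2 * ((∫ t in (0 : ℝ)..1, M.trace e false u t * q.eval t) +
        ∫ t in (0 : ℝ)..1, M.trace e true u t * q.eval t) := by
    rw [← M.integral_proj_mul_eval e hp hr false hf' hq, ← intervalIntegral.integral_add
      (bddMeas.intervalIntegrable_mul hf hq')
      (bddMeas.intervalIntegrable_mul (M.proj_mem_bddMeas e false _) hq'),
      ← intervalIntegral.integral_const_mul]
    simp only [meanTrace, Pi.smul_apply, Pi.add_apply, smul_eq_mul, mul_assoc, add_mul]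
  have h4 : ∫ t in (0 : ℝ)..1, M.halfJump e u t * q.eval t =
      1 / 2 * ((∫ t in (0 : ℝ)..1, M.trace e false u t * q.eval t) -
        ∫ t in (0 : ℝ)..1, M.trace e true u t * q.eval t) := by
    rw [← M.integral_proj_mul_eval e hp hr false hf' hq, ← intervalIntegral.integral_sub
      (bddMeas.intervalIntegrable_mul hf hq')
      (bddMeas.intervalIntegrable_mul (M.proj_mem_bddMeas e false _) hq'),
      ← intervalIntegral.integral_const_mul]
    simp only [halfJump, Pi.smul_apply, Pi.sub_apply, smul_eq_mul, mul_assoc, sub_mul]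
  rw [h1, h2, h3, h4]
  cases σ
  · simp only [sideSign, Bool.false_eq_true, if_false]
    ring
  · simp only [sideSign, if_true]
    ring

include hr in
lemma corrSum_mem_bddMeas (σ : Bool) : M.corrSum e r σ ∈ bddMeas :=
  KnotVector.space0_le_bddMeas _ _ (M.corrSum_mem_space0 e hr σ)

lemma lamPerp_mem_bddMeas (σ : Bool) (j : ℕ) : M.lamPerp e σ j ∈ bddMeas :=
  KnotVector.lam0'_mem_bddMeas _ _ _

include hr in
/-- The correction spline has the moments of the basis function it replaces. -/
lemma integral_corrSum_mul_eval (σ : Bool) {q : Polynomial ℝ}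
    (hq : q ∈ Polynomial.degreeLT ℝ r) :
    ∫ s in (0 : ℝ)..1, M.corrSum e r σ s * q.eval s =
      ∫ s in (0 : ℝ)..1, M.lamPerp e σ 0 s * q.eval s := by
  have hpow : ∀ j : ℕ, (fun s : ℝ => s ^ j) ∈ bddMeas := fun j =>
    bddMeas.of_continuous (continuous_pow j)
  have key : ∀ f ∈ bddMeas, ∫ s in (0 : ℝ)..1, f s * q.eval s =
      ∑ j ∈ Finset.range r, q.coeff j * ∫ s in (0 : ℝ)..1, f s * s ^ j := by
    intro f hf
    simp only [eval_eq_sum_of_mem_degreeLT hq, Finset.mul_sum]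
    have hint : ∀ j ∈ Finset.range r, IntervalIntegrable (fun s => f s * (q.coeff j * s ^ j))
        volume 0 1 := fun j _ => bddMeas.intervalIntegrable_mul hf
      (bddMeas.smul_mem (q.coeff j) (hpow j))
    rw [intervalIntegral.integral_finsetSum hint]
    refine Finset.sum_congr rfl fun j _ => ?_
    rw [← intervalIntegral.integral_const_mul]
    simp only [mul_left_comm]
  rw [key _ (M.corrSum_mem_bddMeas e hr σ), key _ (M.lamPerp_mem_bddMeas e σ 0)]
  refine Finset.sum_congr rfl fun j hj => ?_
  congr 1
  rw [lamPerp, ← KnotVector.gamma_spec _ _ hr (Finset.mem_range.1 hj)]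
  simp only [corrSum, Finset.sum_apply, Pi.smul_apply, smul_eq_mul, Finset.sum_mul, mul_assoc]
  have hint : ∀ m ∈ (Finset.univ : Finset (Fin r)), IntervalIntegrable (fun s =>
      (M.knots (M.patchOf e σ)).gamma (M.frame e σ).flipPerp r m *
        (M.lamPerp e σ (m + 1) s * s ^ j)) volume 0 1 := fun m _ => bddMeas.intervalIntegrable
    (bddMeas.smul_mem _ (bddMeas.mul_mem (M.lamPerp_mem_bddMeas e σ (m + 1)) (hpow j)))
  rw [intervalIntegral.integral_finsetSum hint]
  simp only [intervalIntegral.integral_const_mul]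
  rfl

lemma _root_.Frame.bddOnSquare_mul_coord (A : Frame) {f g : ℝ → ℝ} (hf : f ∈ bddMeas)
    (hg : g ∈ bddMeas) : BddOnSquare fun x => f (A.tCoord x) * g (A.sCoord x) :=
  (BddOnSquare.comp_coord (bddMeas.comp_flipIf A.flipPar hf) A.par).smul
    (BddOnSquare.comp_coord (bddMeas.comp_flipIf A.flipPerp hg) A.par.rev)

/-- The update of a field on one side of the edge has no moments. -/
lemma integral_sideUpdate_mul (hp : 1 ≤ p) (hr : r ≤ p) (σ : Bool) {u : K → Plane → Plane}
    (hu : u ∈ M.broken) {q : Fin 2 → MvPolynomial (Fin 2) ℝ} (hq : ∀ d i, (q d).degreeOf i < r) :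
    ∫ x in openSquare, ∑ d, M.sideUpdate e r σ u x d *
      MvPolynomial.eval (fun i => x i) (q d) = 0 := by
  set A := M.frame e σ with hA
  have ha := KnotVector.space1_le_bddMeas _ _ (M.traceUpdate_mem e σ hu)
  have hb := KnotVector.space1_le_bddMeas _ _ (M.corrUpdate_mem e σ u)
  have hl := M.lamPerp_mem_bddMeas e σ 0
  have hc := M.corrSum_mem_bddMeas e hr σ
  have hpow : ∀ (b : Bool) (j : ℕ), (fun t : ℝ => flipIf b t ^ j) ∈ bddMeas := fun b j =>
    bddMeas.of_continuous ((continuous_flipIf b).pow j)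
  have h1 : ∀ x : Plane, ∑ d, M.sideUpdate e r σ u x d *
      MvPolynomial.eval (fun i => x i) (q d) = ∑ m ∈ (q A.par).support,
        (flipSign A.flipPar * MvPolynomial.coeff m (q A.par)) *
        ((M.traceUpdate e σ u (A.tCoord x) * flipIf A.flipPar (A.tCoord x) ^ m A.par) *
          (M.lamPerp e σ 0 (A.sCoord x) * flipIf A.flipPerp (A.sCoord x) ^ m A.par.rev) +
        (M.corrUpdate e σ u (A.tCoord x) * flipIf A.flipPar (A.tCoord x) ^ m A.par) *
          (M.corrSum e r σ (A.sCoord x) * flipIf A.flipPerp (A.sCoord x) ^ m A.par.rev)) := by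
    intro x
    have hprod : ∀ m : Fin 2 →₀ ℕ, ∏ i, x i ^ m i = x A.par ^ m A.par *
        x A.par.rev ^ m A.par.rev := by
      intro m
      generalize A.par = d
      fin_cases d
      · simp [Fin.prod_univ_two]
      · simp [Fin.prod_univ_two, mul_comm]
    rw [Finset.sum_eq_single A.par]
    · rw [MvPolynomial.eval_eq', Finset.mul_sum]
      refine Finset.sum_congr rfl fun m _ => ?_
      rw [hprod, sideUpdate, Pi.add_apply, PiLp.add_apply, ← hA, Frame.tang_apply_coord,
        Frame.tang_apply_coord, if_pos rfl, if_pos rfl, Frame.tCoord, Frame.sCoord, flipIf_flipIf,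
        flipIf_flipIf]
      ring
    · intro d _ hd
      rw [sideUpdate, Pi.add_apply, PiLp.add_apply, ← hA, Frame.tang_apply_coord,
        Frame.tang_apply_coord, if_neg hd, if_neg hd]
      simp
    · simp
  simp only [h1]
  have hint : ∀ (f g : ℝ → ℝ), f ∈ bddMeas → g ∈ bddMeas → ∀ i j : ℕ,
      IntegrableOn (fun x => (f (A.tCoord x) * flipIf A.flipPar (A.tCoord x) ^ i) *
        (g (A.sCoord x) * flipIf A.flipPerp (A.sCoord x) ^ j)) openSquare :=
    fun f g hf hg i j => (A.bddOnSquare_mul_coord (bddMeas.mul_mem hf (hpow A.flipPar i))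
      (bddMeas.mul_mem hg (hpow A.flipPerp j))).integrableOn
  rw [integral_finsetSum _ fun m _ =>
    ((hint _ _ ha hl (m A.par) (m A.par.rev)).add (hint _ _ hb hc _ _)).const_mul _]
  refine Finset.sum_eq_zero fun m hm => ?_
  have hdeg : ∀ i, m i < r := fun i =>
    (MvPolynomial.monomial_le_degreeOf i hm).trans_lt (hq A.par i)
  obtain ⟨P, hP, hPe⟩ := exists_degreeLT_eval_eq_flipIf_pow A.flipPar (hdeg A.par)
  obtain ⟨Q, hQ, hQe⟩ := exists_degreeLT_eval_eq_flipIf_pow A.flipPerp (hdeg A.par.rev)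
  have hsplit : ∀ f g : ℝ → ℝ, ∫ x in openSquare,
      (f (A.tCoord x) * flipIf A.flipPar (A.tCoord x) ^ m A.par) *
        (g (A.sCoord x) * flipIf A.flipPerp (A.sCoord x) ^ m A.par.rev) =
      (∫ t in (0 : ℝ)..1, f t * P.eval t) * ∫ s in (0 : ℝ)..1, g s * Q.eval s := by
    intro f g
    simp only [hPe, hQe]
    exact A.setIntegral_openSquare_mul (fun t => f t * flipIf A.flipPar t ^ m A.par)
      (fun s => g s * flipIf A.flipPerp s ^ m A.par.rev)
  rw [integral_const_mul, integral_add (hint _ _ ha hl _ _) (hint _ _ hb hc _ _), hsplit, hsplit,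
    M.integral_corrSum_mul_eval e hr σ hQ, ← add_mul, M.integral_update_mul_eval e hp hr σ hu hP]
  simp

lemma momentPreserving_edgeProj [Fintype K] : M.MomentPreserving r (M.edgeProj e hp hr) := by
  intro v k q hq
  set u : K → Plane → Plane := (M.logical hp v : K → Plane → Plane) with hu_def
  have hu : u ∈ M.broken := (M.logical hp v).2
  have h1 := M.isPush_iff.1 (M.isPush_logical hp v) k
  have h2 := M.isPush_iff.1 (M.isPush_logical hp (M.edgeProj e hp hr v)) k
  rw [logical_edgeProj, coe_edgeOp, ← hu_def] at h2
  rw [← hu_def] at h1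
  have hb : ∀ w ∈ M.broken, IntegrableOn
      (fun x => ∑ d, w k x d * MvPolynomial.eval (fun i => x i) (q d)) openSquare := fun w hw =>
    integrable_finsetSum _ fun d _ =>
      ((((M.knots k).bddOnSquare_of_mem_hatV1 (M.mem_broken.1 hw k)).coord d).smul
        (BddOnSquare.of_continuous (continuous_mvPolynomial_eval (q d)))).integrableOn
  have h3 : ∫ x in openSquare, ∑ d, M.edgeUpdate e r u k x d *
      MvPolynomial.eval (fun i => x i) (q d) = 0 := by
    by_cases hk : ∃ σ, k = M.patchOf e σ
    · obtain ⟨σ, rfl⟩ := hk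
      rw [edgeUpdate, sum_onPatch_apply]
      exact M.integral_sideUpdate_mul e hp hr σ hu hq
    · push Not at hk
      rw [edgeUpdate, M.sum_onPatch_apply_of_ne e _ hk]
      simp
  calc _ = ∫ x in openSquare, ((∑ d, u k x d * MvPolynomial.eval (fun i => x i) (q d)) +
        ∑ d, M.edgeUpdate e r u k x d * MvPolynomial.eval (fun i => x i) (q d)) := by
        refine integral_congr_ae ?_
        filter_upwards [h2] with x hx
        rw [hx, ← Finset.sum_add_distrib]
        refine Finset.sum_congr rfl fun d _ => ?_
        rw [Pi.add_apply, Pi.add_apply, PiLp.add_apply, add_mul]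
    _ = ∫ x in openSquare, ∑ d, u k x d * MvPolynomial.eval (fun i => x i) (q d) := by
        rw [integral_add (hb u hu) (hb _ (M.edgeUpdate_mem_broken e hr hu)), h3, add_zero]
    _ = _ := by
        refine integral_congr_ae ?_
        filter_upwards [h1] with x hx
        rw [hx]

end Multipatch

/-! ### Green's formula on the reference square -/

/-- Scalar functions on the closed square to which integration by parts applies. -/
structure IsTest (ψ : Plane → ℝ) : Prop where
  continuousOn : ContinuousOn ψ closedSquare
  differentiableAt : ∀ x ∈ openSquare, DifferentiableAt ℝ ψ x
  continuousOn_fderiv : ContinuousOn (fderiv ℝ ψ) openSquare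
  bounded_fderiv : ∃ C, ∀ x ∈ openSquare, ‖fderiv ℝ ψ x‖ ≤ C

lemma integrableOn_of_continuousOn {h : Plane → ℝ} (hc : ContinuousOn h openSquare)
    (hb : ∃ C, ∀ x ∈ openSquare, ‖h x‖ ≤ C) : IntegrableOn h openSquare := by
  obtain ⟨C, hC⟩ := hb
  refine IntegrableOn.of_bound volume_openSquare_lt_top
    (hc.aestronglyMeasurable measurableSet_openSquare) C ?_
  filter_upwards [ae_restrict_mem measurableSet_openSquare] with x hx using hC x hx

lemma BddOnSquare.integrableOn_mul {c h : Plane → ℝ} (hc : BddOnSquare c)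
    (hh : IntegrableOn h openSquare) : IntegrableOn (fun x => c x * h x) openSquare := by
  obtain ⟨hm, C, hC⟩ := hc
  refine Integrable.bdd_mul (c := C) hh hm.aestronglyMeasurable ?_
  filter_upwards [ae_restrict_mem measurableSet_openSquare] with x hx using hC x hx

namespace IsTest

variable {ψ : Plane → ℝ} (hψ : IsTest ψ)
include hψ

lemma integrableOn : IntegrableOn ψ openSquare := by
  obtain ⟨C, hC⟩ := isCompact_closedSquare.exists_bound_of_continuousOn hψ.continuousOn
  exact integrableOn_of_continuousOn (hψ.continuousOn.mono openSquare_subset)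
    ⟨C, fun x hx => hC x (openSquare_subset hx)⟩

lemma integrableOn_fderiv (y : Plane) : IntegrableOn (fun x => fderiv ℝ ψ x y) openSquare := by
  obtain ⟨C, hC⟩ := hψ.bounded_fderiv
  refine integrableOn_of_continuousOn (hψ.continuousOn_fderiv.clm_apply continuousOn_const)
    ⟨C * ‖y‖, fun x hx => ((fderiv ℝ ψ x).le_opNorm y).trans ?_⟩
  gcongr
  exact hC x hx

lemma continuousOn_edge (A : Frame) {s : ℝ} (hs : s ∈ Icc (0 : ℝ) 1) :
    ContinuousOn (fun t => ψ (A.point t s)) (uIcc 0 1) := by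
  rw [uIcc_of_le zero_le_one]
  exact hψ.continuousOn.comp (A.continuous_prodMap.comp (by fun_prop :
    Continuous fun t : ℝ => (t, s))).continuousOn fun t ht => A.point_mem_closedSquare.2 ⟨ht, hs⟩

/-- Integration by parts in one direction. -/
lemma integral_tensor (d : Fin 2) {f g g' : ℝ → ℝ} (hf : f ∈ bddMeas)
    (hg : ContinuousOn g (Icc 0 1)) (hgb : g ∈ bddMeas) (hg' : g' ∈ bddMeas) {B : Set ℝ}
    (hB : B.Countable)
    (hgg : ∀ s ∉ B, HasDerivAt g (g' s) s) :
    ∫ x in openSquare, f (x d) * (g' (x d.rev) * ψ x + g (x d.rev) *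
        fderiv ℝ ψ x (unitVec d.rev)) =
      ∫ t in (0 : ℝ)..1, f t * (g 1 * ψ ((Frame.mk d false false).point t 1) -
        g 0 * ψ ((Frame.mk d false false).point t 0)) := by
  set A := Frame.mk d false false with hA
  have hpar : ∀ t s, A.point t s d = t := fun t s => A.point_par t s
  have hperp : ∀ t s, A.point t s d.rev = s := fun t s => A.point_perp t s
  have hi1 : IntegrableOn (fun x : Plane => g' (x d.rev) * ψ x + g (x d.rev) *
      fderiv ℝ ψ x (unitVec d.rev)) openSquare :=
    ((BddOnSquare.comp_coord hg' d.rev).integrableOn_mul hψ.integrableOn).add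
      ((BddOnSquare.comp_coord hgb d.rev).integrableOn_mul (hψ.integrableOn_fderiv _))
  have hi2 := (BddOnSquare.comp_coord hf d).integrableOn_mul hi1
  have hi1' := A.integrableOn_openSquare hi1
  have hi2' := A.integrableOn_openSquare hi2
  rw [A.setIntegral_openSquare]
  rw [Measure.volume_eq_prod] at hi1' hi2' ⊢
  rw [setIntegral_prod _ hi2', intervalIntegral.integral_of_le zero_le_one,
    integral_Ioc_eq_integral_Ioo]
  rw [IntegrableOn, ← Measure.prod_restrict] at hi1'
  refine integral_congr_ae ?_
  filter_upwards [hi1'.prod_right_ae, ae_restrict_mem measurableSet_Ioo] with t ht htt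
  simp only [hpar, hperp] at ht ⊢
  rw [integral_const_mul]
  congr 1
  rw [← integral_Ioc_eq_integral_Ioo, ← intervalIntegral.integral_of_le zero_le_one]
  have hderiv : ∀ s ∈ Ioo (0 : ℝ) 1 \ B, HasDerivAt (fun s => g s * ψ (A.point t s))
      (g' s * ψ (A.point t s) + g s * fderiv ℝ ψ (A.point t s) (unitVec d.rev)) s := by
    intro s hs
    refine (hgg s hs.2).mul ?_
    have h1 : HasDerivAt (fun s => A.point t s) (unitVec d.rev) s := by
      have h2 : (fun s => A.point t s) = fun s => A.point t 0 + s • unitVec d.rev := by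
        funext s
        ext i
        revert i
        rw [A.forall_coord]
        constructor
        · simp [PiLp.add_apply, PiLp.smul_apply, unitVec_apply, hA, Frame.point,
            (Fin.rev_ne_self_two d).symm]
        · simp [PiLp.add_apply, PiLp.smul_apply, unitVec_apply, hA, Frame.point,
            Fin.rev_ne_self_two d, flipIf]
      rw [h2]
      simpa using ((hasDerivAt_id s).smul_const (unitVec d.rev)).const_add (A.point t 0)
    exact (hψ.differentiableAt _ (A.point_mem_openSquare.2 ⟨htt, hs.1⟩)).hasFDerivAt.comp_hasDerivAt
      s h1
  refine integral_eq_of_hasDerivAt_off_countable_of_le _ _ zero_le_one hB ?_ hderiv ?_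
  · refine hg.mul (hψ.continuousOn.comp (A.continuous_prodMap.comp (by fun_prop :
      Continuous fun s : ℝ => (t, s))).continuousOn fun s hs => ?_)
    exact A.point_mem_closedSquare.2 ⟨Ioo_subset_Icc_self htt, hs⟩
  · rw [intervalIntegrable_iff_integrableOn_Ioc_of_le zero_le_one,
      integrableOn_Ioc_iff_integrableOn_Ioo]
    exact ht

end IsTest

lemma inner_vcurl (y : Plane) (ψ : Plane → ℝ) (x : Plane) : inner ℝ y (vcurl ψ x) =
    y 0 * fderiv ℝ ψ x (unitVec 1) - y 1 * fderiv ℝ ψ x (unitVec 0) := by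
  simp [vcurl, PiLp.inner_apply, Fin.sum_univ_two]
  ring

/-- The boundary terms of the square in Green's formula: the sum over the sides, numbered by their
direction and by the flip of the perpendicular coordinate, of the tangential traces against `ψ`. The
sign of the frame gives the orientation of the side. -/
noncomputable def boundaryTerm (u : Plane → Plane) (ψ : Plane → ℝ) : ℝ :=
  ∑ a : Fin 2 × Bool, (Frame.mk a.1 false a.2).sgn *
    ∫ t in (0 : ℝ)..1, (Frame.mk a.1 false a.2).trace u t * ψ ((Frame.mk a.1 false a.2).point t 0)

lemma IsTest.integrableOn_inner {ψ : Plane → ℝ} (hψ : IsTest ψ) {u : Plane → Plane}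
    (hu : BddOnSquare u) : IntegrableOn (fun x => inner ℝ (u x) (vcurl ψ x)) openSquare := by
  simp only [inner_vcurl]
  exact ((hu.coord 0).integrableOn_mul (hψ.integrableOn_fderiv _)).sub
    ((hu.coord 1).integrableOn_mul (hψ.integrableOn_fderiv _))

namespace KnotVector

variable {p : ℕ} (Ξ : KnotVector p)

lemma boundaryTerm_hatBasis1 (d : Fin 2) (i j : ℕ) {ψ : Plane → ℝ} (hψ : IsTest ψ) :
     boundaryTerm (Ξ.hatBasis1 d i j) ψ = -((if d = 0 then 1 else -1) *
      ∫ t in (0 : ℝ)..1, Ξ.lam1 i t * (Ξ.lam0 j 1 * ψ ((Frame.mk d false false).point t 1) -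
        Ξ.lam0 j 0 * ψ ((Frame.mk d false false).point t 0))) := by
  have htr : ∀ b, (Frame.mk d false b).trace (Ξ.hatBasis1 d i j) =
      fun t => Ξ.lam1 i t * Ξ.lam0 j (flipIf b 0) := by
    intro b
    funext t
    have h1 := (Frame.mk d false b).point_par t 0
    have h2 := (Frame.mk d false b).point_perp t 0
    simp only at h1 h2
    rw [Frame.trace_apply, Frame.inner_tangent, Ξ.hatBasis1_apply, if_pos rfl, h1, h2]
    simp [flipSign, flipIf]
  have htr' : ∀ b, (Frame.mk d.rev false b).trace (Ξ.hatBasis1 d i j) = 0 := fun b =>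
    Frame.trace_hatBasis1_of_ne _ _ (Fin.rev_ne_self_two d).symm i j
  have hpt : ∀ t, (Frame.mk d false true).point t 0 = (Frame.mk d false false).point t 1 := by
    intro t
    ext k
    simp [Frame.point, flipIf]
  have hsum : boundaryTerm (Ξ.hatBasis1 d i j) ψ = ∑ b : Bool, (Frame.mk d false b).sgn *
      ∫ t in (0 : ℝ)..1, (Frame.mk d false b).trace (Ξ.hatBasis1 d i j) t *
        ψ ((Frame.mk d false b).point t 0) := by
    rw [boundaryTerm, Fintype.sum_prod_type, Finset.sum_eq_single d]
    · intro d' _ hd'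
      have : d' = d.rev := by
        revert hd'
        fin_cases d <;> fin_cases d' <;> simp
      subst this
      simp [htr']
    · simp
  have hl := Ξ.lam1_mem_bddMeas i
  have hint : ∀ (c s : ℝ), s ∈ Icc (0 : ℝ) 1 → IntervalIntegrable (fun t =>
      Ξ.lam1 i t * (c * ψ ((Frame.mk d false false).point t s))) volume 0 1 := fun c s hs =>
    (bddMeas.intervalIntegrable hl).mul_continuousOn
      (continuousOn_const.mul (hψ.continuousOn_edge _ hs))
  rw [hsum, Fintype.sum_bool]
  simp only [htr, hpt, Frame.sgn_eq, mul_sub, mul_assoc]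
  rw [intervalIntegral.integral_sub (hint _ _ (by simp)) (hint _ _ (by simp))]
  simp only [flipSign, flipIf, Bool.false_eq_true, if_false, if_true, one_mul,
    sub_zero]
  ring

/-- Green's formula for the logical splines. -/
lemma exists_curl (hp : 1 ≤ p) {u : Plane → Plane} (hu : u ∈ Ξ.hatV1) :
    ∃ c : Plane → ℝ, BddOnSquare c ∧ ∀ ψ, IsTest ψ →
      ∫ x in openSquare, inner ℝ (u x) (vcurl ψ x) =
        (∫ x in openSquare, c x * ψ x) - boundaryTerm u ψ := by
  unfold hatV1 at hu
  induction hu using Submodule.span_induction with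
  | mem u hu =>
    obtain ⟨⟨d, i, j⟩, rfl⟩ := hu
    have hj : (j : ℕ) ≤ Ξ.n := by omega
    obtain ⟨g', hg', hd⟩ := Ξ.exists_deriv_lam0 hp hj
    have hf := Ξ.lam1_mem_bddMeas i
    have hg := Ξ.lam0_mem_bddMeas j
    refine ⟨fun x => -(if d = 0 then 1 else -1 : ℝ) * (Ξ.lam1 i (x d) * g' (x d.rev)),
      (BddOnSquare.const _).smul ((BddOnSquare.comp_coord hf d).smul
        (BddOnSquare.comp_coord hg' d.rev)), fun ψ hψ => ?_⟩
    have h1 := hψ.integral_tensor d hf (Ξ.continuousOn_lam0 hp hj) hg hg'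
      Ξ.countable_breakpoints hd
    rw [Ξ.boundaryTerm_hatBasis1 d i j hψ, ← h1, sub_neg_eq_add, ← integral_const_mul,
      ← integral_add]
    · refine integral_congr_ae (Filter.Eventually.of_forall fun x => ?_)
      simp only [inner_vcurl, Ξ.hatBasis1_apply]
      fin_cases d
      · simp
        ring
      · simp
        ring
    · exact ((BddOnSquare.const _).smul ((BddOnSquare.comp_coord hf d).smul
        (BddOnSquare.comp_coord hg' d.rev))).integrableOn_mul hψ.integrableOn
    · exact ((BddOnSquare.comp_coord hf d).integrableOn_mul
        (((BddOnSquare.comp_coord hg' d.rev).integrableOn_mul hψ.integrableOn).add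
        ((BddOnSquare.comp_coord hg d.rev).integrableOn_mul
          (hψ.integrableOn_fderiv _)))).const_mul _
  | zero => exact ⟨fun _ => 0, BddOnSquare.const 0, fun ψ _ => by simp [boundaryTerm]⟩
  | add u v hu hv hu' hv' =>
    obtain ⟨c, hc, h⟩ := hu'
    obtain ⟨c', hc', h'⟩ := hv'
    refine ⟨c + c', hc.add hc', fun ψ hψ => ?_⟩
    have hint : ∀ w ∈ Ξ.hatV1, ∀ a : Fin 2 × Bool, IntervalIntegrable (fun t =>
        (Frame.mk a.1 false a.2).trace w t * ψ ((Frame.mk a.1 false a.2).point t 0))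
        volume 0 1 := fun w hw a => (bddMeas.intervalIntegrable (Ξ.space1_le_bddMeas _
      ((Frame.mk a.1 false a.2).trace_mem_space1 Ξ hw))).mul_continuousOn
        (hψ.continuousOn_edge _ (by simp))
    have hb : boundaryTerm (u + v) ψ = boundaryTerm u ψ + boundaryTerm v ψ := by
      simp only [boundaryTerm, map_add, Pi.add_apply, add_mul]
      rw [← Finset.sum_add_distrib]
      refine Finset.sum_congr rfl fun a _ => ?_
      rw [intervalIntegral.integral_add (hint u hu a) (hint v hv a), mul_add]
    simp only [Pi.add_apply, inner_add_left, add_mul]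
    rw [integral_add (hψ.integrableOn_inner (Ξ.bddOnSquare_of_mem_hatV1 hu))
      (hψ.integrableOn_inner (Ξ.bddOnSquare_of_mem_hatV1 hv)), hb, h ψ hψ, h' ψ hψ,
      integral_add (hc.integrableOn_mul hψ.integrableOn) (hc'.integrableOn_mul hψ.integrableOn)]
    ring
  | smul a u hu hu' =>
    obtain ⟨c, hc, h⟩ := hu'
    refine ⟨fun x => a • c x, (BddOnSquare.const a).smul hc, fun ψ hψ => ?_⟩
    have hb : boundaryTerm (a • u) ψ = a * boundaryTerm u ψ := by
      simp only [boundaryTerm, map_smul, Pi.smul_apply, smul_eq_mul, mul_assoc]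
      rw [Finset.mul_sum]
      refine Finset.sum_congr rfl fun a _ => ?_
      rw [intervalIntegral.integral_const_mul]
      ring
    simp only [Pi.smul_apply, real_inner_smul_left, smul_eq_mul, mul_assoc]
    rw [integral_const_mul, integral_const_mul, hb, h ψ hψ]
    ring

end KnotVector

/-! ### Green's formula on a patch -/

namespace IsChart

variable {G : Plane → Plane} (hG : IsChart G)
include hG

lemma hasFDerivAt_comp {φ : Plane → ℝ} (hφ : ContDiff ℝ ∞ φ) {x : Plane} (hx : x ∈ openSquare) :
    HasFDerivAt (φ ∘ G) ((fderiv ℝ φ (G x)).comp (fderivWithin ℝ G closedSquare x)) x :=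
  ((hφ.differentiable (by simp)) (G x)).hasFDerivAt.comp x (hG.hasFDerivAt hx)

lemma isTest_comp {φ : Plane → ℝ} (hφ : ContDiff ℝ ∞ φ) : IsTest (φ ∘ G) := by
  have h1 : ContinuousOn (fun x => (fderiv ℝ φ (G x)).comp (fderivWithin ℝ G closedSquare x))
      closedSquare :=
    ((hφ.continuous_fderiv (by simp)).comp_continuousOn hG.continuousOn).clm_comp
      hG.continuousOn_fderivWithin
  refine ⟨hφ.continuous.comp_continuousOn hG.continuousOn,
    fun x hx => (hG.hasFDerivAt_comp hφ hx).differentiableAt, ?_, ?_⟩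
  · exact (h1.mono openSquare_subset).congr fun x hx => (hG.hasFDerivAt_comp hφ hx).fderiv
  · obtain ⟨C, hC⟩ := isCompact_closedSquare.exists_bound_of_continuousOn h1
    refine ⟨C, fun x hx => ?_⟩
    rw [(hG.hasFDerivAt_comp hφ hx).fderiv]
    exact hC x (openSquare_subset hx)

/-- The vector curl is transformed by the Piola transform. -/
lemma fderivWithin_vcurl {φ : Plane → ℝ} (hφ : ContDiff ℝ ∞ φ) {x : Plane} (hx : x ∈ openSquare) :
    fderivWithin ℝ G closedSquare x (vcurl (φ ∘ G) x) =
      (fderivWithin ℝ G closedSquare x).det • vcurl φ (G x) := by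
  set D := fderivWithin ℝ G closedSquare x
  have h1 : vcurl (φ ∘ G) x = fderiv ℝ φ (G x) (D (unitVec 1)) • unitVec 0 -
      fderiv ℝ φ (G x) (D (unitVec 0)) • unitVec 1 := by
    rw [vcurl, (hG.hasFDerivAt_comp hφ hx).fderiv]
    ext i
    fin_cases i <;> simp [unitVec_apply, D]
  have h2 : ∀ y : Plane, fderiv ℝ φ (G x) y = y 0 * fderiv ℝ φ (G x) (unitVec 0) +
      y 1 * fderiv ℝ φ (G x) (unitVec 1) := by
    intro y
    conv_lhs => rw [plane_eq y]
    simp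
  rw [h1, map_sub, map_smul, map_smul, h2 (D (unitVec 1)), h2 (D (unitVec 0)), det_plane]
  ext i
  fin_cases i <;> simp [vcurl] <;> ring

/-- The pairing of a covariantly transformed field with a vector curl is invariant, up to the
volume element. -/
lemma det_mul_inner_pushforward {φ : Plane → ℝ} (hφ : ContDiff ℝ ∞ φ) (u : Plane → Plane)
    {x : Plane} (hx : x ∈ openSquare) :
    (fderivWithin ℝ G closedSquare x).det * inner ℝ (pushforward G u (G x)) (vcurl φ (G x)) =
      inner ℝ (u x) (vcurl (φ ∘ G) x) := by
  rw [← real_inner_smul_right, ← hG.fderivWithin_vcurl hφ hx,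
    ← ContinuousLinearMap.adjoint_inner_left, hG.adjoint_pushforward u hx]

end IsChart

/-! ### Green's formula on the multipatch domain -/

/-- The weak curl of a pushed forward field is square integrable. -/
lemma IsChart.memLp_div_det {G : Plane → Plane} (hG : IsChart G) {c : Plane → ℝ}
    (hc : BddOnSquare c) : MemLp (fun y => (fderivWithin ℝ G closedSquare
      (Function.invFunOn G openSquare y)).det⁻¹ * c (Function.invFunOn G openSquare y)) 2
      (volume.restrict (G '' openSquare)) := by
  have hm : MeasurableSet (G '' openSquare) := hG.isOpen_image.measurableSet
  have hfin : IsFiniteMeasure (volume.restrict (G '' openSquare)) := hG.isFiniteMeasure_image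
  have hmaps : MapsTo (Function.invFunOn G openSquare) (G '' openSquare) closedSquare := by
    rintro _ ⟨x, hx, rfl⟩
    rw [hG.invFunOn_apply hx]
    exact openSquare_subset hx
  have hdet : ContinuousOn (fun x => (fderivWithin ℝ G closedSquare x).det⁻¹) closedSquare :=
    (ContinuousLinearMap.continuous_det.comp_continuousOn hG.continuousOn_fderivWithin).inv₀
      hG.det_ne_zero
  obtain ⟨C, hC⟩ := hc.bounded
  obtain ⟨B, hB⟩ := isCompact_closedSquare.exists_bound_of_continuousOn hdet
  have h1 := (hdet.comp hG.continuousOn_invFunOn hmaps).aestronglyMeasurable hm (μ := volume)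
  have h2 : AEStronglyMeasurable (fun y => c (Function.invFunOn G openSquare y))
      (volume.restrict (G '' openSquare)) :=
    (hc.measurable.comp_aemeasurable
      (hG.continuousOn_invFunOn.aemeasurable hm (μ := volume))).aestronglyMeasurable
  refine MemLp.of_bound (h1.mul h2) (B * C) ?_
  filter_upwards [ae_restrict_mem hm] with y hy
  obtain ⟨x, hx, rfl⟩ := hy
  rw [hG.invFunOn_apply hx, norm_mul]
  exact mul_le_mul (hB x (openSquare_subset hx)) (hC x hx) (norm_nonneg _)
    ((norm_nonneg _).trans (hB x (openSquare_subset hx)))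

/-- The boundary term of one side does not depend on the direction of the coordinate along it. -/
lemma Frame.sgn_mul_integral_trace (A : Frame) (u : Plane → Plane) (ψ : Plane → ℝ) :
    A.sgn * ∫ t in (0 : ℝ)..1, A.trace u t * ψ (A.point t 0) =
      (Frame.mk A.par false A.flipPerp).sgn *
        ∫ t in (0 : ℝ)..1, (Frame.mk A.par false A.flipPerp).trace u t *
          ψ ((Frame.mk A.par false A.flipPerp).point t 0) := by
  set B := Frame.mk A.par false A.flipPerp with hB
  have hpt : ∀ t, A.point t 0 = B.point (flipIf A.flipPar t) 0 := fun t => by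
    ext i
    simp [Frame.point, hB, flipIf]
  have htr : ∀ t, A.trace u t = flipSign A.flipPar * B.trace u (flipIf A.flipPar t) := fun t => by
    rw [Frame.trace_apply, Frame.trace_apply, Frame.inner_tangent, Frame.inner_tangent, hpt]
    simp [hB, flipSign]
  have hs : A.sgn = flipSign A.flipPar * B.sgn := by
    rw [Frame.sgn_eq, Frame.sgn_eq]
    simp only [hB, flipSign, Bool.false_eq_true, if_false]
    ring
  simp only [hpt, htr, mul_assoc]
  rw [intervalIntegral.integral_const_mul,
    integral_flipIf A.flipPar fun t => B.trace u t * ψ (B.point t 0), hs]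
  linear_combination (B.sgn * ∫ t in (0 : ℝ)..1, B.trace u t * ψ (B.point t 0)) *
    flipSign_mul_self A.flipPar

namespace Multipatch

variable {K E : Type*} {p : ℕ} (M : Multipatch K E p)

/-- Integrals over the domain as integrals over the reference squares. -/
lemma integral_domain [Fintype K] {f : Plane → ℝ} (hf : IntegrableOn f M.domain) :
    ∫ y in M.domain, f y = ∑ k, M.orient k * ∫ x in openSquare,
      (fderivWithin ℝ (M.F k) closedSquare x).det * f (M.F k x) := by
  have hsub : (⋃ k, M.patch k) ⊆ M.domain := iUnion_subset M.patch_subset_domain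
  have h1 : ∫ y in M.domain, f y = ∫ y in ⋃ k, M.patch k, f y := by
    refine setIntegral_congr_set (Filter.EventuallyLE.antisymm ?_ hsub.eventuallyLE)
    exact ae_le_set.2 M.volume_domain_diff
  rw [h1, integral_iUnion_fintype (fun k => (M.isOpen_patch k).measurableSet)
    (fun k l h => M.disjoint k l h) fun k => hf.mono_set (M.patch_subset_domain k)]
  refine Finset.sum_congr rfl fun k _ => ?_
  rw [patch, (M.chart k).setIntegral_image, ← integral_const_mul]
  refine setIntegral_congr_fun measurableSet_openSquare fun x hx => ?_
  simp only [M.abs_det k (openSquare_subset hx), smul_eq_mul, mul_assoc]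

lemma continuousOn_edgeCurve (e : E) : ContinuousOn (M.edgeCurve e) (Icc 0 1) :=
  (M.chart _).continuousOn.comp ((M.frame e false).continuous_prodMap.comp (by fun_prop :
    Continuous fun t : ℝ => (t, (0 : ℝ)))).continuousOn
    fun _ ht => (M.frame e false).edge_mem_closedSquare ht

/-- The boundary terms of the patches reduce to the jumps over the interior edges. -/
lemma sum_boundaryTerm [Fintype K] [Fintype E] {u : K → Plane → Plane} (hu : u ∈ M.broken)
    {φ : Plane → ℝ} (hφ : Continuous φ) (hsupp : tsupport φ ⊆ M.domain) :
    ∑ k, M.orient k * boundaryTerm (u k) (φ ∘ M.F k) =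
      ∑ e, M.orient (M.patchOf e false) * (M.frame e false).sgn * ∫ t in (0 : ℝ)..1,
        (M.trace e false u t - M.trace e true u t) * φ (M.edgeCurve e t) := by
  set S : K × Fin 2 × Bool → ℝ := fun a => M.orient a.1 * ((Frame.mk a.2.1 false a.2.2).sgn *
    ∫ t in (0 : ℝ)..1, (Frame.mk a.2.1 false a.2.2).trace (u a.1) t *
      φ (M.edgePoint a.1 (Frame.mk a.2.1 false a.2.2) t)) with hS
  set ι : E × Bool → K × Fin 2 × Bool := fun b =>
    (M.patchOf b.1 b.2, (M.frame b.1 b.2).par, (M.frame b.1 b.2).flipPerp) with hι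
  have hι_inj : Function.Injective ι := by
    rintro ⟨e, σ⟩ ⟨e', σ'⟩ h
    simp only [hι, Prod.mk.injEq] at h
    obtain ⟨rfl, rfl⟩ := M.side_injective h.1 h.2.1 h.2.2
    rfl
  have h1 : ∑ k, M.orient k * boundaryTerm (u k) (φ ∘ M.F k) = ∑ a, S a := by
    rw [Fintype.sum_prod_type]
    refine Finset.sum_congr rfl fun k _ => ?_
    rw [boundaryTerm, Finset.mul_sum]
    rfl
  have h2 : ∑ b : E × Bool, M.orient (M.patchOf b.1 b.2) * ((M.frame b.1 b.2).sgn *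
      ∫ t in (0 : ℝ)..1, M.trace b.1 b.2 u t *
        φ (M.edgePoint (M.patchOf b.1 b.2) (M.frame b.1 b.2) t)) = ∑ a, S a := by
    -- the sides which are no interior edges do not meet the support of `φ`
    refine Fintype.sum_of_injective ι hι_inj _ _ (fun a ha => ?_) fun b => ?_
    · obtain ⟨k, d, c⟩ := a
      have h3 : ∫ t in (0 : ℝ)..1, (Frame.mk d false c).trace (u k) t *
          φ (M.edgePoint k (Frame.mk d false c) t) = ∫ t in (0 : ℝ)..1, (0 : ℝ) := by
        refine intervalIntegral_congr_Ioo ?_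
        filter_upwards [ae_restrict_mem measurableSet_Ioo] with t ht
        have h4 : M.edgePoint k (Frame.mk d false c) t ∉ M.domain := by
          refine M.edgePoint_notMem_domain ht fun e σ h1 h2 h3 => ha ⟨(e, σ), ?_⟩
          simp only [hι, h1, h2, h3]
        rw [image_eq_zero_of_notMem_tsupport fun h => h4 (hsupp h), mul_zero]
      simp only [hS, h3]
      simp
    · have := (M.frame b.1 b.2).sgn_mul_integral_trace (u (M.patchOf b.1 b.2))
        (φ ∘ M.F (M.patchOf b.1 b.2))
      exact congrArg (M.orient (M.patchOf b.1 b.2) * ·) this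
  rw [h1, ← h2, Fintype.sum_prod_type]
  refine Finset.sum_congr rfl fun e _ => ?_
  rw [Fintype.sum_bool]
  have hcurve : ∀ σ, ∫ t in (0 : ℝ)..1, M.trace e σ u t *
      φ (M.edgePoint (M.patchOf e σ) (M.frame e σ) t) =
      ∫ t in (0 : ℝ)..1, M.trace e σ u t * φ (M.edgeCurve e t) := by
    intro σ
    refine intervalIntegral.integral_congr fun t ht => ?_
    rw [uIcc_of_le zero_le_one] at ht
    simp only [M.edgePoint_eq e σ ht]
  have hint : ∀ σ, IntervalIntegrable (fun t => M.trace e σ u t * φ (M.edgeCurve e t))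
      volume 0 1 := by
    intro σ
    refine (bddMeas.intervalIntegrable (M.trace_mem_bddMeas e σ hu)).mul_continuousOn ?_
    rw [uIcc_of_le zero_le_one]
    exact hφ.comp_continuousOn (M.continuousOn_edgeCurve e)
  have hsgn := M.orient_mul_sgn_edge e
  simp only [hcurve, sub_mul]
  rw [intervalIntegral.integral_sub (hint false) (hint true)]
  linear_combination (∫ t in (0 : ℝ)..1, M.trace e true u t * φ (M.edgeCurve e t)) * hsgn

/-- Green's formula for the fields in the broken space. -/
lemma exists_green [Fintype K] [Fintype E] (hp : 1 ≤ p) (v : M.V1pw) :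
    ∃ w : Lp ℝ 2 (volume.restrict M.domain), ∀ φ : Plane → ℝ, ContDiff ℝ ∞ φ →
      HasCompactSupport φ → tsupport φ ⊆ M.domain →
      ∫ y in M.domain, inner ℝ ((v : L2Field M.domain) y) (vcurl φ y) =
        (∫ y in M.domain, w y * φ y) -
        ∑ e, M.orient (M.patchOf e false) * (M.frame e false).sgn * ∫ t in (0 : ℝ)..1,
          (M.trace e false (M.logical hp v : K → Plane → Plane) t -
            M.trace e true (M.logical hp v : K → Plane → Plane) t) * φ (M.edgeCurve e t) := by
  set u : K → Plane → Plane := (M.logical hp v : K → Plane → Plane) with hu_def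
  have hu : u ∈ M.broken := (M.logical hp v).2
  have hpush : M.IsPush (v : L2Field M.domain) u := M.isPush_logical hp v
  choose c hc hgreen using fun k => (M.knots k).exists_curl hp (M.mem_broken.1 hu k)
  obtain ⟨w, hw⟩ := M.exists_glue fun k => (M.chart k).memLp_div_det (hc k)
  refine ⟨w, fun φ hφ hφc hφs => ?_⟩
  rw [← M.sum_boundaryTerm hu hφ.continuous hφs,
    M.integral_domain (integrable_inner_vcurl (v : L2Field M.domain) hφ hφc),
    M.integral_domain (integrable_mul_test w hφ hφc), ← Finset.sum_sub_distrib]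
  refine Finset.sum_congr rfl fun k _ => ?_
  rw [← mul_sub]
  congr 1
  have h1 : ∫ x in openSquare, (fderivWithin ℝ (M.F k) closedSquare x).det *
      inner ℝ ((v : L2Field M.domain) (M.F k x)) (vcurl φ (M.F k x)) =
      ∫ x in openSquare, inner ℝ (u k x) (vcurl (φ ∘ M.F k) x) := by
    refine integral_congr_ae ?_
    filter_upwards [M.ae_patch_iff.1 (hpush k), ae_restrict_mem measurableSet_openSquare]
      with x hx hxs
    rw [hx, (M.chart k).det_mul_inner_pushforward hφ (u k) hxs]
  have h2 : ∫ x in openSquare, (fderivWithin ℝ (M.F k) closedSquare x).det *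
      (w (M.F k x) * φ (M.F k x)) = ∫ x in openSquare, c k x * (φ ∘ M.F k) x := by
    refine integral_congr_ae ?_
    filter_upwards [M.ae_patch_iff.1 (hw k), ae_restrict_mem measurableSet_openSquare]
      with x hx hxs
    have hd := (M.chart k).det_ne_zero x (openSquare_subset hxs)
    rw [hx, (M.chart k).invFunOn_apply hxs, Function.comp_apply]
    field_simp
  rw [h1, h2, hgreen k _ ((M.chart k).isTest_comp hφ)]

end Multipatch

/-! ### Conforming fields are the fields with continuous tangential component -/

namespace Multipatch

variable {K E : Type*} {p : ℕ} (M : Multipatch K E p)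

lemma injOn_edgeCurve (e : E) : InjOn (M.edgeCurve e) (Icc 0 1) := fun t ht t' ht' h => by
  have h1 := (M.chart _).injOn ((M.frame e false).edge_mem_closedSquare ht)
    ((M.frame e false).edge_mem_closedSquare ht') h
  rw [← (M.frame e false).tCoord_point t 0, h1, Frame.tCoord_point]

lemma orient_mul_sgn_ne_zero (k : K) (A : Frame) : M.orient k * A.sgn ≠ 0 :=
  mul_ne_zero (fun h => by simpa [h] using M.orient_mul_self k)
    (fun h => by simpa [h] using A.sgn_mul_self)

/-- The part of the domain which does not meet the other interior edges. -/
def edgeNhd (e : E) : Set Plane := M.domain \ ⋃ e' : {e' // e' ≠ e}, M.edgeCurve e' '' Icc 0 1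

lemma isOpen_edgeNhd [Finite E] (e : E) : IsOpen (M.edgeNhd e) :=
  M.isOpen_domain.sdiff (isClosed_iUnion_of_finite fun e' =>
    (isCompact_Icc.image_of_continuousOn (M.continuousOn_edgeCurve e')).isClosed)

lemma edgeCurve_mem_edgeNhd (e : E) {t : ℝ} (ht : t ∈ Ioo (0 : ℝ) 1) :
    M.edgeCurve e t ∈ M.edgeNhd e :=
  ⟨M.edgeCurve_mem_domain e ht, fun h => by
    obtain ⟨e', he'⟩ := mem_iUnion.1 h
    exact M.edgeCurve_notMem e'.2.symm ht he'⟩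

/-- The fundamental lemma of the calculus of variations on an interior edge. -/
lemma ae_eq_zero_of_integral_edgeCurve [Finite E] (e : E) {f : ℝ → ℝ} (hf : f ∈ bddMeas)
    (h : ∀ φ : Plane → ℝ, ContDiff ℝ ∞ φ → HasCompactSupport φ → tsupport φ ⊆ M.edgeNhd e →
      ∫ t in (0 : ℝ)..1, f t * φ (M.edgeCurve e t) = 0) :
    ∀ᵐ t ∂volume.restrict (Icc (0 : ℝ) 1), f t = 0 := by
  -- transport `f` to the image measure on the curve
  set γ : Icc (0 : ℝ) 1 → Plane := (Icc (0 : ℝ) 1).domRestrict (M.edgeCurve e) with hγ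
  have hγi : Function.Injective γ := (M.injOn_edgeCurve e).injective
  have hγc : Continuous γ := (M.continuousOn_edgeCurve e).domRestrict
  have hγm : MeasurableEmbedding γ := (hγc.isClosedEmbedding hγi).measurableEmbedding
  set ν : Measure (Icc (0 : ℝ) 1) := Measure.comap Subtype.val volume with hν
  have hνfin : IsFiniteMeasure ν := by
    refine ⟨?_⟩
    rw [hν, (MeasurableEmbedding.subtype_coe measurableSet_Icc).comap_apply, image_univ,
      Subtype.range_coe]
    exact isCompact_Icc.measure_lt_top
  set g : Plane → ℝ := Function.extend γ (fun t => f t) 0 with hg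
  have hgγ : ∀ t : Icc (0 : ℝ) 1, g (γ t) = f t := fun t => hγi.extend_apply _ _ t
  obtain ⟨hfm, C, hC⟩ := hf
  have hgi : Integrable g (Measure.map γ ν) := by
    rw [hγm.integrable_map_iff]
    refine Integrable.of_bound (C := C) ?_ (Filter.Eventually.of_forall fun t => ?_)
    · exact ((hγm.measurable_extend (hfm.comp measurable_subtype_coe)
        measurable_const).comp hγm.measurable).aestronglyMeasurable
    · rw [Function.comp_apply, hgγ]
      exact hC t t.2
  have key := (M.isOpen_edgeNhd e).ae_eq_zero_of_integral_contDiff_smul_eq_zero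
    (hgi.locallyIntegrable.locallyIntegrableOn _) fun φ hφ hφc hφs => by
      rw [hγm.integral_map]
      simp only [hgγ, smul_eq_mul]
      refine Eq.trans ?_ (h φ hφ hφc hφs)
      rw [intervalIntegral.integral_of_le zero_le_one, ← integral_Icc_eq_integral_Ioc,
        ← integral_subtype_comap measurableSet_Icc]
      exact integral_congr_ae (Filter.Eventually.of_forall fun t => mul_comm _ _)
  rw [hγm.ae_map_iff] at key
  replace key := (ae_restrict_iff_subtype measurableSet_Icc
    (p := fun t => M.edgeCurve e t ∈ M.edgeNhd e → g (M.edgeCurve e t) = 0)).2 key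
  rw [← restrict_Ioo_eq_restrict_Icc] at key ⊢
  filter_upwards [key, ae_restrict_mem measurableSet_Ioo] with t ht htt
  rw [← ht (M.edgeCurve_mem_edgeNhd e htt)]
  exact (hgγ ⟨t, Ioo_subset_Icc_self htt⟩).symm

/-- By Green's formula, a field of the broken space has a weak curl if and only if it has no
tangential jumps. -/
lemma mem_V1h_iff [Fintype K] [Fintype E] (hp : 1 ≤ p) {v : M.V1pw} :
    v ∈ M.V1h ↔ ∀ e, M.TangentiallyContinuous e v := by
  obtain ⟨w, hw⟩ := M.exists_green hp v
  set u : K → Plane → Plane := (M.logical hp v : K → Plane → Plane) with hu_def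
  have hu : u ∈ M.broken := (M.logical hp v).2
  have hjump : ∀ e, M.TangentiallyContinuous e v ↔ ∀ᵐ t ∂volume.restrict (Icc (0 : ℝ) 1),
      M.trace e false u t - M.trace e true u t = 0 := fun e => by
    simp only [M.tangentiallyContinuous_iff e hp, sub_eq_zero, hu_def]
  constructor
  · rintro ⟨w', hw'⟩ e
    have hdiff : ∀ φ : Plane → ℝ, ContDiff ℝ ∞ φ → HasCompactSupport φ →
        tsupport φ ⊆ M.domain → ∫ y in M.domain, φ y • (w y - w' y) =
          ∑ e, M.orient (M.patchOf e false) * (M.frame e false).sgn * ∫ t in (0 : ℝ)..1,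
            (M.trace e false u t - M.trace e true u t) * φ (M.edgeCurve e t) := by
      intro φ hφ hφc hφs
      have h1 : ∫ y in M.domain, inner ℝ ((v : L2Field M.domain) y) (vcurl φ y) =
        ∫ y in M.domain, w' y * φ y := hw' φ hφ hφc hφs
      rw [hw φ hφ hφc hφs] at h1
      have h2 : ∀ y, φ y • (w y - w' y) = w y * φ y - w' y * φ y := fun y => by
        rw [smul_eq_mul]
        ring
      simp only [h2]
      rw [integral_sub (integrable_mul_test w hφ hφc) (integrable_mul_test w' hφ hφc), ← h1]
      ring
    have hzero : ∀ (e : E) {φ : Plane → ℝ}, (∀ t ∈ Icc (0 : ℝ) 1, φ (M.edgeCurve e t) = 0) →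
        ∫ t in (0 : ℝ)..1, (M.trace e false u t - M.trace e true u t) *
          φ (M.edgeCurve e t) = 0 := by
      intro e φ hφ
      refine Eq.trans (intervalIntegral.integral_congr (g := fun _ => (0 : ℝ)) fun t ht => ?_)
        intervalIntegral.integral_zero
      rw [uIcc_of_le zero_le_one] at ht
      simp only [hφ t ht, mul_zero]
    -- test functions with support in the patches show that the two weak curls agree
    have hww : ∀ᵐ y ∂volume.restrict M.domain, w y - w' y = 0 := by
      refine M.ae_domain_of_forall_patch fun k =>
        (M.ae_patch_iff (P := fun y => w y - w' y = 0)).1 ?_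
      refine (M.isOpen_patch k).ae_eq_zero_of_integral_contDiff_smul_eq_zero
        (LocallyIntegrable.locallyIntegrableOn ?_ _) fun φ hφ hφc hφs => ?_
      · exact ((Lp.memLp w).locallyIntegrable (by norm_num)).sub
          ((Lp.memLp w').locallyIntegrable (by norm_num))
      · rw [hdiff φ hφ hφc (hφs.trans (M.patch_subset_domain k))]
        refine Finset.sum_eq_zero fun e _ => ?_
        rw [hzero e fun t ht => image_eq_zero_of_notMem_tsupport fun h =>
          M.edgePoint_notMem_patch _ _ ht k (hφs h), mul_zero]
    -- now test functions which only meet the edge `e` isolate its jump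
    rw [hjump]
    refine M.ae_eq_zero_of_integral_edgeCurve e (Subalgebra.sub_mem _
      (M.trace_mem_bddMeas e false hu) (M.trace_mem_bddMeas e true hu)) fun φ hφ hφc hφs => ?_
    have h1 := hdiff φ hφ hφc (hφs.trans sdiff_subset)
    rw [integral_eq_zero_of_ae (by filter_upwards [hww] with y hy; simp [hy]),
      Finset.sum_eq_single e] at h1
    · exact (mul_eq_zero.1 h1.symm).resolve_left (M.orient_mul_sgn_ne_zero _ _)
    · intro e' _ he'
      rw [hzero e' fun t ht => image_eq_zero_of_notMem_tsupport fun h =>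
        (hφs h).2 (mem_iUnion.2 ⟨⟨e', he'⟩, t, ht, rfl⟩), mul_zero]
    · simp
  · intro h
    refine ⟨w, fun φ hφ hφc hφs => ?_⟩
    refine (hw φ hφ hφc hφs).trans ?_
    rw [Finset.sum_eq_zero, sub_zero]
    intro e _
    rw [intervalIntegral_congr_Ioo (g := fun _ => 0), intervalIntegral.integral_zero, mul_zero]
    have h1 := ae_restrict_of_ae_restrict_of_subset Ioo_subset_Icc_self ((hjump e).1 (h e))
    filter_upwards [h1] with t ht
    rw [ht, zero_mul]

end Multipatch

/-! ### The product of the edge projections -/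

namespace Multipatch

variable {K E : Type*} {p : ℕ} {M : Multipatch K E p}

/-- The product of all edge projections does not depend on their order. -/
lemma prod_map_eq {P : E → Module.End ℝ M.V1pw} (hP : ∀ e e', Commute (P e) (P e'))
    {l l' : List E} (hl : l.Nodup) (hl' : l'.Nodup) (h : ∀ e, e ∈ l) (h' : ∀ e, e ∈ l') :
    (l.map P).prod = (l'.map P).prod := by
  have hperm : l.Perm l' := (List.perm_ext_iff_of_nodup hl hl').2 fun e => by simp [h, h']
  refine (hperm.map P).prod_eq' ?_
  rw [List.pairwise_map]
  exact List.pairwise_of_forall fun e e' => hP e e'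

lemma momentPreserving_prod {r : ℕ} {P : E → Module.End ℝ M.V1pw}
    (hP : ∀ e, M.MomentPreserving r (P e)) (l : List E) :
    M.MomentPreserving r (l.map P).prod := by
  induction l with
  | nil => exact fun v k q _ => rfl
  | cons e l ih =>
    intro v k q hq
    rw [List.map_cons, List.prod_cons]
    exact (hP e _ k q hq).trans (ih v k q hq)

lemma prod_apply_eq_self {P : E → Module.End ℝ M.V1pw} {v : M.V1pw} (hP : ∀ e, P e v = v)
    (l : List E) : (l.map P).prod v = v := by
  induction l with
  | nil => rfl
  | cons e l ih => rw [List.map_cons, List.prod_cons, Module.End.mul_apply, ih, hP]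

end Multipatch

theorem mainTheorem2 {K E : Type*} [Fintype K] [Fintype E] {p : ℕ} (hp : 1 ≤ p)
    (M : Multipatch K E p) (r : ℕ) (hr : r ≤ p) :
    (∀ e : E, ∃! T : M.V1pw →ₗ[ℝ] M.V1pw, M.IsEdgeProjection e r T) ∧
    ∀ P : E → (M.V1pw →ₗ[ℝ] M.V1pw), (∀ e, M.IsEdgeProjection e r (P e)) →
      (∀ e e', P e ∘ₗ P e' = P e' ∘ₗ P e) ∧
      ∃ P1 : M.V1pw →ₗ[ℝ] M.V1pw,
        (∀ l : List E, l.Nodup → (∀ e, e ∈ l) →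
          (l.map fun e => (P e : Module.End ℝ M.V1pw)).prod = P1) ∧
        LinearMap.IsProj M.V1h P1 ∧
        (∀ v e, M.TangentiallyContinuous e (P1 v)) ∧
        M.MomentPreserving r P1 := by
  classical
  refine ⟨fun e => ⟨M.edgeProj e hp hr, M.isEdgeProjection_edgeProj e hp hr,
    fun T hT => Multipatch.IsEdgeProjection.unique hp hT (M.isEdgeProjection_edgeProj e hp hr)⟩,
    fun P hP => ?_⟩
  obtain rfl : P = fun e => M.edgeProj e hp hr := funext fun e =>
    Multipatch.IsEdgeProjection.unique hp (hP e) (M.isEdgeProjection_edgeProj e hp hr)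
  have hcomm := M.edgeProj_comm hp hr
  have hnd : (Finset.univ : Finset E).toList.Nodup := Finset.nodup_toList _
  have hmem : ∀ e, e ∈ (Finset.univ : Finset E).toList := fun e => by simp
  set P : E → Module.End ℝ M.V1pw := fun e => M.edgeProj e hp hr
  have hprod := fun (l : List E) (hl : l.Nodup) (h : ∀ e, e ∈ l) =>
    Multipatch.prod_map_eq (P := P) hcomm hl hnd h hmem
  have htc : ∀ v e, M.TangentiallyContinuous e
      (((Finset.univ : Finset E).toList.map P).prod v) := by
    intro v e
    -- the factor which belongs to the edge `e` can be applied last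
    have h1 := hprod (e :: (Finset.univ : Finset E).toList.erase e)
      (List.nodup_cons.2 ⟨hnd.not_mem_erase, hnd.erase e⟩) fun e' => by
        rw [List.mem_cons, hnd.mem_erase_iff]
        by_cases he : e' = e <;> simp [he]
    rw [← h1, List.map_cons, List.prod_cons, Module.End.mul_apply]
    exact M.tangentiallyContinuous_edgeProj e hp hr _
  refine ⟨hcomm, ((Finset.univ : Finset E).toList.map P).prod, hprod, ⟨fun v => ?_, fun v hv => ?_⟩,
    htc, Multipatch.momentPreserving_prod (fun e => M.momentPreserving_edgeProj e hp hr) _⟩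
  · exact (M.mem_V1h_iff hp).2 (htc v)
  · exact Multipatch.prod_apply_eq_self (fun e =>
      M.edgeProj_of_tangentiallyContinuous e hp hr ((M.mem_V1h_iff hp).1 hv e)) _
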